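/- **Setting.** Let $R$ be a real closed field, $C=R[i]$ its algebraic closure, and $k\subseteq R$ a subfield (for instance $k$ an ordered field and $R$ its real closure). Write $k[\boldsymbol y]=k[y_1,\dots,y_n]$, with $n\ge 0$, and let $\pi:R^{n+1}\to R^n$, $(\boldsymbol y,x)\mapsto \boldsymbol y$. For an ideal $I$ and a polynomial $h$, the *basic constructible set* $V(I)\cap D(h)$ is the locus $I=0$, $h\neq 0$; for a basic constructible set $T$, $T(R)$ denotes its $R$-rational points. A semi-algebraic set $S\subseteq R^n$ is *semi-algebraically connected* if it is not the disjoint union of two non-empty semi-algebraic subsets that are closed in $S$ for the Euclidean topology. **Geometric delineability.** Let $T=V(I)\cap D(h)$ with $I\unlhd R[\boldsymbol y,x]$, $h\in R[\boldsymbol y,x]$, and let $S\subseteq R^n$ be a semi-algebraically connected semi-algebraic set. $T$ is *geometrically delineable* over $S$ with *sections* $\xi_1,\dots,\xi_m$ if (1) the number of distinct $t\in C$ with $f(a;t)=0$ for all $f\in I$ and $h(a;t)\ne0$ is finite and the same for all $a\in S$; (2) the $\xi_i:S\to T(R)$ are continuous semi-algebraic maps with $\pi\circ\xi_i=\mathrm{id}_S$,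 strictly increasing in $i$ in the last coordinate; (3) every $t\in T(R)$ with $\pi(t)\in S$ equals $\xi_i(\pi(t))$ for exactly one $i$. By convention, if $T\cap(S\times R)=D(g)\cap(S\times R)$ for some $g\in R[\boldsymbol y,x]$, then $T$ is also called geometrically delineable over $S$ whenever $V(g)$ is, with the sections of $V(g)$. A family of basic constructible sets is geometrically delineable over $S$ if every member is, and any two sections (of the same or of different members) are either identical or disjoint. **Algorithms.** Fix monomial orders $T_{\boldsymbol y}$ on the monomials in $\boldsymbol y$ and $T_{x,z}$ on the monomials in $x,z$. $\mathtt{PrimeDecomposition}(J)$ is the list of the minimal primes over $J$, and $\mathtt{LC}_{x}$, $\mathtt{LC}_{T_{x,z}}$ denote leading coefficients in $k[\boldsymbol y]$ of polynomials in $x$, resp. in $x,z$, over $k[\boldsymbol y]$. $\mathtt{Proj2Sub}(I_0,J_0,h',w)$, where $I_0\unlhd k[\boldsymbol y,x]$, $J_0\unlhd k[\boldsymbol y]$ is prime, $J_0\subseteq I_0\cap k[\boldsymbol y]$, $h'\in k[\boldsymbol y,x]$, $w\in k[\boldsymbol y]$: 1. Let $\mathcal G$ be the reduced Gröbner basis of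 $I_0\,k[\boldsymbol y,x,z]+\langle zh'-1\rangle$ for the block order $T_{x,z}>T_{\boldsymbol y}$. 2. If $1\in I_0$, return $\varnothing$. 3. If $I_0\cap k[\boldsymbol y]\neq J_0$, let $\{J_i\}=\mathtt{PrimeDecomposition}(I_0\cap k[\boldsymbol y])$ and return $\bigcup_i\mathtt{Proj2Sub}(I_0+J_i\,k[\boldsymbol y,x],J_i,h',w)$. 4. Otherwise let $v=\prod_{g\in\mathcal G\setminus J_0}\mathtt{LC}_{T_{x,z}}(g)$ and $\{J_i\}=\mathtt{PrimeDecomposition}(J_0+\langle v\rangle)$, and return $\{(J_0,wv)\}\cup\bigcup_i\mathtt{Proj2Sub}(I_0+J_i\,k[\boldsymbol y,x],J_i,h',w)$. $\mathtt{Proj2}(I,I',J,h,h')$, where $I,I'\unlhd k[\boldsymbol y,x]$, $J\unlhd k[\boldsymbol y]$ is prime, $J\subseteq I\cap k[\boldsymbol y]$, $h,h'\in k[\boldsymbol y,x]$: 1. Let $\mathcal G$ be the reduced Gröbner basis of $I$ for the block order $x>T_{\boldsymbol y}$. 2. If $1\in I$, return $\varnothing$. 3. If $I\cap k[\boldsymbol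 y]\ne J$, let $\{J_i\}=\mathtt{PrimeDecomposition}(I\cap k[\boldsymbol y])$ and return $\bigcup_i\mathtt{Proj2}(I+J_i\,k[\boldsymbol y,x],I',J_i,h,h')$. 4. If $I=J\,k[\boldsymbol y,x]$, return $\mathtt{Proj2}(I+\langle h\rangle,I',J,1,h')$. 5. Otherwise let $w=\prod_{g\in\mathcal G\setminus J}\mathtt{LC}_x(g)$ and $\{J_i\}=\mathtt{PrimeDecomposition}(J+\langle w\rangle)$, and return $\mathtt{Proj2Sub}(I+I',\langle0\rangle,h',w)\cup\bigcup_i\mathtt{Proj2}(I+J_i\,k[\boldsymbol y,x],I',J_i,h,h')$. An output pair $(J_0,u)$ stands for the basic constructible set $V(J_0)\cap D(u)$ in affine $n$-space. **Theorem.** $\mathtt{Proj2Sub}$ and $\mathtt{Proj2}$ terminate on all inputs as above. Moreover, let $L_1,\dots,L_r$ be the output of $\mathtt{Proj2}(I,I',J,h,h')$. If $S\subseteq R^n$ is a semi-algebraically connected semi-algebraic set contained in $L_i(R)$ for some $i$, and $V(I)\cap D(h)$ and $V(I')\cap D(h')$ are each geometrically delineable over $S$, then the pair $\{V(I)\cap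 D(h),\,V(I')\cap D(h')\}$ is geometrically delineable over $S$. -/

import Mathlib

open MvPolynomial

/-! ### Semi-algebraic geometry over a real closed field -/

section RealGeometry

variable {R : Type*} [Field R] [LinearOrder R]

/-- A basic semi-algebraic set: finitely many conditions `f = 0` and `h > 0`. -/
def IsBasicSemialgebraic {σ : Type*} (S : Set (σ → R)) : Prop :=
  ∃ F H : Finset (MvPolynomial σ R),
    S = {x | (∀ f ∈ F, eval x f = 0) ∧ ∀ h ∈ H, 0 < eval x h}

/-- A semi-algebraic set: a finite union of basic semi-algebraic sets. -/
def IsSemialgebraic {σ : Type*} (S : Set (σ → R)) : Prop :=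
  ∃ 𝒮 : Set (Set (σ → R)), 𝒮.Finite ∧ (∀ B ∈ 𝒮, IsBasicSemialgebraic B) ∧ S = ⋃₀ 𝒮

/-- The open Euclidean ball of radius `r`. For `0 < r` the condition says `‖c - x‖ < r`. -/
def euclideanBall {σ : Type*} [Fintype σ] (c : σ → R) (r : R) : Set (σ → R) :=
  {x | ∑ i, (c i - x i) ^ 2 < r ^ 2}

/-- The Euclidean topology on `R ^ σ`, generated by the open balls. -/
@[reducible]
def euclideanTopology (R : Type*) [Field R] [LinearOrder R] (σ : Type*) [Fintype σ] :
    TopologicalSpace (σ → R) :=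
  TopologicalSpace.generateFrom {U | ∃ c : σ → R, ∃ r : R, 0 < r ∧ U = euclideanBall c r}

/-- The Euclidean topology on a subset of `R ^ σ`. -/
@[reducible]
def euclideanTopologyOn {σ : Type*} [Fintype σ] (S : Set (σ → R)) : TopologicalSpace S :=
  (euclideanTopology R σ).induced Subtype.val

/-- `A ⊆ S` is closed in `S` for the Euclidean topology. -/
def IsEuclideanClosedIn {σ : Type*} [Fintype σ] (A S : Set (σ → R)) : Prop :=
  ∃ F : Set (σ → R), @IsClosed _ (euclideanTopology R σ) F ∧ A = S ∩ F

/-- `S` is not the disjoint union of two non-empty semi-algebraic subsets closed in `S`. -/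
def IsSemialgebraicallyConnected {σ : Type*} [Fintype σ] (S : Set (σ → R)) : Prop :=
  ¬ ∃ A B : Set (σ → R), IsSemialgebraic A ∧ IsSemialgebraic B ∧ A.Nonempty ∧ B.Nonempty ∧
    IsEuclideanClosedIn A S ∧ IsEuclideanClosedIn B S ∧ Disjoint A B ∧ A ∪ B = S

/-- A map `S → R ^ τ`, with `S ⊆ R ^ σ`, whose graph is semi-algebraic. -/
def IsSemialgebraicMap {σ τ : Type*} {S : Set (σ → R)} (f : S → τ → R) : Prop :=
  IsSemialgebraic {p : σ ⊕ τ → R | ∃ s : S, p ∘ Sum.inl = s ∧ p ∘ Sum.inr = f s}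

/-- A map `S → R ^ τ`, with `S ⊆ R ^ σ`, continuous for the Euclidean topologies. -/
def IsEuclideanContinuous {σ τ : Type*} [Fintype σ] [Fintype τ] {S : Set (σ → R)}
    (f : S → τ → R) : Prop :=
  @Continuous _ _ (euclideanTopologyOn S) (euclideanTopology R τ) f

end RealGeometry

/-! ### Basic constructible sets -/

/-- The data `(I, h)` presenting the basic constructible set `V(I) ∩ D(h)` in the affine space
over `K` with coordinates indexed by `σ`. -/
structure BasicConstructible (K : Type*) [Field K] (σ : Type*) where
  ideal : Ideal (MvPolynomial σ K)
  denom : MvPolynomial σ K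

namespace BasicConstructible

/-- Base change along a field extension. -/
noncomputable def baseChange {k : Type*} [Field k] (R : Type*) [Field R] [Algebra k R]
    {σ : Type*} (T : BasicConstructible k σ) : BasicConstructible R σ where
  ideal := T.ideal.map (MvPolynomial.map (algebraMap k R))
  denom := MvPolynomial.map (algebraMap k R) T.denom

/-- The rational points of `V(I) ∩ D(h)`. -/
def points {K : Type*} [Field K] {σ : Type*} (T : BasicConstructible K σ) : Set (σ → K) :=
  {p | (∀ f ∈ T.ideal, eval p f = 0) ∧ eval p T.denom ≠ 0}

/-- Affine `(n+1)`-space has coordinates indexed by `Fin 1 ⊕ Fin n`: the fibre coordinate `x`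
comes first, then the base coordinates `y`. The geometric fibre over `a ∈ R ^ n` is the set of all
`t` in the algebraic closure of `R` with `f(a; t) = 0` for `f ∈ I` and `h(a; t) ≠ 0`. -/
noncomputable def geometricFiber {R : Type*} [Field R] {n : ℕ}
    (T : BasicConstructible R (Fin 1 ⊕ Fin n)) (a : Fin n → R) : Set (AlgebraicClosure R) :=
  {t | (∀ f ∈ T.ideal,
      aeval (Sum.elim (fun _ => t) fun i => algebraMap R (AlgebraicClosure R) (a i)) f = 0) ∧
    aeval (Sum.elim (fun _ => t) fun i => algebraMap R (AlgebraicClosure R) (a i)) T.denom ≠ 0}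

end BasicConstructible

/-! ### Geometric delineability -/

section Delineability

variable {R : Type*} [Field R] [LinearOrder R] {n : ℕ}

/-- The three conditions defining that `T` is geometrically delineable over `S` with sections
`ξ 0, …, ξ (m - 1)`. -/
structure IsDelineatedBy (T : BasicConstructible R (Fin 1 ⊕ Fin n)) (S : Set (Fin n → R))
    (m : ℕ) (ξ : Fin m → S → (Fin 1 ⊕ Fin n → R)) : Prop where
  card_geometricFiber : ∃ N : ℕ, ∀ a ∈ S, (T.geometricFiber a).encard = N
  mem_points : ∀ i s, ξ i s ∈ T.points
  proj_eq : ∀ i s, ξ i s ∘ Sum.inr = (s : Fin n → R)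
  semialgebraic : ∀ i, IsSemialgebraicMap (ξ i)
  continuous : ∀ i, IsEuclideanContinuous (ξ i)
  strictMono : ∀ i j s, i < j → ξ i s (Sum.inl 0) < ξ j s (Sum.inl 0)
  cover : ∀ t ∈ T.points, ∀ ht : t ∘ Sum.inr ∈ S, ∃! i, t = ξ i ⟨t ∘ Sum.inr, ht⟩

/-- `T` is geometrically delineable over `S` with sections `ξ`. The second constructor is the
convention that if `T` agrees with `D(g)` on `S × R`, then `T` is geometrically delineable over `S`
as soon as `V(g)` is, with the sections of `V(g)`. -/
inductive HasSections (S : Set (Fin n → R)) (m : ℕ) (ξ : Fin m → S → (Fin 1 ⊕ Fin n → R)) :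
    BasicConstructible R (Fin 1 ⊕ Fin n) → Prop
  | direct (T : BasicConstructible R (Fin 1 ⊕ Fin n)) (hT : IsDelineatedBy T S m ξ) :
      HasSections S m ξ T
  | convention (T : BasicConstructible R (Fin 1 ⊕ Fin n)) (g : MvPolynomial (Fin 1 ⊕ Fin n) R)
      (hTg : T.points ∩ {p | p ∘ Sum.inr ∈ S} =
        (BasicConstructible.mk ⊥ g).points ∩ {p | p ∘ Sum.inr ∈ S})
      (hg : HasSections S m ξ (BasicConstructible.mk (Ideal.span {g}) 1)) :
      HasSections S m ξ T

/-- Geometric delineability of one basic constructible set. -/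
def IsGeometricallyDelineable (T : BasicConstructible R (Fin 1 ⊕ Fin n))
    (S : Set (Fin n → R)) : Prop :=
  ∃ (m : ℕ) (ξ : Fin m → S → (Fin 1 ⊕ Fin n → R)), HasSections S m ξ T

/-- Geometric delineability of a family: every member is geometrically delineable, and all the
sections of all the members are pairwise either identical or disjoint. -/
def IsGeometricallyDelineableFamily {ι : Type*}
    (L : ι → BasicConstructible R (Fin 1 ⊕ Fin n)) (S : Set (Fin n → R)) : Prop :=
  ∃ (m : ι → ℕ) (ξ : ∀ i, Fin (m i) → S → (Fin 1 ⊕ Fin n → R)),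
    (∀ i, HasSections S (m i) (ξ i) (L i)) ∧
    ∀ i a j b, ξ i a = ξ j b ∨ ∀ s, ξ i a s ≠ ξ j b s

end Delineability

/-! ### Gröbner bases -/

section Groebner

variable {k : Type*} [Field k]

/-- `G` is a reduced Gröbner basis of `I` with respect to the monomial order `m`. -/
structure IsReducedGroebnerBasis {σ : Type*} (m : MonomialOrder σ) (I : Ideal (MvPolynomial σ k))
    (G : Finset (MvPolynomial σ k)) : Prop where
  span_eq : Ideal.span (G : Set (MvPolynomial σ k)) = I
  span_leadingTerm_eq : Ideal.span (m.leadingTerm '' (I : Set (MvPolynomial σ k))) =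
    Ideal.span (m.leadingTerm '' (G : Set (MvPolynomial σ k)))
  monic : ∀ g ∈ G, m.leadingCoeff g = 1
  reduced : ∀ g ∈ G, ∀ g' ∈ G, g' ≠ g → ∀ c ∈ g.support, ¬ m.degree g' ≤ c

theorem exists_isReducedGroebnerBasis {σ : Type*} [Finite σ] (m : MonomialOrder σ)
    (I : Ideal (MvPolynomial σ k)) : ∃ G, IsReducedGroebnerBasis m I G := by
  classical
  set E : Set (σ →₀ ℕ) := {d | ∃ f ∈ I, f ≠ 0 ∧ m.degree f = d} with hE
  set M : Set (σ →₀ ℕ) := {d | Minimal (· ∈ E) d} with hM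
  have hMfin : M.Finite :=
    (setOfPred_minimal_antichain (· ∈ E)).finite_of_partiallyWellOrderedOn (Set.isPWO_of_wellQuasiOrderedLE M)
  have hbelow : ∀ d ∈ E, ∃ d' ∈ M, d' ≤ d := by
    intro d hd
    obtain ⟨d', hle, hmin⟩ := exists_minimal_le_of_wellFoundedLT (· ∈ E) d hd
    exact ⟨d', hmin, hle⟩
  have hf : ∀ d : M, ∃ f ∈ I, m.degree f = d ∧ IsUnit (m.leadingCoeff f) := by
    rintro ⟨d, hd⟩
    obtain ⟨f, hfI, hf0, hfd⟩ := hd.1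
    exact ⟨f, hfI, hfd, (isUnit_iff_ne_zero).2 (by simpa using hf0)⟩
  choose f hfI hfd hfu using hf
  have key : ∀ d : M, ∃ g ∈ I, m.degree g = d ∧ m.leadingCoeff g = 1 ∧
      ∀ c ∈ g.support, c ≠ d → ∀ d' ∈ M, ¬ d' ≤ c := by
    intro d
    obtain ⟨q, r, hqr, -, hr⟩ := m.div (b := f) hfu (monomial (d : σ →₀ ℕ) (1 : k))
    have hr' : ∀ c ∈ r.support, ∀ d' ∈ M, ¬ d' ≤ c := by
      intro c hc d' hd'
      have := hr c hc ⟨d', hd'⟩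
      rwa [hfd] at this
    have hcoeff : coeff (d : σ →₀ ℕ) (monomial (d : σ →₀ ℕ) (1 : k) - r) = 1 := by
      have : coeff (d : σ →₀ ℕ) r = 0 := by
        by_contra h
        exact hr' _ (mem_support_iff.2 h) _ d.2 le_rfl
      simp [this]
    have hmem : monomial (d : σ →₀ ℕ) (1 : k) - r ∈ I := by
      rw [hqr, add_sub_cancel_right, Finsupp.linearCombination_apply]
      exact I.sum_mem fun i _ => I.mul_mem_left _ (hfI i)
    have hsupp : ∀ c ∈ (monomial (d : σ →₀ ℕ) (1 : k) - r).support, c ≠ d → c ∈ r.support := by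
      intro c hc hcd
      rw [mem_support_iff, coeff_sub, coeff_monomial, if_neg (Ne.symm hcd), zero_sub,
        neg_ne_zero] at hc
      exact mem_support_iff.2 hc
    have hne : monomial (d : σ →₀ ℕ) (1 : k) - r ≠ 0 := by
      intro h
      rw [h] at hcoeff
      simp at hcoeff
    have hdeg : m.degree (monomial (d : σ →₀ ℕ) (1 : k) - r) = d := by
      by_contra h
      obtain ⟨d', hd', hle⟩ := hbelow _ ⟨_, hmem, hne, rfl⟩
      exact hr' _ (hsupp _ (m.degree_mem_support hne) h) d' hd' hle
    refine ⟨_, hmem, hdeg, ?_, fun c hc hcd d' hd' => hr' c (hsupp c hc hcd) d' hd'⟩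
    rw [MonomialOrder.leadingCoeff, hdeg, hcoeff]
  choose g hgI hgd hgl hgr using key
  have := hMfin.fintype
  refine ⟨Finset.univ.image g, ?_, ?_, ?_, ?_⟩
  · refine le_antisymm (Ideal.span_le.2 ?_) ?_
    · intro p hp
      obtain ⟨d, -, rfl⟩ := Finset.mem_image.1 hp
      exact hgI d
    · intro p hp
      obtain ⟨q, r, hqr, -, hr⟩ := m.div (b := g) (fun d => by rw [hgl]; exact isUnit_one) p
      have hsum : Finsupp.linearCombination _ g q ∈
          Ideal.span ((Finset.univ.image g : Finset _) : Set (MvPolynomial σ k)) := by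
        rw [Finsupp.linearCombination_apply]
        exact Ideal.sum_mem _ fun i _ => Ideal.mul_mem_left _ _ (Ideal.subset_span (by simp))
      have hle : Ideal.span ((Finset.univ.image g : Finset _) : Set (MvPolynomial σ k)) ≤ I := by
        rw [Ideal.span_le]
        intro p hp
        obtain ⟨d, -, rfl⟩ := Finset.mem_image.1 hp
        exact hgI d
      have hr0 : r = 0 := by
        by_contra h
        have hrI : r ∈ I := by
          have : r = p - Finsupp.linearCombination _ g q := by rw [hqr]; ring
          rw [this]
          exact I.sub_mem hp (hle hsum)
        obtain ⟨d', hd', hle⟩ := hbelow _ ⟨r, hrI, h, rfl⟩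
        exact hr _ (m.degree_mem_support h) ⟨d', hd'⟩ (by rw [hgd]; exact hle)
      rw [hqr, hr0, add_zero]
      exact hsum
  · refine le_antisymm (Ideal.span_le.2 ?_) (Ideal.span_mono (Set.image_mono ?_))
    · rintro _ ⟨p, hp, rfl⟩
      by_cases h0 : p = 0
      · simp [h0]
      obtain ⟨d', hd', hle⟩ := hbelow _ ⟨p, hp, h0, rfl⟩
      have : m.leadingTerm p = monomial (m.degree p - d') (m.leadingCoeff p) *
          m.leadingTerm (g ⟨d', hd'⟩) := by
        rw [MonomialOrder.leadingTerm, MonomialOrder.leadingTerm, hgd, hgl, monomial_mul, mul_one,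
          tsub_add_cancel_of_le hle]
      rw [this]
      exact Ideal.mul_mem_left _ _ (Ideal.subset_span ⟨_, by simp, rfl⟩)
    · intro p hp
      obtain ⟨d, -, rfl⟩ := Finset.mem_image.1 hp
      exact hgI d
  · intro p hp
    obtain ⟨d, -, rfl⟩ := Finset.mem_image.1 hp
    exact hgl d
  · intro p hp p' hp' hne c hc
    obtain ⟨d, -, rfl⟩ := Finset.mem_image.1 hp
    obtain ⟨d', -, rfl⟩ := Finset.mem_image.1 hp'
    rw [hgd]
    by_cases hcd : c = d
    · intro hle
      rw [hcd] at hle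
      exact hne (by rw [Subtype.ext (d.2.eq_of_le d'.2.1 hle)])
    · exact hgr d c hc hcd d' d'.2

/-- The reduced Gröbner basis of `I` with respect to `m`. -/
noncomputable def reducedGroebnerBasis {σ : Type*} [Finite σ] (m : MonomialOrder σ)
    (I : Ideal (MvPolynomial σ k)) : Finset (MvPolynomial σ k) :=
  (exists_isReducedGroebnerBasis m I).choose

/-- The block order `m₁ > m₂`: compare the first block of variables by `m₁`, and break ties by
comparing the second block by `m₂`. -/
noncomputable def blockOrder {τ σ : Type*} (m₁ : MonomialOrder τ) (m₂ : MonomialOrder σ) :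
    MonomialOrder (τ ⊕ σ) where
  syn := m₁.syn ×ₗ m₂.syn
  toSyn :=
    { toFun := fun d => toLex
        (m₁.toSyn (Finsupp.sumFinsuppAddEquivProdFinsupp d).1,
          m₂.toSyn (Finsupp.sumFinsuppAddEquivProdFinsupp d).2)
      invFun := fun p => Finsupp.sumFinsuppAddEquivProdFinsupp.symm
        (m₁.toSyn.symm (ofLex p).1, m₂.toSyn.symm (ofLex p).2)
      left_inv := fun d => by simp
      right_inv := fun p => by simp
      map_add' := fun d e => by simp only [map_add, Prod.fst_add, Prod.snd_add, ← toLex_add, Prod.mk_add_mk] }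
  toSyn_monotone := fun d e hde => by
    refine Prod.Lex.toLex_mono (Prod.mk_le_mk.2 ⟨m₁.toSyn_monotone ?_, m₂.toSyn_monotone ?_⟩)
    · exact fun i => hde (Sum.inl i)
    · exact fun i => hde (Sum.inr i)

variable {τ : Type*} {n : ℕ}

/-- The inclusion of `k[y]` into `k[τ, y]`. -/
noncomputable def baseIncl (k : Type*) [Field k] (τ : Type*) (n : ℕ) :
    MvPolynomial (Fin n) k →ₐ[k] MvPolynomial (τ ⊕ Fin n) k :=
  rename Sum.inr

/-- The leading coefficient in `k[y]`, with respect to `m`, of a polynomial of `k[τ, y]` seen as a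
polynomial in the variables `τ` over `k[y]`. -/
noncomputable def relLeadingCoeff (m : MonomialOrder τ) (g : MvPolynomial (τ ⊕ Fin n) k) :
    MvPolynomial (Fin n) k :=
  m.leadingCoeff (sumAlgEquiv k τ (Fin n) g)

open Classical in
/-- The product of the relative leading coefficients of the members outside `J ⊆ k[y]` of the
reduced Gröbner basis of `I` with respect to the block order `m₁ > m₂`. -/
noncomputable def leadingCoeffProduct [Finite τ] (m₁ : MonomialOrder τ)
    (m₂ : MonomialOrder (Fin n)) (I : Ideal (MvPolynomial (τ ⊕ Fin n) k))
    (J : Ideal (MvPolynomial (Fin n) k)) : MvPolynomial (Fin n) k :=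
  ∏ g ∈ (reducedGroebnerBasis (blockOrder m₁ m₂) I).filter fun g => ∀ f ∈ J, baseIncl k τ n f ≠ g,
    relLeadingCoeff m₁ g

end Groebner

/-! ### The algorithms -/

section Algorithms

variable {k : Type*} [Field k] {n : ℕ}

/-- The list of the minimal primes over `J`. -/
noncomputable def primeDecomposition (J : Ideal (MvPolynomial (Fin n) k)) :
    List (Ideal (MvPolynomial (Fin n) k)) :=
  (Ideal.finite_minimalPrimes_of_isNoetherianRing _ J).toFinset.toList

/-- The ideal `I · k[y, x, z] + ⟨z h - 1⟩`, where `x` is the variable `Sum.inl 0` and the new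
variable `z` is `Sum.inl 1`. -/
noncomputable def rabinowitschIdeal (I : Ideal (MvPolynomial (Fin 1 ⊕ Fin n) k))
    (h : MvPolynomial (Fin 1 ⊕ Fin n) k) : Ideal (MvPolynomial (Fin 2 ⊕ Fin n) k) :=
  I.map (rename (Sum.map (fun _ => (0 : Fin 2)) id)) ⊔
    Ideal.span {X (Sum.inl 1) * rename (Sum.map (fun _ => (0 : Fin 2)) id) h - 1}

open Classical in
/-- The subroutine `Proj2Sub(I₀, J₀, h', w)`, executed with the bound given by the first explicit
number on the depth of recursive calls; the value is `none` if the bound is exceeded. -/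
noncomputable def proj2SubRun (Ty : MonomialOrder (Fin n)) (Txz : MonomialOrder (Fin 2)) :
    ℕ → Ideal (MvPolynomial (Fin 1 ⊕ Fin n) k) → Ideal (MvPolynomial (Fin n) k) →
      MvPolynomial (Fin 1 ⊕ Fin n) k → MvPolynomial (Fin n) k →
      Option (List (BasicConstructible k (Fin n)))
  | 0, _, _, _, _ => none
  | N + 1, I₀, J₀, h', w =>
    if 1 ∈ I₀ then some []
    else if I₀.comap (baseIncl k (Fin 1) n) ≠ J₀ then do
      let rets ← (primeDecomposition (I₀.comap (baseIncl k (Fin 1) n))).mapM fun P =>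
        proj2SubRun Ty Txz N (I₀ ⊔ P.map (baseIncl k (Fin 1) n)) P h' w
      return rets.flatten
    else do
      let v := leadingCoeffProduct Txz Ty (rabinowitschIdeal I₀ h') J₀
      let rets ← (primeDecomposition (J₀ ⊔ Ideal.span {v})).mapM fun P =>
        proj2SubRun Ty Txz N (I₀ ⊔ P.map (baseIncl k (Fin 1) n)) P h' w
      return ⟨J₀, w * v⟩ :: rets.flatten

open Classical in
/-- The algorithm `Proj2(I, I', J, h, h')`, executed with the bound given by the first explicit
number on the depth of recursive calls; the value is `none` if the bound is exceeded. -/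
noncomputable def proj2Run (Ty : MonomialOrder (Fin n)) (Txz : MonomialOrder (Fin 2)) :
    ℕ → Ideal (MvPolynomial (Fin 1 ⊕ Fin n) k) → Ideal (MvPolynomial (Fin 1 ⊕ Fin n) k) →
      Ideal (MvPolynomial (Fin n) k) → MvPolynomial (Fin 1 ⊕ Fin n) k →
      MvPolynomial (Fin 1 ⊕ Fin n) k → Option (List (BasicConstructible k (Fin n)))
  | 0, _, _, _, _, _ => none
  | N + 1, I, I', J, h, h' =>
    if 1 ∈ I then some []
    else if I.comap (baseIncl k (Fin 1) n) ≠ J then do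
      let rets ← (primeDecomposition (I.comap (baseIncl k (Fin 1) n))).mapM fun P =>
        proj2Run Ty Txz N (I ⊔ P.map (baseIncl k (Fin 1) n)) I' P h h'
      return rets.flatten
    else if I = J.map (baseIncl k (Fin 1) n) then
      proj2Run Ty Txz N (I ⊔ Ideal.span {h}) I' J 1 h'
    else do
      let w := leadingCoeffProduct MonomialOrder.lex Ty I J
      let sub ← proj2SubRun Ty Txz N (I ⊔ I') ⊥ h' w
      let rets ← (primeDecomposition (J ⊔ Ideal.span {w})).mapM fun P =>
        proj2Run Ty Txz N (I ⊔ P.map (baseIncl k (Fin 1) n)) I' P h h'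
      return sub ++ rets.flatten

/-- The run of `Proj2Sub` on the given input halts and returns `L`. -/
def Proj2SubReturns (Ty : MonomialOrder (Fin n)) (Txz : MonomialOrder (Fin 2))
    (I₀ : Ideal (MvPolynomial (Fin 1 ⊕ Fin n) k)) (J₀ : Ideal (MvPolynomial (Fin n) k))
    (h' : MvPolynomial (Fin 1 ⊕ Fin n) k) (w : MvPolynomial (Fin n) k)
    (L : List (BasicConstructible k (Fin n))) : Prop :=
  ∃ N, proj2SubRun Ty Txz N I₀ J₀ h' w = some L

/-- The run of `Proj2` on the given input halts and returns `L`. -/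
def Proj2Returns (Ty : MonomialOrder (Fin n)) (Txz : MonomialOrder (Fin 2))
    (I I' : Ideal (MvPolynomial (Fin 1 ⊕ Fin n) k)) (J : Ideal (MvPolynomial (Fin n) k))
    (h h' : MvPolynomial (Fin 1 ⊕ Fin n) k)
    (L : List (BasicConstructible k (Fin n))) : Prop :=
  ∃ N, proj2Run Ty Txz N I I' J h h' = some L

end Algorithms

/-!
Two sections over a semi-algebraically connected set `S` are identical or disjoint as soon as the
set `A ⊆ S` where they agree is semi-algebraic, closed and open in `S`
(`IsSemialgebraicallyConnected.eq_or_forall_ne`). It is closed by continuity. It is semi-algebraic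
because it is the projection of the intersection of the two images along the coordinate `x`; this
uses the Tarski–Seidenberg theorem (`IsSemialgebraic.exists_fiber`), which is proved by counting
roots with Cauchy indices. The sign changes of polynomials that this needs rest on the fundamental
theorem of algebra for real closed fields (`IsRealClosed.natDegree_le_two_of_irreducible`).

The openness of `A` is what the algorithms provide. A member of the output comes from an ideal `I₁`
met by `Proj2`, an ideal `I₂` met by `Proj2Sub`, which is `I₁ + I'` up to polynomials in `y` that
vanish on `S`, and from the product of the relative leading coefficients of their Gröbner bases,
which vanishes nowhere on `S` (`exists_of_mem_proj2Run`, `exists_of_mem_proj2SubRun`). For the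
Gröbner basis of `Q = I₂ k[y, x, z] + ⟨z h' - 1⟩` this means that the standard monomials in `x, z`
form a basis of the algebra `R[x, z] / Q_a` for all `a ∈ S` simultaneously
(`eq_zero_of_mem_map_specializeCoeff`, `exists_standard_remainder`). For `I₁` it means that
`I₁` does not vanish on any fibre (`exists_fiberAt_ne_zero`), so that this basis is finite. The
characteristic polynomial of the multiplication by `x` therefore has its coefficients in `k[y]`, up
to the inverse of the leading coefficient, and it restricts, over every `a ∈ S`, to the part prime
to `h'` of the greatest common divisor of the restrictions of `I₂` (`exists_fiber_gcd`). Call it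
`c`. Its zeros over `S` are the points of `V(I₂) ∩ D(h')`, and every generator `f` of `I₂` is over
`S` a product `c e_f` up to units, where `h'` vanishes at the common zeros of the `e_f`
(`exists_local_equation`).

Suppose now that a section of `V(I) ∩ D(h)` and one of `V(I') ∩ D(h')` meet at a point. There some
`e_f` does not vanish, and it does not vanish near the point. If `f ∈ I₁`, then `f` vanishes along
the first section, hence so does `c`, which means that the first section runs in `V(I') ∩ D(h')`
near the point. As the sections of the second set are disjoint, it coincides there with the second
section. If `f ∈ I'`, the roles are exchanged (`IsDelineatedBy.eventually_eq_of_eq`). The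
conventional sections of `V(h')`, when `I'` vanishes over `S`, are treated in the same way, with `c`
in the place of `e_f`. The conventions reduce to these cases because the fibres of a delineated set
are finite and `R` is infinite (`HasSections.exists_isDelineatedBy`,
`IsDelineatedBy.exists_mem_points_iff`).

The algorithms terminate because no relative leading coefficient lies in the prime ideal `J`
(`leadingCoeffProduct_notMem`), so that `J` grows strictly in the recursive calls.
-/

/-! ### The fundamental theorem of algebra for real closed fields -/

section RealClosed

open scoped Polynomial
open IntermediateField Module

variable {R : Type*} [Field R] [LinearOrder R] [IsStrictOrderedRing R] [IsRealClosed R]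

/-- The minimal polynomial of a primitive element of an extension of odd degree has a root. -/
theorem IsRealClosed.finrank_eq_one_of_odd {F : Type*} [Field F] [Algebra R F]
    [FiniteDimensional R F] (h : Odd (finrank R F)) : finrank R F = 1 := by
  obtain ⟨x, hx⟩ := Field.exists_primitive_element R F
  have hint : IsIntegral R x := IsIntegral.of_finite R x
  have hdeg : (minpoly R x).natDegree = finrank R F := by
    rw [← IntermediateField.adjoin.finrank hint, hx, IntermediateField.finrank_top']
  obtain ⟨r, hr⟩ := IsRealClosed.exists_isRoot_of_odd_natDegree (f := minpoly R x) (hdeg ▸ h)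
  have := Polynomial.degree_eq_one_of_irreducible_of_root (minpoly.irreducible hint) hr
  rw [← hdeg]
  exact Polynomial.natDegree_eq_of_degree_eq_some this

theorem IntermediateField.exists_eq_add_mul_of_mem_adjoin {K E : Type*} [Field K]
    [Field E] [Algebra K E] {i : E}
    (hi : i ^ 2 = -1) {z : E} (hz : z ∈ K⟮i⟯) :
    ∃ a b : K, z = algebraMap K E a + algebraMap K E b * i := by
  have halg : IsAlgebraic K i :=
    ⟨Polynomial.X ^ 2 + 1, (Polynomial.monic_X_pow_add_C (1 : K) two_ne_zero).ne_zero,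
      by simp [hi]⟩
  have hz' : z ∈ Algebra.adjoin K {i} := by
    rw [← IntermediateField.adjoin_simple_toSubalgebra_of_isAlgebraic halg]
    exact hz
  clear hz
  induction hz' using Algebra.adjoin_induction with
  | mem x hx => exact ⟨0, 1, by simpa using hx⟩
  | algebraMap r => exact ⟨r, 0, by simp⟩
  | add x y _ _ hx hy =>
    obtain ⟨a, b, rfl⟩ := hx
    obtain ⟨c, d, rfl⟩ := hy
    exact ⟨a + c, b + d, by simp only [map_add]; ring⟩
  | mul x y _ _ hx hy =>
    obtain ⟨a, b, rfl⟩ := hx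
    obtain ⟨c, d, rfl⟩ := hy
    refine ⟨a * c - b * d, a * d + b * c, ?_⟩
    simp only [map_add, map_sub, map_mul]
    linear_combination (algebraMap K E b * algebraMap K E d) * hi

/-- Every element `a + b i` of `R(i)` is a square, `(u + v i) ^ 2` with `u ^ 2 = (r + a) / 2` and
`v ^ 2 = (r - a) / 2`, where `r ^ 2 = a ^ 2 + b ^ 2`. -/
theorem IsRealClosed.isSquare_of_mem_adjoin {E : Type*} [Field E] [Algebra R E] {i : E}
    (hi : i ^ 2 = -1) (z : R⟮i⟯) : IsSquare z := by
  obtain ⟨a, b, hab⟩ := IntermediateField.exists_eq_add_mul_of_mem_adjoin hi z.2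
  obtain ⟨r, hr0, hr⟩ : ∃ r : R, 0 ≤ r ∧ r ^ 2 = a ^ 2 + b ^ 2 := by
    obtain ⟨r, hr⟩ := IsRealClosed.exists_eq_pow_of_nonneg (x := a ^ 2 + b ^ 2) (by positivity)
      two_ne_zero
    exact ⟨|r|, abs_nonneg r, by rw [sq_abs, hr]⟩
  have har : |a| ≤ r := abs_le_of_sq_le_sq' (by nlinarith [sq_nonneg b]) hr0 |> abs_le.2
  obtain ⟨u, hu⟩ := IsRealClosed.exists_eq_pow_of_nonneg (x := (r + a) / 2)
    (by have := (abs_le.1 har).1; linarith) two_ne_zero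
  obtain ⟨v, hv⟩ := IsRealClosed.exists_eq_pow_of_nonneg (x := (r - a) / 2)
    (by have := (abs_le.1 har).2; linarith) two_ne_zero
  have huv : (2 * (u * v)) ^ 2 = b ^ 2 := by
    calc (2 * (u * v)) ^ 2 = 4 * u ^ 2 * v ^ 2 := by ring
      _ = b ^ 2 := by rw [← hu, ← hv]; linear_combination hr
  have key : ∀ v : R, v ^ 2 = (r - a) / 2 → 2 * (u * v) = b → IsSquare z := by
    intro v hv hb
    refine ⟨⟨algebraMap R E u + algebraMap R E v * i, ?_⟩, ?_⟩
    · exact add_mem (R⟮i⟯.algebraMap_mem u)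
        (mul_mem (R⟮i⟯.algebraMap_mem v) (mem_adjoin_simple_self R i))
    · apply Subtype.ext
      rw [hab, MulMemClass.mk_mul_mk]
      have h1 : a = u ^ 2 - v ^ 2 := by rw [← hu, hv]; ring
      rw [← hb, h1]
      simp only [map_sub, map_mul, map_pow, map_ofNat]
      linear_combination (-(algebraMap R E v) ^ 2) * hi
  rcases sq_eq_sq_iff_eq_or_eq_neg.1 huv with h | h
  · exact key v hv.symm h
  · exact key (-v) (by rw [hv]; ring) (by linear_combination -h)

theorem Polynomial.not_irreducible_of_natDegree_eq_two {K : Type*} [Field K] [CharZero K]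
    (hK : ∀ z : K, IsSquare z) {p : K[X]} (hp : p.Monic) (h2 : p.natDegree = 2) :
    ¬ Irreducible p := by
  intro hirr
  have hform : p = Polynomial.X ^ 2 + Polynomial.C (p.coeff 1) * Polynomial.X +
      Polynomial.C (p.coeff 0) := by
    conv_lhs => rw [p.as_sum_range_C_mul_X_pow, h2]
    have : p.coeff 2 = 1 := by rw [← h2]; exact hp
    simp [Finset.sum_range_succ, this]
    ring
  obtain ⟨s, hs⟩ := hK (p.coeff 1 ^ 2 - 4 * p.coeff 0)
  have hroot : p.IsRoot ((s - p.coeff 1) / 2) := by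
    rw [hform]
    simp only [IsRoot, Polynomial.eval_add, Polynomial.eval_pow, Polynomial.eval_X,
      Polynomial.eval_mul, Polynomial.eval_C, Polynomial.coeff_add, coeff_X_pow]
    simp
    field_simp
    linear_combination -hs
  have := Polynomial.degree_eq_one_of_irreducible_of_root hirr hroot
  rw [Polynomial.natDegree_eq_of_degree_eq_some this] at h2
  exact absurd h2 (by norm_num)

/-- An irreducible polynomial over a real closed field has degree at most two. The Galois group of
the splitting field of `p (X ^ 2 + 1)` is a `2`-group, since the fixed field of a Sylow
`2`-subgroup has odd degree; over `R(i)` it is then trivial, because a subgroup of index two would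
give a quadratic extension of a field in which every element is a square. -/
theorem IsRealClosed.natDegree_le_two_of_irreducible {p : R[X]} (hp : Irreducible p) :
    p.natDegree ≤ 2 := by
  classical
  let q : R[X] := p * (Polynomial.X ^ 2 + 1)
  have hq0 : q ≠ 0 := mul_ne_zero hp.ne_zero
    (Polynomial.monic_X_pow_add_C (1 : R) two_ne_zero).ne_zero
  let E := q.SplittingField
  have hsp : (q.map (algebraMap R E)).Splits := Polynomial.SplittingField.splits q
  have : IsGalois R E := ⟨⟩
  have : FiniteDimensional R E := inferInstance
  have hcard : Nat.card Gal(E/R) = finrank R E := IsGalois.card_aut_eq_finrank R E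
  -- the Galois group is a `2`-group
  have htwo : ∃ m, finrank R E = 2 ^ m := by
    obtain ⟨P⟩ : Nonempty (Sylow 2 Gal(E/R)) := inferInstance
    obtain ⟨m, hm⟩ := IsPGroup.iff_card.1 P.isPGroup'
    have h1 := IntermediateField.finrank_fixedField_eq_card (P : Subgroup Gal(E/R))
    have h2 := Module.finrank_mul_finrank R (fixedField (P : Subgroup Gal(E/R))) E
    have hodd : Odd (finrank R (fixedField (P : Subgroup Gal(E/R)))) := by
      have h3 : (P : Subgroup Gal(E/R)).index = finrank R (fixedField (P : Subgroup Gal(E/R))) := by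
        have h4 := (P : Subgroup Gal(E/R)).card_mul_index
        rw [hcard, ← h2, h1, mul_comm] at h4
        exact Nat.eq_of_mul_eq_mul_right Nat.card_pos h4
      rw [← h3, Nat.odd_iff, ← Nat.two_dvd_ne_zero]
      exact Sylow.not_dvd_index P
    have h5 := IsRealClosed.finrank_eq_one_of_odd hodd
    exact ⟨m, by rw [← h2, h5, one_mul, h1]; exact hm⟩
  obtain ⟨i, hi⟩ : ∃ i : E, i ^ 2 = -1 := by
    have : ((Polynomial.X ^ 2 + 1 : R[X]).map (algebraMap R E)).Splits :=
      Polynomial.Splits.of_dvd hsp (Polynomial.map_ne_zero hq0)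
        (Polynomial.map_dvd _ ⟨p, mul_comm _ _⟩)
    obtain ⟨i, hi⟩ := this.exists_eval_eq_zero (by
      rw [Polynomial.degree_map]
      have : (Polynomial.X ^ 2 + 1 : R[X]).degree = 2 :=
        Polynomial.degree_X_pow_add_C (by norm_num) (1 : R)
      rw [this]; norm_num)
    exact ⟨i, by simpa using eq_neg_of_add_eq_zero_left (by simpa using hi)⟩
  have hK2 : finrank R R⟮i⟯ ≤ 2 := by
    have hint : IsIntegral R i := IsIntegral.of_finite R i
    rw [IntermediateField.adjoin.finrank hint]
    have := Polynomial.natDegree_le_of_dvd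
      (minpoly.dvd R i (p := Polynomial.X ^ 2 + 1) (by simp [hi]))
      (Polynomial.monic_X_pow_add_C (1 : R) two_ne_zero).ne_zero
    refine this.trans ?_
    rw [show (Polynomial.X ^ 2 + 1 : R[X]) = Polynomial.X ^ 2 + Polynomial.C 1 by simp,
      Polynomial.natDegree_X_pow_add_C]
  -- a `2`-group has a subgroup of index two, unless it is trivial
  have hKE : finrank R⟮i⟯ E = 1 := by
    by_contra hne
    obtain ⟨m, hm⟩ := htwo
    have h1 := Module.finrank_mul_finrank R R⟮i⟯ E
    obtain ⟨l, -, hl⟩ := (Nat.dvd_prime_pow Nat.prime_two).1 (hm ▸ Dvd.intro_left _ h1)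
    have hl0 : l ≠ 0 := by rintro rfl; exact hne (by simpa using hl)
    have hc : Nat.card Gal(E/R⟮i⟯) = 2 ^ l := by rw [IsGalois.card_aut_eq_finrank, hl]
    have : Fact (Nat.Prime 2) := ⟨Nat.prime_two⟩
    obtain ⟨H, hH⟩ := Sylow.exists_subgroup_card_pow_prime (G := Gal(E/R⟮i⟯)) 2 (n := l - 1)
      (by rw [hc]; exact pow_dvd_pow 2 (by omega))
    have h2 := IntermediateField.finrank_fixedField_eq_card H
    have h3 := Module.finrank_mul_finrank R⟮i⟯ (fixedField H) E
    have h4 : finrank R⟮i⟯ (fixedField H) = 2 := by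
      rw [h2, hH, hl] at h3
      refine Nat.eq_of_mul_eq_mul_right (pow_pos (two_pos) (l - 1)) ?_
      rw [h3, ← pow_succ']; congr 1; omega
    obtain ⟨x, hx⟩ := Field.exists_primitive_element R⟮i⟯ (fixedField H)
    have hint : IsIntegral R⟮i⟯ x := IsIntegral.of_finite _ x
    refine Polynomial.not_irreducible_of_natDegree_eq_two
      (IsRealClosed.isSquare_of_mem_adjoin hi) (minpoly.monic hint) ?_ (minpoly.irreducible hint)
    rw [← IntermediateField.adjoin.finrank hint, hx, IntermediateField.finrank_top', h4]
  have hE : finrank R E ≤ 2 := by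
    rw [← Module.finrank_mul_finrank R R⟮i⟯ E, hKE, mul_one]; exact hK2
  have hps : (p.map (algebraMap R E)).Splits :=
    Polynomial.Splits.of_dvd hsp (Polynomial.map_ne_zero hq0)
      (Polynomial.map_dvd _ ⟨Polynomial.X ^ 2 + 1, rfl⟩)
  obtain ⟨x, hx⟩ := hps.exists_eval_eq_zero (by
    rw [Polynomial.degree_map]; exact (Polynomial.degree_pos_of_irreducible hp).ne')
  have hmin : p.natDegree = (minpoly R x).natDegree := by
    have hx' : Polynomial.aeval x p = 0 := by rwa [Polynomial.eval_map_algebraMap] at hx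
    have hd := minpoly.dvd R x hx'
    have := (minpoly.irreducible (IsIntegral.of_finite R x)).associated_of_dvd hp hd
    exact (Polynomial.natDegree_eq_of_degree_eq
      (Polynomial.degree_eq_degree_of_associated this)).symm
  rw [hmin]
  exact (minpoly.natDegree_le x).trans hE

end RealClosed

/-! ### The intermediate value property and Rolle's theorem for polynomials -/

section IntermediateValue

open scoped Polynomial

variable {R : Type*} [Field R] [LinearOrder R] [IsStrictOrderedRing R] [IsRealClosed R]

/-- An irreducible quadratic polynomial has negative discriminant. -/
theorem IsRealClosed.natDegree_eq_one_or_leadingCoeff_mul_eval_pos {p : R[X]}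
    (hp : Irreducible p) : p.natDegree = 1 ∨ ∀ x, 0 < p.leadingCoeff * p.eval x := by
  have h2 := IsRealClosed.natDegree_le_two_of_irreducible hp
  have h0 : 0 < p.natDegree := hp.natDegree_pos
  refine or_iff_not_imp_left.2 fun h1 x => ?_
  have hdeg : p.natDegree = 2 := by omega
  have hnr : ∀ z, p.eval z ≠ 0 := fun z hz =>
    h1 (Polynomial.natDegree_eq_of_degree_eq_some
      (Polynomial.degree_eq_one_of_irreducible_of_root hp hz))
  have hform : ∀ z, p.eval z = p.coeff 2 * z ^ 2 + p.coeff 1 * z + p.coeff 0 := by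
    intro z
    rw [Polynomial.eval_eq_sum_range, hdeg]
    simp [Finset.sum_range_succ]
    ring
  have hl : p.leadingCoeff = p.coeff 2 := by rw [← hdeg]; rfl
  have ha : p.coeff 2 ≠ 0 := by rw [← hl]; exact Polynomial.leadingCoeff_ne_zero.2 hp.ne_zero
  by_contra hneg
  rw [hl, hform] at hneg
  have hdisc : 0 ≤ p.coeff 1 ^ 2 - 4 * p.coeff 2 * p.coeff 0 := by
    nlinarith [sq_nonneg (2 * p.coeff 2 * x + p.coeff 1)]
  obtain ⟨s, hs⟩ := IsRealClosed.exists_eq_pow_of_nonneg hdisc two_ne_zero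
  refine hnr ((s - p.coeff 1) / (2 * p.coeff 2)) ?_
  rw [hform]
  field_simp
  linear_combination -hs

/-- A polynomial without roots in `[x, y]` has the same sign at `x` and at `y`. -/
theorem IsRealClosed.eval_mul_eval_pos {p : R[X]} {x y : R} (hxy : x ≤ y)
    (h : ∀ z, x ≤ z → z ≤ y → p.eval z ≠ 0) : 0 < p.eval x * p.eval y := by
  classical
  induction p using WfDvdMonoid.induction_on_irreducible with
  | zero => exact absurd (by simp) (h x le_rfl hxy)
  | unit u hu =>
    obtain ⟨a, ha, rfl⟩ := Polynomial.isUnit_iff.1 hu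
    simp only [Polynomial.eval_C]
    exact mul_self_pos.2 ha.ne_zero
  | mul a i ha hi ih =>
    have h1 : 0 < a.eval x * a.eval y := ih fun z hz hz' h0 => h z hz hz' (by simp [h0])
    have h2 : 0 < i.eval x * i.eval y := by
      rcases IsRealClosed.natDegree_eq_one_or_leadingCoeff_mul_eval_pos hi with h' | h'
      · obtain ⟨c, hc, d, rfl⟩ := Polynomial.natDegree_eq_one.1 h'
        by_contra hneg
        have hr := h (-d / c)
        have hc2 : 0 < c * c := mul_self_pos.2 hc
        simp only [Polynomial.eval_add, Polynomial.eval_mul, Polynomial.eval_C, Polynomial.eval_X]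
          at hneg hr
        rcases lt_or_ge (-d / c) x with hlt | hge
        · have e1 : d = -c * (-d / c) := by field_simp
          set r := -d / c
          refine hneg ?_
          rw [e1]
          have : 0 < (x - r) * (y - r) := mul_pos (by linarith) (by linarith)
          calc 0 < (c * c) * ((x - r) * (y - r)) := mul_pos hc2 this
            _ = _ := by ring
        · rcases lt_or_ge y (-d / c) with hlt | hge'
          · have e1 : d = -c * (-d / c) := by field_simp
            set r := -d / c
            refine hneg ?_
            rw [e1]
            have : 0 < (r - x) * (r - y) := mul_pos (by linarith) (by linarith)
            calc 0 < (c * c) * ((r - x) * (r - y)) := mul_pos hc2 this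
              _ = _ := by ring
          · exact hr hge hge' (by rw [mul_div_cancel₀ _ hc]; simp)
      · have h3 := mul_pos (h' x) (h' y)
        by_contra hneg
        nlinarith [mul_self_nonneg i.leadingCoeff]
    rw [Polynomial.eval_mul, Polynomial.eval_mul]
    calc 0 < (i.eval x * i.eval y) * (a.eval x * a.eval y) := mul_pos h2 h1
      _ = _ := by ring

/-- A polynomial without roots in `[c, ∞)` has at `c` the sign of its leading coefficient. -/
theorem IsRealClosed.eval_mul_leadingCoeff_pos {p : R[X]} {c : R}
    (h : ∀ z, c ≤ z → p.eval z ≠ 0) : 0 < p.eval c * p.leadingCoeff := by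
  classical
  induction p using WfDvdMonoid.induction_on_irreducible with
  | zero => exact absurd (by simp) (h c le_rfl)
  | unit u hu =>
    obtain ⟨a, ha, rfl⟩ := Polynomial.isUnit_iff.1 hu
    simp only [Polynomial.eval_C, Polynomial.leadingCoeff_C]
    exact mul_self_pos.2 ha.ne_zero
  | mul a i ha hi ih =>
    have h1 : 0 < a.eval c * a.leadingCoeff := ih fun z hz h0 => h z hz (by simp [h0])
    have h2 : 0 < i.eval c * i.leadingCoeff := by
      rcases IsRealClosed.natDegree_eq_one_or_leadingCoeff_mul_eval_pos hi with h' | h'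
      · obtain ⟨u, hu, d, rfl⟩ := Polynomial.natDegree_eq_one.1 h'
        have hr := h (-d / u)
        have hc2 : 0 < u * u := mul_self_pos.2 hu
        rw [Polynomial.leadingCoeff_linear hu]
        simp only [Polynomial.eval_add, Polynomial.eval_mul, Polynomial.eval_C, Polynomial.eval_X]
          at hr ⊢
        rcases lt_or_ge (-d / u) c with hlt | hge
        · have e1 : d = -u * (-d / u) := by field_simp
          set r := -d / u
          rw [e1]
          calc 0 < (u * u) * (c - r) := mul_pos hc2 (by linarith)
            _ = _ := by ring
        · exact absurd (by rw [mul_div_cancel₀ _ hu]; simp) (hr hge)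
      · rw [mul_comm]; exact h' c
    rw [Polynomial.eval_mul, Polynomial.leadingCoeff_mul]
    calc 0 < (i.eval c * i.leadingCoeff) * (a.eval c * a.leadingCoeff) := mul_pos h2 h1
      _ = _ := by ring

/-- Rolle's theorem between two consecutive roots `a < b` of a polynomial
`p = (X - a) ^ m (X - b) ^ n g`: the remaining factor of `p'` has opposite signs at `a` and `b`. -/
theorem IsRealClosed.exists_eval_derivative_eq_zero {p : R[X]} (hp : p ≠ 0) {a b : R}
    (hab : a < b) (ha : p.eval a = 0) (hb : p.eval b = 0)
    (h : ∀ z, a < z → z < b → p.eval z ≠ 0) : ∃ c, a < c ∧ c < b ∧ p.derivative.eval c = 0 := by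
  obtain ⟨q, hq, hqa⟩ := Polynomial.exists_eq_pow_rootMultiplicity_mul_and_not_dvd p hp a
  have hq0 : q ≠ 0 := by rintro rfl; simp at hqa
  obtain ⟨g, hg, hgb⟩ := Polynomial.exists_eq_pow_rootMultiplicity_mul_and_not_dvd q hq0 b
  rw [Polynomial.dvd_iff_isRoot] at hqa hgb
  have hm : 0 < p.rootMultiplicity a := (Polynomial.rootMultiplicity_pos hp).2 ha
  have hqb : q.eval b = 0 := by
    rw [hq] at hb
    simpa [sub_eq_zero, hab.ne'] using hb
  have hn : 0 < q.rootMultiplicity b := (Polynomial.rootMultiplicity_pos hq0).2 hqb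
  obtain ⟨m, hm⟩ := Nat.exists_eq_succ_of_ne_zero hm.ne'
  obtain ⟨n, hn⟩ := Nat.exists_eq_succ_of_ne_zero hn.ne'
  rw [hm] at hq
  rw [hn] at hg
  have hga : g.eval a ≠ 0 := fun h0 => hqa (by rw [hg]; simp [h0])
  have hgz : ∀ z, a ≤ z → z ≤ b → g.eval z ≠ 0 := by
    intro z hz hz' h0
    rcases hz.eq_or_lt with rfl | hz
    · exact hga h0
    · rcases hz'.eq_or_lt with rfl | hz'
      · exact hgb h0
      · exact h z hz hz' (by rw [hq, hg]; simp [h0])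
  have hpos := IsRealClosed.eval_mul_eval_pos hab.le hgz
  let A : R[X] := Polynomial.X - Polynomial.C a
  let B : R[X] := Polynomial.X - Polynomial.C b
  let r : R[X] := (m + 1 : R[X]) * B * g + (n + 1 : R[X]) * A * g + A * B * Polynomial.derivative g
  have hder : Polynomial.derivative p = A ^ m * B ^ n * r := by
    rw [hq, hg]
    simp only [Polynomial.derivative_mul, Polynomial.derivative_pow_succ,
      Polynomial.derivative_X_sub_C, r, A, B]
    simp
    ring
  by_contra! hcon
  have hr : ∀ z, a ≤ z → z ≤ b → r.eval z ≠ 0 := by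
    intro z hz hz' h0
    rcases hz.eq_or_lt with rfl | hz
    · simp [r, A, B, sub_eq_zero, hab.ne, hga] at h0
      exact absurd h0 (by positivity)
    · rcases hz'.eq_or_lt with rfl | hz'
      · have : g.eval z ≠ 0 := hgb
        simp [r, A, B, sub_eq_zero, hab.ne', this] at h0
        exact absurd h0 (by positivity)
      · exact hcon z hz hz' (by rw [hder]; simp [h0])
  have h1 := IsRealClosed.eval_mul_eval_pos hab.le hr
  simp only [r, A, B, Polynomial.eval_add, Polynomial.eval_mul, Polynomial.eval_sub,
    Polynomial.eval_X, Polynomial.eval_C, sub_self, Polynomial.eval_natCast,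
    Polynomial.eval_one, mul_zero, zero_mul, add_zero, zero_add] at h1
  have h2 : 0 < ((m : R) + 1) * ((n : R) + 1) * (b - a) ^ 2 * (g.eval a * g.eval b) := by
    have := sub_pos.2 hab
    positivity
  nlinarith

end IntermediateValue

/-! ### The Cauchy index and the Sturm–Tarski theorem -/

section CauchyIndex

open scoped Polynomial

variable {R : Type*} [Field R]

theorem Polynomial.rootMultiplicity_pow_mul {x : R} {m : ℕ} {u : R[X]}
    (hu : u.eval x ≠ 0) :
    ((Polynomial.X - Polynomial.C x) ^ m * u).rootMultiplicity x = m := by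
  have hu0 : u ≠ 0 := by rintro rfl; simp at hu
  have h0 : (Polynomial.X - Polynomial.C x) ^ m * u ≠ 0 :=
    mul_ne_zero (pow_ne_zero _ (Polynomial.X_sub_C_ne_zero x)) hu0
  rw [Polynomial.rootMultiplicity_mul h0, Polynomial.rootMultiplicity_X_sub_C_pow,
    Polynomial.rootMultiplicity_eq_zero hu, add_zero]

theorem Polynomial.exists_eq_pow_mul {r : R[X]} (hr : r ≠ 0) (x : R) :
    ∃ u : R[X], u.eval x ≠ 0 ∧
      r = (Polynomial.X - Polynomial.C x) ^ r.rootMultiplicity x * u := by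
  obtain ⟨u, hu, hd⟩ := Polynomial.exists_eq_pow_rootMultiplicity_mul_and_not_dvd r hr x
  exact ⟨u, fun h => hd (Polynomial.dvd_iff_isRoot.2 h), hu⟩

variable [LinearOrder R]

/-- Half the change of sign of the polynomial `r` at the point `x`, from left to right: `1`, `0` or
`-1`. Writing `r = (X - x) ^ m u` with `u x ≠ 0`, it is the sign of `u x` if `m` is odd, and `0` if
`m` is even. -/
noncomputable def Polynomial.signJump (r : R[X]) (x : R) : ℤ :=
  if Odd (r.rootMultiplicity x) then
    (SignType.sign ((r /ₘ (Polynomial.X - Polynomial.C x) ^ r.rootMultiplicity x).eval x) : ℤ)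
  else 0

/-- The Cauchy index of `q / p`, counting the jumps between `-∞` and `+∞` with their signs. At a
point the fraction has a pole exactly if `p` vanishes there to a higher order than `q`, and it jumps
there as `p q` does. -/
noncomputable def Polynomial.cauchyIndex (p q : R[X]) : ℤ :=
  ∑ x ∈ p.roots.toFinset, if q.rootMultiplicity x < p.rootMultiplicity x then
    (p * q).signJump x else 0

/-- The sign of a polynomial near `+∞`. -/
noncomputable def Polynomial.signTop (r : R[X]) : ℤ := (SignType.sign r.leadingCoeff : ℤ)

/-- The sign of a polynomial near `-∞`. -/
noncomputable def Polynomial.signBot (r : R[X]) : ℤ := (-1) ^ r.natDegree * r.signTop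

theorem Polynomial.signJump_pow_mul {x : R} {m : ℕ} {u : R[X]} (hu : u.eval x ≠ 0) :
    ((Polynomial.X - Polynomial.C x) ^ m * u).signJump x =
      if Odd m then (SignType.sign (u.eval x) : ℤ) else 0 := by
  rw [Polynomial.signJump, Polynomial.rootMultiplicity_pow_mul hu,
    Polynomial.mul_divByMonic_cancel_left _ ((Polynomial.monic_X_sub_C x).pow m)]

theorem Polynomial.signJump_eq_zero {r : R[X]} {x : R} (h : r.eval x ≠ 0) : r.signJump x = 0 := by
  rw [Polynomial.signJump, Polynomial.rootMultiplicity_eq_zero h]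
  simp

variable [IsStrictOrderedRing R]

theorem Polynomial.signTop_mul (p q : R[X]) : (p * q).signTop = p.signTop * q.signTop := by
  simp [Polynomial.signTop, sign_mul]

theorem sign_eq_of_mul_pos {x y : R} (h : 0 < x * y) : SignType.sign x = SignType.sign y := by
  rcases pos_and_pos_or_neg_and_neg_of_mul_pos h with ⟨h1, h2⟩ | ⟨h1, h2⟩
  · rw [sign_pos h1, sign_pos h2]
  · rw [sign_neg h1, sign_neg h2]

/-- At a pole of `p / q`, adding a multiple of `q` to `p` does not change the lowest term of `p`. -/
theorem Polynomial.cauchyIndex_add_mul (q p u : R[X]) :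
    q.cauchyIndex (p + u * q) = q.cauchyIndex p := by
  by_cases hq : q = 0
  · simp [Polynomial.cauchyIndex, hq]
  have aux : ∀ (p u : R[X]) (x : R), p ≠ 0 → p.rootMultiplicity x < q.rootMultiplicity x →
      (p + u * q).rootMultiplicity x < q.rootMultiplicity x ∧ p + u * q ≠ 0 ∧
      (q * (p + u * q)).signJump x = (q * p).signJump x := by
    intro p u x hp hlt
    obtain ⟨p', hp', hpe⟩ := Polynomial.exists_eq_pow_mul hp x
    obtain ⟨q', hq', hqe⟩ := Polynomial.exists_eq_pow_mul hq x
    obtain ⟨d, hd⟩ := Nat.exists_eq_add_of_lt hlt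
    have hsum : p + u * q = (Polynomial.X - Polynomial.C x) ^ p.rootMultiplicity x *
        (p' + u * (Polynomial.X - Polynomial.C x) ^ (d + 1) * q') := by
      conv_lhs => rw [hpe, hqe, hd]
      ring
    have he : (p' + u * (Polynomial.X - Polynomial.C x) ^ (d + 1) * q').eval x = p'.eval x := by
      simp
    refine ⟨?_, ?_, ?_⟩
    · rw [hsum, Polynomial.rootMultiplicity_pow_mul (by rw [he]; exact hp')]
      exact hlt
    · intro h0
      rw [hsum] at h0
      rcases mul_eq_zero.1 h0 with h1 | h1
      · exact pow_ne_zero _ (Polynomial.X_sub_C_ne_zero x) h1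
      · rw [h1] at he; exact hp' (by simpa using he.symm)
    · have e1 : q * (p + u * q) = (Polynomial.X - Polynomial.C x) ^
          (q.rootMultiplicity x + p.rootMultiplicity x) *
          (q' * (p' + u * (Polynomial.X - Polynomial.C x) ^ (d + 1) * q')) := by
        conv_lhs => rw [hsum]; lhs; rw [hqe]
        ring
      have e2 : q * p = (Polynomial.X - Polynomial.C x) ^
          (q.rootMultiplicity x + p.rootMultiplicity x) * (q' * p') := by
        conv_lhs => rw [hpe]; lhs; rw [hqe]
        ring
      rw [e1, e2, Polynomial.signJump_pow_mul (by rw [Polynomial.eval_mul, he]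
                                                  exact mul_ne_zero hq' hp'),
        Polynomial.signJump_pow_mul (by rw [Polynomial.eval_mul]; exact mul_ne_zero hq' hp'),
        Polynomial.eval_mul, Polynomial.eval_mul, he]
  refine Finset.sum_congr rfl fun x _ => ?_
  have hz : ∀ p : R[X], p = 0 → (if p.rootMultiplicity x < q.rootMultiplicity x then
      (q * p).signJump x else 0) = 0 := by
    rintro p rfl
    simp [Polynomial.signJump]
  by_cases hp : p = 0
  · rw [hz p hp]
    by_cases hs : p + u * q = 0
    · rw [hz _ hs]
    · rw [if_neg]
      intro hlt
      obtain ⟨-, h0, -⟩ := aux _ (-u) x hs hlt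
      exact h0 (by rw [hp]; ring)
  · by_cases hlt : p.rootMultiplicity x < q.rootMultiplicity x
    · obtain ⟨h1, -, h3⟩ := aux p u x hp hlt
      rw [if_pos hlt, if_pos h1, h3]
    · rw [if_neg hlt]
      by_cases hs : p + u * q = 0
      · rw [hz _ hs]
      · rw [if_neg]
        intro hlt'
        obtain ⟨h1, -, -⟩ := aux _ (-u) x hs hlt'
        exact hlt (by convert h1 using 2; ring)

theorem Polynomial.cauchyIndex_C_mul (q p : R[X]) {c : R} (hc : 0 < c) :
    q.cauchyIndex (Polynomial.C c * p) = q.cauchyIndex p := by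
  refine Finset.sum_congr rfl fun x hx => ?_
  by_cases hp : p = 0
  · simp [hp]
  have hq : q ≠ 0 := by rintro rfl; simp at hx
  obtain ⟨p', hp', hpe⟩ := Polynomial.exists_eq_pow_mul hp x
  obtain ⟨q', hq', hqe⟩ := Polynomial.exists_eq_pow_mul hq x
  have e0 : Polynomial.C c * p = (Polynomial.X - Polynomial.C x) ^ p.rootMultiplicity x *
      (Polynomial.C c * p') := by
    conv_lhs => rw [hpe]
    ring
  have e1 : q * (Polynomial.C c * p) = (Polynomial.X - Polynomial.C x) ^
      (q.rootMultiplicity x + p.rootMultiplicity x) * (Polynomial.C c * (q' * p')) := by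
    conv_lhs => rw [hpe]; lhs; rw [hqe]
    ring
  have e2 : q * p = (Polynomial.X - Polynomial.C x) ^
      (q.rootMultiplicity x + p.rootMultiplicity x) * (q' * p') := by
    conv_lhs => rw [hpe]; lhs; rw [hqe]
    ring
  have hne : (q' * p').eval x ≠ 0 := by rw [Polynomial.eval_mul]; exact mul_ne_zero hq' hp'
  have hne' : (Polynomial.C c * (q' * p')).eval x ≠ 0 := by
    rw [Polynomial.eval_mul, Polynomial.eval_C]; exact mul_ne_zero hc.ne' hne
  have h1 : (Polynomial.C c * p).rootMultiplicity x = p.rootMultiplicity x := by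
    rw [e0, Polynomial.rootMultiplicity_pow_mul]
    rw [Polynomial.eval_mul, Polynomial.eval_C]; exact mul_ne_zero hc.ne' hp'
  rw [h1, e1, e2, Polynomial.signJump_pow_mul hne, Polynomial.signJump_pow_mul hne',
    Polynomial.eval_mul, Polynomial.eval_C, sign_mul, sign_pos hc, one_mul]

/-- Sturm's count, weighted by the signs of `q`, of the roots of `p` as a Cauchy index. -/
theorem Polynomial.cauchyIndex_derivative_mul {p : R[X]} (hp : p ≠ 0) (q : R[X]) :
    p.cauchyIndex (Polynomial.derivative p * q) =
      ∑ x ∈ p.roots.toFinset, (SignType.sign (q.eval x) : ℤ) := by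
  refine Finset.sum_congr rfl fun x hx => ?_
  have hx' : p.IsRoot x := by
    rw [Multiset.mem_toFinset] at hx
    exact Polynomial.isRoot_of_mem_roots hx
  obtain ⟨u, hu, hpe⟩ := Polynomial.exists_eq_pow_mul hp x
  obtain ⟨m, hm⟩ := Nat.exists_eq_succ_of_ne_zero ((Polynomial.rootMultiplicity_pos hp).2 hx').ne'
  rw [hm] at hpe
  let v : R[X] := (m + 1 : R[X]) * u + (Polynomial.X - Polynomial.C x) * Polynomial.derivative u
  have hv : v.eval x = (m + 1) * u.eval x := by simp [v]
  have hder : Polynomial.derivative p = (Polynomial.X - Polynomial.C x) ^ m * v := by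
    conv_lhs => rw [hpe]
    simp only [Polynomial.derivative_mul, Polynomial.derivative_pow_succ,
      Polynomial.derivative_X_sub_C, v, Nat.succ_eq_add_one]
    simp
    ring
  have hm1 : (0 : R) < m + 1 := by positivity
  by_cases hq : q.eval x = 0
  · rw [hq, sign_zero]
    obtain ⟨q', rfl⟩ := Polynomial.dvd_iff_isRoot.2 hq
    by_cases h0 : Polynomial.derivative p * ((Polynomial.X - Polynomial.C x) * q') = 0
    · simp [h0, Polynomial.signJump]
    · rw [if_neg]
      · simp
      rw [not_lt, Polynomial.le_rootMultiplicity_iff h0, hm, hder]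
      exact ⟨v * q', by rw [Nat.succ_eq_add_one]; ring⟩
  · have hne : (v * q).eval x ≠ 0 := by
      rw [Polynomial.eval_mul, hv]; exact mul_ne_zero (mul_ne_zero hm1.ne' hu) hq
    rw [if_pos]
    · have e : p * (Polynomial.derivative p * q) =
          (Polynomial.X - Polynomial.C x) ^ (2 * m + 1) * (u * (v * q)) := by
        rw [hder]; conv_lhs => rw [hpe]
        rw [Nat.succ_eq_add_one]; ring
      rw [e, Polynomial.signJump_pow_mul (by rw [Polynomial.eval_mul]; exact mul_ne_zero hu hne),
        if_pos (by exact ⟨m, rfl⟩), Polynomial.eval_mul, Polynomial.eval_mul, hv]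
      congr 1
      rw [show u.eval x * ((m + 1) * u.eval x * q.eval x) =
        ((m + 1) * (u.eval x * u.eval x)) * q.eval x by ring, sign_mul,
        sign_pos (mul_pos hm1 (mul_self_pos.2 hu)), one_mul]
    · rw [hm, hder, mul_assoc, Polynomial.rootMultiplicity_pow_mul hne]
      exact Nat.lt_succ_self m

variable [IsRealClosed R]

/-- The sign changes of a polynomial along the line add up to the difference of its signs near
`+∞` and `-∞`. The induction splits off the greatest root. -/
theorem Polynomial.two_mul_sum_signJump {r : R[X]} (hr : r ≠ 0) (s : Finset R)
    (hs : r.roots.toFinset ⊆ s) : 2 * ∑ x ∈ s, r.signJump x = r.signTop - r.signBot := by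
  classical
  induction hd : r.natDegree generalizing r s with
  | zero =>
    obtain ⟨a, rfl⟩ := Polynomial.natDegree_eq_zero.1 hd
    have ha : a ≠ 0 := by rintro rfl; simp at hr
    rw [Finset.sum_eq_zero fun x _ => Polynomial.signJump_eq_zero (by simpa using ha)]
    simp [Polynomial.signBot]
  | succ d ih =>
    have hmem : ∀ {p : R[X]}, p ≠ 0 → ∀ x, x ∈ p.roots.toFinset ↔ p.eval x = 0 := by
      intro p hp x
      rw [Multiset.mem_toFinset, Polynomial.mem_roots hp, Polynomial.IsRoot]
    rcases Finset.eq_empty_or_nonempty r.roots.toFinset with he | hne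
    · have hno : ∀ x, r.eval x ≠ 0 := fun x h0 => by
        have := (hmem hr x).2 h0
        rw [he] at this
        simp at this
      rw [Finset.sum_eq_zero fun x _ => Polynomial.signJump_eq_zero (hno x)]
      have h1 := IsRealClosed.eval_mul_leadingCoeff_pos (p := r) (c := 0) fun z _ => hno z
      have h2 := IsRealClosed.eval_mul_leadingCoeff_pos (p := r.comp (-Polynomial.X)) (c := 0)
        fun z _ => by simpa using hno (-z)
      have h3 : (r.comp (-Polynomial.X)).leadingCoeff = (-1) ^ r.natDegree * r.leadingCoeff := by
        rw [Polynomial.leadingCoeff_comp (by simp)]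
        simp [mul_comm]
      rw [h3] at h2
      simp only [Polynomial.eval_comp, Polynomial.eval_neg, Polynomial.eval_X, neg_zero] at h2
      rw [Polynomial.signBot, Polynomial.signTop]
      rcases Nat.even_or_odd r.natDegree with hev | hodd
      · simp [hev.neg_one_pow]
      · rw [hodd.neg_one_pow] at h2
        linarith
    · set c := r.roots.toFinset.max' hne with hc
      have hcr : r.eval c = 0 := (hmem hr c).1 (Finset.max'_mem _ hne)
      have hmax : ∀ z, r.eval z = 0 → z ≤ c := fun z hz =>
        Finset.le_max' _ _ ((hmem hr z).2 hz)
      obtain ⟨r', hr'⟩ := Polynomial.dvd_iff_isRoot.2 hcr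
      have hr'0 : r' ≠ 0 := by rintro rfl; exact hr (by rw [hr', mul_zero])
      have hd' : r'.natDegree = d := by
        have := Polynomial.natDegree_mul (Polynomial.X_sub_C_ne_zero c) hr'0
        rw [← hr', hd, Polynomial.natDegree_X_sub_C] at this
        omega
      have hih := ih hr'0 s (fun x hx => hs ((hmem hr x).2 (by
        rw [hr']; simp [(hmem hr'0 x).1 hx]))) hd'
      have hcs : c ∈ s := hs (Finset.max'_mem _ hne)
      rw [← Finset.add_sum_erase _ _ hcs] at hih ⊢
      have hlt : ∑ x ∈ s.erase c, r.signJump x = - ∑ x ∈ s.erase c, r'.signJump x := by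
        rw [← Finset.sum_neg_distrib]
        refine Finset.sum_congr rfl fun x hx => ?_
        by_cases hrx : r.eval x = 0
        · have hxc : x < c := lt_of_le_of_ne (hmax x hrx) (Finset.ne_of_mem_erase hx)
          obtain ⟨u, hu, hue⟩ := Polynomial.exists_eq_pow_mul hr'0 x
          have e : r = (Polynomial.X - Polynomial.C x) ^ r'.rootMultiplicity x *
              ((Polynomial.X - Polynomial.C c) * u) := by
            rw [hr']; conv_lhs => rw [hue]
            ring
          have hne : ((Polynomial.X - Polynomial.C c) * u).eval x ≠ 0 := by
            simp [sub_eq_zero, hxc.ne, hu]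
          conv_lhs => rw [e, Polynomial.signJump_pow_mul hne]
          conv_rhs => rw [hue, Polynomial.signJump_pow_mul hu]
          split_ifs
          · rw [Polynomial.eval_mul, sign_mul, Polynomial.eval_sub, Polynomial.eval_X,
              Polynomial.eval_C, sign_neg (sub_neg.2 hxc)]
            simp
          · simp
        · rw [Polynomial.signJump_eq_zero hrx, Polynomial.signJump_eq_zero (fun h0 => hrx (by
            rw [hr']; simp [h0])), neg_zero]
      obtain ⟨u, hu, hue⟩ := Polynomial.exists_eq_pow_mul hr'0 c
      have hsu : SignType.sign (u.eval c) = SignType.sign r'.leadingCoeff := by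
        have : r'.leadingCoeff = u.leadingCoeff := by
          conv_lhs => rw [hue]
          rw [Polynomial.leadingCoeff_mul, ((Polynomial.monic_X_sub_C c).pow _).leadingCoeff,
            one_mul]
        rw [this]
        refine sign_eq_of_mul_pos (IsRealClosed.eval_mul_leadingCoeff_pos fun z hz h0 => ?_)
        have hz' := hmax z (by rw [hr', hue]; simp [h0])
        exact hu (le_antisymm hz hz' ▸ h0)
      have e : r = (Polynomial.X - Polynomial.C c) ^ (r'.rootMultiplicity c + 1) * u := by
        rw [hr']; conv_lhs => rw [hue]
        ring
      have hj : r.signJump c = if Odd (r'.rootMultiplicity c + 1) then r'.signTop else 0 := by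
        conv_lhs => rw [e, Polynomial.signJump_pow_mul hu]
        rw [hsu]; rfl
      have hj' : r'.signJump c = if Odd (r'.rootMultiplicity c) then r'.signTop else 0 := by
        conv_lhs => rw [hue, Polynomial.signJump_pow_mul hu]
        rw [hsu]; rfl
      have htop : r.signTop = r'.signTop := by
        rw [hr', Polynomial.signTop_mul]
        simp [Polynomial.signTop]
      have hbot : r.signBot = - r'.signBot := by
        rw [Polynomial.signBot, Polynomial.signBot, htop, hd, hd', pow_succ]
        ring
      rw [hlt, hj, htop, hbot]
      rw [hj'] at hih
      rcases Nat.even_or_odd (r'.rootMultiplicity c) with hev | hodd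
      · rw [if_neg (Nat.not_odd_iff_even.2 hev)] at hih
        rw [if_pos hev.add_one]
        linarith
      · rw [if_pos hodd] at hih
        rw [if_neg (Nat.not_odd_iff_even.2 hodd.add_one)]
        linarith

/-- The reciprocity law for Cauchy indices. Where `p` and `q` vanish to different orders, exactly
one of the two fractions has a pole; where they vanish to the same order, `p q` does not change its
sign. -/
theorem Polynomial.two_mul_cauchyIndex_add {p q : R[X]} (hp : p ≠ 0) (hq : q ≠ 0) :
    2 * (p.cauchyIndex q + q.cauchyIndex p) = (p * q).signTop - (p * q).signBot := by
  classical
  have hpq : p * q ≠ 0 := mul_ne_zero hp hq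
  rw [← Polynomial.two_mul_sum_signJump hpq (p * q).roots.toFinset subset_rfl]
  have hext : ∀ p q : R[X], p ≠ 0 → q ≠ 0 → p.cauchyIndex q =
      ∑ x ∈ (p * q).roots.toFinset, if q.rootMultiplicity x < p.rootMultiplicity x then
        (p * q).signJump x else 0 := by
    intro p q hp hq
    refine Finset.sum_subset ?_ fun x _ hx => ?_
    · intro x hx
      rw [Multiset.mem_toFinset, Polynomial.mem_roots hp] at hx
      rw [Multiset.mem_toFinset, Polynomial.mem_roots (mul_ne_zero hp hq)]
      simp [Polynomial.IsRoot, hx.eq_zero]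
    · rw [if_neg]
      rw [Multiset.mem_toFinset, Polynomial.mem_roots hp] at hx
      rw [Polynomial.rootMultiplicity_eq_zero hx]
      omega
  rw [hext p q hp hq, hext q p hq hp, mul_comm q p, ← Finset.sum_add_distrib]
  congr 1
  refine Finset.sum_congr rfl fun x _ => ?_
  rcases lt_trichotomy (q.rootMultiplicity x) (p.rootMultiplicity x) with h | h | h
  · rw [if_pos h, if_neg (by omega), add_zero]
  · rw [if_neg (by omega), if_neg (by omega), add_zero, Polynomial.signJump, if_neg]
    rw [Polynomial.rootMultiplicity_mul hpq, h, Nat.not_odd_iff_even]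
    exact ⟨_, rfl⟩
  · rw [if_neg (by omega), if_pos h, zero_add]

end CauchyIndex

/-! ### Semi-algebraic sets -/

section SemialgebraicSets

variable {R : Type*} [Field R] [LinearOrder R] {σ : Type*}

theorem IsBasicSemialgebraic.isSemialgebraic {S : Set (σ → R)} (h : IsBasicSemialgebraic S) :
    IsSemialgebraic S :=
  ⟨{S}, Set.finite_singleton _, by simpa using h, by simp⟩

theorem isSemialgebraic_eq_zero (f : MvPolynomial σ R) : IsSemialgebraic {x | eval x f = 0} :=
  IsBasicSemialgebraic.isSemialgebraic ⟨{f}, ∅, by simp⟩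

theorem isSemialgebraic_pos (f : MvPolynomial σ R) : IsSemialgebraic {x | 0 < eval x f} :=
  IsBasicSemialgebraic.isSemialgebraic ⟨∅, {f}, by simp⟩

theorem isSemialgebraic_empty : IsSemialgebraic (∅ : Set (σ → R)) :=
  ⟨∅, Set.finite_empty, by simp, by simp⟩

theorem isSemialgebraic_univ : IsSemialgebraic (Set.univ : Set (σ → R)) :=
  IsBasicSemialgebraic.isSemialgebraic ⟨∅, ∅, by simp⟩

theorem IsSemialgebraic.union {S T : Set (σ → R)} (hS : IsSemialgebraic S)
    (hT : IsSemialgebraic T) : IsSemialgebraic (S ∪ T) := by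
  obtain ⟨A, hA, hA', rfl⟩ := hS
  obtain ⟨B, hB, hB', rfl⟩ := hT
  refine ⟨A ∪ B, hA.union hB, ?_, (Set.sUnion_union A B).symm⟩
  rintro C (hC | hC)
  exacts [hA' C hC, hB' C hC]

theorem IsSemialgebraic.inter {S T : Set (σ → R)} (hS : IsSemialgebraic S)
    (hT : IsSemialgebraic T) : IsSemialgebraic (S ∩ T) := by
  classical
  obtain ⟨A, hA, hA', rfl⟩ := hS
  obtain ⟨B, hB, hB', rfl⟩ := hT
  refine ⟨Set.image2 (· ∩ ·) A B, hA.image2 _ hB, ?_, ?_⟩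
  · rintro _ ⟨C, hC, D, hD, rfl⟩
    obtain ⟨F, H, rfl⟩ := hA' C hC
    obtain ⟨F', H', rfl⟩ := hB' D hD
    refine ⟨F ∪ F', H ∪ H', ?_⟩
    ext x
    simp only [Set.mem_inter_iff, Set.mem_ofPred_eq, Finset.mem_union]
    constructor
    · rintro ⟨⟨h1, h2⟩, h3, h4⟩
      exact ⟨fun f hf => hf.elim (h1 f) (h3 f), fun f hf => hf.elim (h2 f) (h4 f)⟩
    · rintro ⟨h1, h2⟩
      exact ⟨⟨fun f hf => h1 f (.inl hf), fun f hf => h2 f (.inl hf)⟩,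
        fun f hf => h1 f (.inr hf), fun f hf => h2 f (.inr hf)⟩
  · ext x
    simp only [Set.mem_inter_iff, Set.mem_sUnion, Set.mem_image2]
    constructor
    · rintro ⟨⟨C, hC, hx⟩, D, hD, hx'⟩
      exact ⟨_, ⟨C, hC, D, hD, rfl⟩, hx, hx'⟩
    · rintro ⟨_, ⟨C, hC, D, hD, rfl⟩, hx, hx'⟩
      exact ⟨⟨C, hC, hx⟩, D, hD, hx'⟩

theorem isSemialgebraic_biUnion {ι : Type*} {I : Set ι} (hI : I.Finite) {S : ι → Set (σ → R)}
    (h : ∀ i ∈ I, IsSemialgebraic (S i)) : IsSemialgebraic (⋃ i ∈ I, S i) := by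
  induction I, hI using Set.Finite.induction_on with
  | empty => simpa using isSemialgebraic_empty
  | insert _ _ ih =>
    rw [Set.biUnion_insert]
    exact (h _ (Set.mem_insert _ _)).union (ih fun i hi => h i (Set.mem_insert_of_mem _ hi))

theorem isSemialgebraic_biInter {ι : Type*} {I : Set ι} (hI : I.Finite) {S : ι → Set (σ → R)}
    (h : ∀ i ∈ I, IsSemialgebraic (S i)) : IsSemialgebraic (⋂ i ∈ I, S i) := by
  induction I, hI using Set.Finite.induction_on with
  | empty => simpa using isSemialgebraic_univ
  | insert _ _ ih =>
    rw [Set.biInter_insert]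
    exact (h _ (Set.mem_insert _ _)).inter (ih fun i hi => h i (Set.mem_insert_of_mem _ hi))

theorem isSemialgebraic_neg [IsStrictOrderedRing R] (f : MvPolynomial σ R) :
    IsSemialgebraic {x | eval x f < 0} := by
  simpa using isSemialgebraic_pos (-f)

theorem IsSemialgebraic.compl [IsStrictOrderedRing R] {S : Set (σ → R)} (hS : IsSemialgebraic S) :
    IsSemialgebraic Sᶜ := by
  obtain ⟨A, hA, hA', rfl⟩ := hS
  rw [Set.sUnion_eq_biUnion, Set.compl_iUnion₂]
  refine isSemialgebraic_biInter hA fun B hB => ?_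
  obtain ⟨F, H, rfl⟩ := hA' B hB
  have : {x : σ → R | (∀ f ∈ F, eval x f = 0) ∧ ∀ h ∈ H, 0 < eval x h}ᶜ =
      (⋃ f ∈ (F : Set (MvPolynomial σ R)), ({x | 0 < eval x f} ∪ {x | eval x f < 0})) ∪
      (⋃ h ∈ (H : Set (MvPolynomial σ R)), ({x | eval x h = 0} ∪ {x | eval x h < 0})) := by
    ext x
    simp only [Set.mem_compl_iff, Set.mem_ofPred_eq, Set.mem_union, Set.mem_iUnion,
      Finset.mem_coe, not_and_or, not_forall, exists_prop, not_lt, ← ne_eq, ne_iff_lt_or_gt,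
      le_iff_eq_or_lt]
    simp only [or_comm]
  rw [this]
  exact (isSemialgebraic_biUnion F.finite_toSet fun f _ =>
    (isSemialgebraic_pos f).union (isSemialgebraic_neg f)).union
    (isSemialgebraic_biUnion H.finite_toSet fun f _ =>
      (isSemialgebraic_eq_zero f).union (isSemialgebraic_neg f))

/-- Semi-algebraic sets pull back along polynomial maps. -/
theorem IsSemialgebraic.preimage {τ : Type*} {S : Set (τ → R)} (hS : IsSemialgebraic S)
    (φ : τ → MvPolynomial σ R) : IsSemialgebraic {x : σ → R | (fun t => eval x (φ t)) ∈ S} := by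
  classical
  obtain ⟨A, hA, hA', rfl⟩ := hS
  have : {x : σ → R | (fun t => eval x (φ t)) ∈ ⋃₀ A} =
      ⋃ B ∈ A, {x : σ → R | (fun t => eval x (φ t)) ∈ B} := by
    ext x; simp
  rw [this]
  refine isSemialgebraic_biUnion hA fun B hB => ?_
  obtain ⟨F, H, rfl⟩ := hA' B hB
  refine IsBasicSemialgebraic.isSemialgebraic ⟨F.image (bind₁ φ), H.image (bind₁ φ), ?_⟩
  ext x
  have : ∀ f : MvPolynomial τ R, eval x (bind₁ φ f) = eval (fun t => eval x (φ t)) f := by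
    intro f
    exact eval₂Hom_bind₁ _ _ _ _
  simp [this]

/-- An integer-valued function with finitely many values and semi-algebraic fibres. -/
structure IsSemialgebraicFun (F : (σ → R) → ℤ) : Prop where
  finite_range : (Set.range F).Finite
  fiber : ∀ z, IsSemialgebraic {a | F a = z}

theorem IsSemialgebraicFun.const (z : ℤ) : IsSemialgebraicFun fun _ : σ → R => z where
  finite_range := (Set.finite_singleton z).subset (by rintro _ ⟨_, rfl⟩; rfl)
  fiber y := by
    by_cases h : z = y
    · simpa [h] using isSemialgebraic_univ
    · simpa [h] using isSemialgebraic_empty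

theorem IsSemialgebraicFun.map₂ {F G : (σ → R) → ℤ} (hF : IsSemialgebraicFun F)
    (hG : IsSemialgebraicFun G) (g : ℤ → ℤ → ℤ) :
    IsSemialgebraicFun fun a => g (F a) (G a) where
  finite_range := (hF.finite_range.image2 g hG.finite_range).subset (by
    rintro _ ⟨a, rfl⟩; exact ⟨_, ⟨a, rfl⟩, _, ⟨a, rfl⟩, rfl⟩)
  fiber z := by
    have : {a | g (F a) (G a) = z} =
        ⋃ p ∈ {p ∈ Set.range F ×ˢ Set.range G | g p.1 p.2 = z},
          ({a | F a = p.1} ∩ {a | G a = p.2}) := by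
      ext a
      simp only [Set.mem_ofPred_eq, Set.mem_iUnion, Set.mem_inter_iff, exists_prop]
      constructor
      · exact fun h => ⟨(F a, G a), ⟨⟨⟨a, rfl⟩, ⟨a, rfl⟩⟩, h⟩, rfl, rfl⟩
      · rintro ⟨p, ⟨-, h⟩, h1, h2⟩
        rw [h1, h2, h]
    rw [this]
    exact isSemialgebraic_biUnion ((hF.finite_range.prod hG.finite_range).subset
      (Set.sep_subset _ _)) fun p _ => (hF.fiber _).inter (hG.fiber _)

theorem IsSemialgebraicFun.map {F : (σ → R) → ℤ} (hF : IsSemialgebraicFun F) (g : ℤ → ℤ) :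
    IsSemialgebraicFun fun a => g (F a) :=
  hF.map₂ hF fun x _ => g x

theorem IsSemialgebraicFun.isSemialgebraic {F : (σ → R) → ℤ} (hF : IsSemialgebraicFun F)
    (P : ℤ → Prop) : IsSemialgebraic {a | P (F a)} := by
  classical
  have := (hF.map fun z => if P z then 1 else 0).fiber 1
  simpa using this

variable [IsStrictOrderedRing R]

theorem IsSemialgebraicFun.piecewise {F G K : (σ → R) → ℤ} {U : Set (σ → R)}
    (hU : IsSemialgebraic U) (hF : IsSemialgebraicFun F) (hG : IsSemialgebraicFun G)
    (h1 : ∀ a ∈ U, K a = F a) (h2 : ∀ a ∉ U, K a = G a) : IsSemialgebraicFun K where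
  finite_range := (hF.finite_range.union hG.finite_range).subset (by
    rintro _ ⟨a, rfl⟩
    by_cases h : a ∈ U
    · exact .inl ⟨a, (h1 a h).symm⟩
    · exact .inr ⟨a, (h2 a h).symm⟩)
  fiber z := by
    have : {a | K a = z} = (U ∩ {a | F a = z}) ∪ (Uᶜ ∩ {a | G a = z}) := by
      ext a
      by_cases h : a ∈ U
      · simp [h, h1 a h]
      · simp [h, h2 a h]
    rw [this]
    exact (hU.inter (hF.fiber z)).union (hU.compl.inter (hG.fiber z))

theorem isSemialgebraicFun_sign (f : MvPolynomial σ R) :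
    IsSemialgebraicFun fun a => (SignType.sign (eval a f) : ℤ) :=
  IsSemialgebraicFun.piecewise (F := fun _ => 1) (G := fun a => if eval a f < 0 then -1 else 0)
    (isSemialgebraic_pos f) (.const 1)
    (IsSemialgebraicFun.piecewise (isSemialgebraic_neg f) (.const (-1)) (.const 0)
      (fun a ha => if_pos ha) (fun a ha => if_neg ha))
    (fun a ha => by simp [sign_pos (show 0 < eval a f from ha)]) (fun a ha => by
      split_ifs with h
      · simp [sign_neg h]
      · simp [le_antisymm (not_lt.1 ha) (not_lt.1 h)])

end SemialgebraicSets

/-! ### Projection of semi-algebraic sets along one coordinate -/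

section Projection

open scoped Polynomial

variable {R : Type*} [Field R] [LinearOrder R] {σ : Type*}

/-- The specialization at a point `a` of a polynomial with coefficients polynomials in the
coordinates of `a`. -/
noncomputable abbrev specialize {R σ : Type*} [Field R] (a : σ → R)
    (p : (MvPolynomial σ R)[X]) : R[X] :=
  p.map (eval a)

theorem specialize_eraseLead {R σ : Type*} [Field R] {a : σ → R} {p : (MvPolynomial σ R)[X]}
    (h : eval a p.leadingCoeff = 0) : specialize a p.eraseLead = specialize a p := by
  conv_rhs => rw [specialize, ← p.eraseLead_add_C_mul_X_pow, Polynomial.map_add,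
    Polynomial.map_mul, Polynomial.map_C, h, Polynomial.C_0, zero_mul, add_zero]

theorem Polynomial.signTop_eq_zero {p : R[X]} : p.signTop = 0 ↔ p = 0 := by
  rw [Polynomial.signTop, ← Polynomial.leadingCoeff_eq_zero,
    ← sign_eq_zero_iff (a := p.leadingCoeff)]
  cases SignType.sign p.leadingCoeff <;> simp

theorem Polynomial.signTop_eq_one {p : R[X]} : p.signTop = 1 ↔ 0 < p.leadingCoeff := by
  rw [Polynomial.signTop, ← sign_eq_one_iff (a := p.leadingCoeff)]
  cases SignType.sign p.leadingCoeff <;> simp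

variable [IsStrictOrderedRing R]

theorem Polynomial.signBot_eq_signTop_comp_neg (p : R[X]) :
    p.signBot = (p.comp (-Polynomial.X)).signTop := by
  rw [Polynomial.signBot, Polynomial.signTop, Polynomial.signTop,
    Polynomial.leadingCoeff_comp (by simp), sign_mul]
  rcases Nat.even_or_odd p.natDegree with h | h
  · simp [h.neg_one_pow]
  · simp [h.neg_one_pow]

/-- The degree and the sign of the leading coefficient depend semi-algebraically on the
coefficients: where the leading coefficient vanishes, the leading term may be dropped. -/
theorem isSemialgebraicFun_natDegree_signTop (g : ℕ → ℤ → ℤ) (p : (MvPolynomial σ R)[X]) :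
    IsSemialgebraicFun fun a => g (specialize a p).natDegree (specialize a p).signTop := by
  obtain ⟨n, hn⟩ : ∃ n : ℕ, p.degree < n :=
    ⟨p.natDegree + 1,
      Polynomial.degree_le_natDegree.trans_lt (by exact_mod_cast Nat.lt_succ_self _)⟩
  induction n generalizing p with
  | zero =>
    have : p = 0 := Polynomial.degree_eq_bot.1 (Nat.WithBot.lt_zero_iff.1 hn)
    subst this
    simpa using IsSemialgebraicFun.const (R := R) (σ := σ) (g 0 (Polynomial.signTop (0 : R[X])))
  | succ n ih =>
    by_cases hp : p = 0
    · subst hp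
      simpa using IsSemialgebraicFun.const (R := R) (σ := σ) (g 0 (Polynomial.signTop (0 : R[X])))
    refine IsSemialgebraicFun.piecewise (isSemialgebraic_eq_zero p.leadingCoeff)
      (ih p.eraseLead ((Polynomial.degree_eraseLead_lt hp).trans_le (Order.le_of_lt_succ hn)))
      ((isSemialgebraicFun_sign p.leadingCoeff).map (g p.natDegree)) ?_ ?_
    · intro a ha
      simp only [specialize_eraseLead (show eval a p.leadingCoeff = 0 from ha)]
    · intro a ha
      have ha' : eval a p.leadingCoeff ≠ 0 := ha
      simp only [Polynomial.signTop]
      rw [specialize, Polynomial.natDegree_map_of_leadingCoeff_ne_zero _ ha',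
        Polynomial.leadingCoeff_map_of_leadingCoeff_ne_zero _ ha']

theorem isSemialgebraic_specialize_eq_zero (p : (MvPolynomial σ R)[X]) :
    IsSemialgebraic {a | specialize a p = 0} := by
  have := (isSemialgebraicFun_natDegree_signTop (fun _ s => s) p).isSemialgebraic (· = 0)
  simpa only [Polynomial.signTop_eq_zero] using this

/-- One step of pseudo-division, with a square as multiplier so that signs are kept. -/
theorem exists_degree_lt_specialize_eq {p q : (MvPolynomial σ R)[X]} (hp : p ≠ 0) (hq : q ≠ 0)
    (hqp : q.natDegree ≤ p.natDegree) : ∃ r : (MvPolynomial σ R)[X], r.degree < p.degree ∧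
      ∀ a, eval a q.leadingCoeff ≠ 0 →
        (specialize a q).cauchyIndex (specialize a r) =
          (specialize a q).cauchyIndex (specialize a p) := by
  have hlp := Polynomial.leadingCoeff_ne_zero.2 hp
  have hlq := Polynomial.leadingCoeff_ne_zero.2 hq
  set u : (MvPolynomial σ R)[X] := Polynomial.C (p.leadingCoeff * q.leadingCoeff) *
    Polynomial.X ^ (p.natDegree - q.natDegree) with hu
  have hu0 : u ≠ 0 := mul_ne_zero (Polynomial.C_ne_zero.2 (mul_ne_zero hlp hlq))
    (pow_ne_zero _ Polynomial.X_ne_zero)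
  have hl0 : Polynomial.C (q.leadingCoeff ^ 2) ≠ 0 := Polynomial.C_ne_zero.2 (pow_ne_zero _ hlq)
  have hud : u.natDegree = p.natDegree - q.natDegree :=
    Polynomial.natDegree_C_mul_X_pow _ _ (mul_ne_zero hlp hlq)
  refine ⟨Polynomial.C (q.leadingCoeff ^ 2) * p - u * q, ?_, fun a ha => ?_⟩
  · have hd : (Polynomial.C (q.leadingCoeff ^ 2) * p).degree = p.degree :=
      Polynomial.degree_C_mul (pow_ne_zero _ hlq)
    rw [← hd]
    refine Polynomial.degree_sub_lt_left ?_ (mul_ne_zero hl0 hp) ?_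
    · rw [hd, Polynomial.degree_eq_natDegree hp, Polynomial.degree_eq_natDegree
        (mul_ne_zero hu0 hq), Polynomial.natDegree_mul hu0 hq, hud, Nat.sub_add_cancel hqp]
    · rw [Polynomial.leadingCoeff_mul, Polynomial.leadingCoeff_mul, Polynomial.leadingCoeff_C, hu,
        Polynomial.leadingCoeff_C_mul_X_pow]
      ring
  · have : specialize a (Polynomial.C (q.leadingCoeff ^ 2) * p - u * q) =
        Polynomial.C (eval a q.leadingCoeff ^ 2) * specialize a p +
          (-specialize a u) * specialize a q := by
      simp only [specialize, Polynomial.map_sub, Polynomial.map_mul, Polynomial.map_C, ← map_pow]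
      ring
    rw [this, Polynomial.cauchyIndex_add_mul, Polynomial.cauchyIndex_C_mul _ _ (by positivity)]

variable [IsRealClosed R]

/-- The Cauchy index of two polynomials depends semi-algebraically on their coefficients: it is
computed by the signed remainder sequence. -/
theorem isSemialgebraicFun_cauchyIndex (p q : (MvPolynomial σ R)[X]) :
    IsSemialgebraicFun fun a => (specialize a p).cauchyIndex (specialize a q) := by
  have hbound : ∀ p : (MvPolynomial σ R)[X], ∃ n : ℕ, p.degree < n := fun p =>
    ⟨p.natDegree + 1,
      Polynomial.degree_le_natDegree.trans_lt (by exact_mod_cast Nat.lt_succ_self _)⟩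
  obtain ⟨m, hm⟩ := hbound p
  obtain ⟨n, hn⟩ := hbound q
  induction hN : m + n using Nat.strong_induction_on generalizing m n p q with
  | _ N ih =>
    by_cases hp : p = 0
    · simpa [hp, Polynomial.cauchyIndex] using IsSemialgebraicFun.const (R := R) (σ := σ) 0
    by_cases hq : q = 0
    · simpa [hq, Polynomial.cauchyIndex, Polynomial.signJump] using
        IsSemialgebraicFun.const (R := R) (σ := σ) 0
    have hpos : ∀ {p : (MvPolynomial σ R)[X]} {m : ℕ}, p ≠ 0 → p.degree < m →
        ∃ m' : ℕ, m = m' + 1 ∧ p.degree ≤ m' := by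
      intro p m hp hm
      have : p.natDegree < m := (Polynomial.natDegree_lt_iff_degree_lt hp).2 hm
      obtain ⟨m', rfl⟩ : ∃ m', m = m' + 1 := ⟨m - 1, by omega⟩
      exact ⟨m', rfl, Order.le_of_lt_succ hm⟩
    obtain ⟨m, rfl, hm'⟩ := hpos hp hm
    obtain ⟨n, rfl, hn'⟩ := hpos hq hn
    have hlead : ∀ {p : (MvPolynomial σ R)[X]} {a : σ → R}, eval a p.leadingCoeff ≠ 0 →
        specialize a p ≠ 0 := by
      intro p a h h0
      rw [← Polynomial.leadingCoeff_map_of_leadingCoeff_ne_zero _ h] at h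
      exact h (Polynomial.leadingCoeff_eq_zero.2 h0)
    -- where neither leading coefficient vanishes, one division step makes the problem smaller
    obtain ⟨E, hE, hEa⟩ : ∃ E : (σ → R) → ℤ, IsSemialgebraicFun E ∧
        ∀ a, eval a p.leadingCoeff ≠ 0 → eval a q.leadingCoeff ≠ 0 →
          (specialize a p).cauchyIndex (specialize a q) = E a := by
      rcases le_total q.natDegree p.natDegree with hle | hle
      · obtain ⟨r, hr, hrs⟩ := exists_degree_lt_specialize_eq hp hq hle
        have h1 := ih _ (by omega) q r _ hn _ (hr.trans_le hm') rfl
        have h2 := isSemialgebraicFun_natDegree_signTop (fun d s => (s - (-1) ^ d * s) / 2) (p * q)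
        refine ⟨_, h2.map₂ h1 (· - ·), fun a ha ha' => ?_⟩
        have := Polynomial.two_mul_cauchyIndex_add (hlead ha) (hlead ha')
        rw [Polynomial.signBot, ← Polynomial.map_mul] at this
        simp only [hrs a ha']
        rw [specialize, ← this, Int.mul_ediv_cancel_left _ two_ne_zero]
        ring
      · obtain ⟨r, hr, hrs⟩ := exists_degree_lt_specialize_eq hq hp hle
        exact ⟨_, ih _ (by omega) p r _ hm _ (hr.trans_le hn') rfl, fun a ha _ => (hrs a ha).symm⟩
    refine IsSemialgebraicFun.piecewise (isSemialgebraic_eq_zero p.leadingCoeff)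
      (ih _ (by omega) p.eraseLead q _ ((Polynomial.degree_eraseLead_lt hp).trans_le hm') _ hn rfl)
      (IsSemialgebraicFun.piecewise (isSemialgebraic_eq_zero q.leadingCoeff)
        (ih _ (by omega) p q.eraseLead _ hm _ ((Polynomial.degree_eraseLead_lt hq).trans_le hn')
          rfl) hE
        (K := fun a => if eval a q.leadingCoeff = 0 then
          (specialize a p).cauchyIndex (specialize a q.eraseLead) else E a)
        (fun a ha => if_pos ha) (fun a ha => if_neg ha)) (fun a ha => ?_) fun a ha => ?_
    · rw [specialize_eraseLead (show eval a p.leadingCoeff = 0 from ha)]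
    · split_ifs with h
      · rw [specialize_eraseLead h]
      · exact hEa a ha h

/-- Tarski's count of the roots of `p` that satisfy finitely many strict inequalities, weighted by
the signs of `q`. The conditions are removed one at a time, using that `(s + s ^ 2) / 2` is, for a
sign `s`, the indicator of `s = 1`. -/
theorem isSemialgebraicFun_sum_sign (p q : (MvPolynomial σ R)[X])
    (H : Finset (MvPolynomial σ R)[X]) :
    IsSemialgebraicFun fun a => ∑ x ∈ {x ∈ (specialize a p).roots.toFinset |
      ∀ h ∈ H, 0 < (specialize a h).eval x}, (SignType.sign ((specialize a q).eval x) : ℤ) := by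
  classical
  induction H using Finset.induction_on generalizing q with
  | empty =>
    have := isSemialgebraicFun_cauchyIndex p (Polynomial.derivative p * q)
    convert this using 2 with a
    by_cases hp : specialize a p = 0
    · simp [hp, Polynomial.cauchyIndex]
    · rw [show specialize a (Polynomial.derivative p * q) =
        Polynomial.derivative (specialize a p) * specialize a q by
          rw [specialize, Polynomial.map_mul, ← Polynomial.derivative_map],
        Polynomial.cauchyIndex_derivative_mul hp]
      simp
  | insert h H _ ih =>
    convert (ih (q * h)).map₂ (ih (q * h ^ 2)) (fun x y => (x + y) / 2) using 2 with a
    rw [← Finset.sum_add_distrib]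
    refine (Int.ediv_eq_of_eq_mul_right two_ne_zero ?_).symm
    rw [Finset.mul_sum, Finset.sum_filter, Finset.sum_filter]
    refine Finset.sum_congr rfl fun x _ => ?_
    by_cases hH : ∀ h ∈ H, 0 < (specialize a h).eval x
    · rw [if_pos hH]
      simp only [Finset.forall_mem_insert, Polynomial.map_mul, Polynomial.eval_mul,
        sign_mul, pow_two]
      rcases lt_trichotomy ((specialize a h).eval x) 0 with hx | hx | hx
      · rw [if_neg (fun h' => absurd h'.1 hx.not_gt), sign_neg hx]
        simp
      · rw [if_neg (fun h' => absurd h'.1 hx.le.not_gt), hx]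
        simp
      · rw [if_pos ⟨hx, hH⟩, sign_pos hx]
        simp [two_mul]
    · rw [if_neg hH, if_neg]
      exact fun h' => hH fun i hi => h' i (Finset.mem_insert_of_mem hi)

/-- The roots of `p` that satisfy the inequalities are counted by Tarski's sum with weight `1`. -/
theorem isSemialgebraic_exists_root (p : (MvPolynomial σ R)[X])
    (H : Finset (MvPolynomial σ R)[X]) :
    IsSemialgebraic {a | specialize a p ≠ 0 ∧ ∃ x, (specialize a p).eval x = 0 ∧
      ∀ h ∈ H, 0 < (specialize a h).eval x} := by
  classical
  convert (isSemialgebraicFun_sum_sign p 1 H).isSemialgebraic (· ≠ 0) using 3 with a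
  simp only [Polynomial.map_one, Polynomial.eval_one, sign_one, SignType.coe_one,
    Finset.sum_const, nsmul_eq_mul, mul_one, ne_eq, Nat.cast_eq_zero, Finset.card_eq_zero,
    Finset.filter_eq_empty_iff, Multiset.mem_toFinset]
  push Not
  constructor
  · rintro ⟨hp, x, hx, hH⟩
    exact ⟨x, (Polynomial.mem_roots hp).2 hx, hH⟩
  · rintro ⟨x, hx, hH⟩
    exact ⟨Polynomial.ne_zero_of_mem_roots hx, x, Polynomial.isRoot_of_mem_roots hx, hH⟩

/-- If finitely many polynomials are positive at a common point, they are so near `+∞`, or near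
`-∞`, or, by Rolle's theorem, at a zero of the derivative of their product. -/
theorem exists_forall_eval_pos_iff {ι : Type*} (s : Finset ι) (h : ι → R[X]) :
    (∃ x, ∀ i ∈ s, 0 < (h i).eval x) ↔ (∀ i ∈ s, (h i).signTop = 1) ∨
      (∀ i ∈ s, (h i).signBot = 1) ∨
      (Polynomial.derivative (∏ i ∈ s, h i) ≠ 0 ∧
        ∃ x, (Polynomial.derivative (∏ i ∈ s, h i)).eval x = 0 ∧ ∀ i ∈ s, 0 < (h i).eval x) := by
  classical
  have hev : ∀ x, (∏ i ∈ s, h i).eval x = 0 ↔ ∃ i ∈ s, (h i).eval x = 0 := by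
    intro x
    rw [Polynomial.eval_prod, Finset.prod_eq_zero_iff]
  constructor
  · rintro ⟨x, hx⟩
    have hQx : (∏ i ∈ s, h i).eval x ≠ 0 := by
      rw [Ne, hev]
      rintro ⟨i, hi, h0⟩
      exact (hx i hi).ne' h0
    have hQ : ∏ i ∈ s, h i ≠ 0 := fun h0 => hQx (by rw [h0, Polynomial.eval_zero])
    set Q := ∏ i ∈ s, h i with hQdef
    have hmem : ∀ z, z ∈ Q.roots.toFinset ↔ Q.eval z = 0 := by
      intro z
      rw [Multiset.mem_toFinset, Polynomial.mem_roots hQ, Polynomial.IsRoot]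
    by_cases hr : ∃ z, x ≤ z ∧ Q.eval z = 0
    swap
    · refine Or.inl fun i hi => Polynomial.signTop_eq_one.2 ?_
      refine (pos_iff_pos_of_mul_pos (IsRealClosed.eval_mul_leadingCoeff_pos
        fun z hz h0 => hr ⟨z, hz, ?_⟩)).1 (hx i hi)
      exact (hev z).2 ⟨i, hi, h0⟩
    by_cases hl : ∃ z, z ≤ x ∧ Q.eval z = 0
    swap
    · refine Or.inr (Or.inl fun i hi => ?_)
      rw [Polynomial.signBot_eq_signTop_comp_neg, Polynomial.signTop_eq_one]
      refine (pos_iff_pos_of_mul_pos (IsRealClosed.eval_mul_leadingCoeff_pos (c := -x)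
        fun z hz h0 => hl ⟨-z, by linarith, ?_⟩)).1 (by simpa using hx i hi)
      exact (hev _).2 ⟨i, hi, by simpa using h0⟩
    right; right
    have hrne : (Q.roots.toFinset.filter (x ≤ ·)).Nonempty := by
      obtain ⟨z, hz, h0⟩ := hr
      exact ⟨z, Finset.mem_filter.2 ⟨(hmem z).2 h0, hz⟩⟩
    have hlne : (Q.roots.toFinset.filter (· ≤ x)).Nonempty := by
      obtain ⟨z, hz, h0⟩ := hl
      exact ⟨z, Finset.mem_filter.2 ⟨(hmem z).2 h0, hz⟩⟩
    obtain ⟨hb0, hxb⟩ := Finset.mem_filter.1 (Finset.min'_mem _ hrne)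
    obtain ⟨ha0, hax⟩ := Finset.mem_filter.1 (Finset.max'_mem _ hlne)
    -- the two roots of the product next to `x`
    set b := Finset.min' _ hrne
    set a := Finset.max' _ hlne
    rw [hmem] at ha0 hb0
    have hxb' : x < b := lt_of_le_of_ne hxb fun h0 => hQx (h0 ▸ hb0)
    have hax' : a < x := lt_of_le_of_ne hax fun h0 => hQx (h0 ▸ ha0)
    have hno : ∀ z, a < z → z < b → Q.eval z ≠ 0 := by
      intro z hz hz' h0
      rcases le_total x z with h1 | h1
      · exact absurd (Finset.min'_le _ z (Finset.mem_filter.2 ⟨(hmem z).2 h0, h1⟩)) hz'.not_ge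
      · exact absurd (Finset.le_max' _ z (Finset.mem_filter.2 ⟨(hmem z).2 h0, h1⟩)) hz.not_ge
    obtain ⟨c, hac, hcb, hc⟩ := IsRealClosed.exists_eval_derivative_eq_zero hQ (hax'.trans hxb')
      ha0 hb0 hno
    refine ⟨fun h0 => ?_, c, hc, fun i hi => ?_⟩
    · rw [Polynomial.eq_C_of_derivative_eq_zero h0] at hQx ha0
      simp only [Polynomial.eval_C] at hQx ha0
      exact hQx ha0
    · have hi0 : ∀ z, a < z → z < b → (h i).eval z ≠ 0 := fun z h1 h2 h0 =>
        hno z h1 h2 ((hev z).2 ⟨i, hi, h0⟩)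
      rcases le_total x c with h1 | h1
      · exact (pos_iff_pos_of_mul_pos (IsRealClosed.eval_mul_eval_pos h1 fun z hz hz' =>
          hi0 z (hax'.trans_le hz) (hz'.trans_lt hcb))).1 (hx i hi)
      · exact (pos_iff_pos_of_mul_pos (IsRealClosed.eval_mul_eval_pos h1 fun z hz hz' =>
          hi0 z (hac.trans_le hz) (hz'.trans_lt hxb'))).2 (hx i hi)
  · have key : ∀ h : ι → R[X], (∀ i ∈ s, (h i).signTop = 1) → ∃ x, ∀ i ∈ s, 0 < (h i).eval x := by
      intro h hs
      have hne : ∀ i ∈ s, h i ≠ 0 := fun i hi h0 => by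
        have := hs i hi
        rw [Polynomial.signTop_eq_zero.2 h0] at this
        simp at this
      obtain ⟨x, hx⟩ := (s.biUnion fun i => (h i).roots.toFinset).exists_le
      refine ⟨x + 1, fun i hi => ?_⟩
      refine (pos_iff_pos_of_mul_pos (IsRealClosed.eval_mul_leadingCoeff_pos
        fun z hz h0 => ?_)).2 (Polynomial.signTop_eq_one.1 (hs i hi))
      have := hx z (Finset.mem_biUnion.2 ⟨i, hi, by
        rw [Multiset.mem_toFinset, Polynomial.mem_roots (hne i hi)]; exact h0⟩)
      linarith
    rintro (hs | hs | ⟨-, x, -, hx⟩)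
    · exact key h hs
    · obtain ⟨x, hx⟩ := key (fun i => (h i).comp (-Polynomial.X)) fun i hi => by
        rw [← Polynomial.signBot_eq_signTop_comp_neg]; exact hs i hi
      exact ⟨-x, fun i hi => by simpa using hx i hi⟩
    · exact ⟨x, hx⟩

theorem isSemialgebraic_exists_forall_pos (H : Finset (MvPolynomial σ R)[X]) :
    IsSemialgebraic {a | ∃ x, ∀ h ∈ H, 0 < (specialize a h).eval x} := by
  classical
  have h1 : IsSemialgebraic (⋂ h ∈ (H : Set (MvPolynomial σ R)[X]),
      {a | (specialize a h).signTop = 1}) := isSemialgebraic_biInter H.finite_toSet fun h _ =>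
    (isSemialgebraicFun_natDegree_signTop (fun _ s => s) h).fiber 1
  have h2 : IsSemialgebraic (⋂ h ∈ (H : Set (MvPolynomial σ R)[X]),
      {a | (specialize a h).signBot = 1}) := isSemialgebraic_biInter H.finite_toSet fun h _ =>
    (isSemialgebraicFun_natDegree_signTop (fun d s => (-1) ^ d * s) h).fiber 1
  have h3 := isSemialgebraic_exists_root (Polynomial.derivative (∏ h ∈ H, h)) H
  convert h1.union (h2.union h3) using 1
  ext a
  have := exists_forall_eval_pos_iff H (fun h => specialize a h)
  simp only [Set.mem_ofPred_eq, Set.mem_union, Set.mem_iInter, Finset.mem_coe]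
  rw [this, specialize, ← Polynomial.derivative_map, Polynomial.map_prod]

/-- A polynomial in the fibre coordinate and the base coordinates, as a polynomial in the fibre
coordinate over the ring of polynomials in the base coordinates. -/
noncomputable def fiberPoly (k : Type*) [Field k] (σ : Type*) :
    MvPolynomial (Fin 1 ⊕ σ) k →ₐ[k] (MvPolynomial σ k)[X] :=
  aeval (Sum.elim (fun _ => Polynomial.X) fun i => Polynomial.C (X i))

theorem eval_specialize_fiberPoly {R σ : Type*} [Field R] (a : σ → R) (x : R)
    (f : MvPolynomial (Fin 1 ⊕ σ) R) :
    (specialize a (fiberPoly R σ f)).eval x = eval (Sum.elim (fun _ => x) a) f := by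
  induction f using MvPolynomial.induction_on with
  | C c =>
    simp [fiberPoly, specialize, MvPolynomial.algebraMap_eq,
      IsScalarTower.algebraMap_apply R (MvPolynomial σ R) (MvPolynomial σ R)[X]]
  | add p q hp hq =>
    simp only [map_add, specialize, Polynomial.map_add, Polynomial.eval_add] at *
    rw [hp, hq]
  | mul_X p i hp =>
    simp only [map_mul, specialize, Polynomial.map_mul, Polynomial.eval_mul] at *
    rw [hp]
    rcases i with i | i <;> simp [fiberPoly]

/-- The Tarski–Seidenberg theorem for the projection along one coordinate. -/
theorem IsSemialgebraic.exists_fiber {S : Set (Fin 1 ⊕ σ → R)} (hS : IsSemialgebraic S) :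
    IsSemialgebraic {a : σ → R | ∃ x : R, Sum.elim (fun _ => x) a ∈ S} := by
  classical
  obtain ⟨A, hA, hA', rfl⟩ := hS
  have : {a : σ → R | ∃ x : R, Sum.elim (fun _ => x) a ∈ ⋃₀ A} =
      ⋃ B ∈ A, {a : σ → R | ∃ x : R, Sum.elim (fun _ => x) a ∈ B} := by
    ext a
    simp only [Set.mem_sUnion, Set.mem_ofPred_eq, Set.mem_iUnion, exists_prop]
    exact ⟨fun ⟨x, B, hB, hx⟩ => ⟨B, hB, x, hx⟩, fun ⟨B, hB, x, hx⟩ => ⟨x, B, hB, hx⟩⟩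
  rw [this]
  refine isSemialgebraic_biUnion hA fun B hB => ?_
  obtain ⟨F, H, rfl⟩ := hA' B hB
  -- the equations are gathered into one by adding their squares
  set p := fiberPoly R σ (∑ f ∈ F, f ^ 2) with hp
  have hpx : ∀ (a : σ → R) (x : R), (specialize a p).eval x = 0 ↔
      ∀ f ∈ F, eval (Sum.elim (fun _ => x) a) f = 0 := by
    intro a x
    rw [hp, eval_specialize_fiberPoly, map_sum,
      Finset.sum_eq_zero_iff_of_nonneg fun f _ => by rw [map_pow]; positivity]
    simp
  convert ((isSemialgebraic_specialize_eq_zero p).inter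
    (isSemialgebraic_exists_forall_pos (H.image (fiberPoly R σ)))).union
    (isSemialgebraic_exists_root p (H.image (fiberPoly R σ))) using 1
  ext a
  simp only [Set.mem_ofPred_eq, Set.mem_union, Set.mem_inter_iff, Finset.forall_mem_image, hpx,
    eval_specialize_fiberPoly]
  constructor
  · rintro ⟨x, h1, h2⟩
    by_cases h0 : specialize a p = 0
    · exact Or.inl ⟨h0, x, h2⟩
    · exact Or.inr ⟨h0, x, h1, h2⟩
  · rintro (⟨h0, x, h2⟩ | ⟨-, x, h1, h2⟩)
    · exact ⟨x, (hpx a x).1 (by rw [h0, Polynomial.eval_zero]), h2⟩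
    · exact ⟨x, h1, h2⟩

end Projection

/-! ### Gröbner bases for block orders -/

section BlockOrder

variable {k : Type*} [Field k] {τ : Type*} {n : ℕ}

theorem sumAlgEquiv_monomial (e : τ →₀ ℕ) (d : Fin n →₀ ℕ) (c : k) :
    sumAlgEquiv k τ (Fin n) (monomial (Finsupp.sumElim e d) c) = monomial e (monomial d c) := by
  have h : Finsupp.sumFinsuppAddEquivProdFinsupp (Finsupp.sumElim e d) = (e, d) :=
    Finsupp.sumFinsuppAddEquivProdFinsupp.apply_symm_apply (e, d)
  change AddMonoidAlgebra.curryAlgEquiv k (AddMonoidAlgebra.domCongr k k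
    Finsupp.sumFinsuppAddEquivProdFinsupp (AddMonoidAlgebra.single (Finsupp.sumElim e d) c)) = _
  rw [AddMonoidAlgebra.domCongr_single, h, AddMonoidAlgebra.curryAlgEquiv_single]
  rfl

theorem coeff_coeff_sumAlgEquiv (f : MvPolynomial (τ ⊕ Fin n) k) (e : τ →₀ ℕ) (d : Fin n →₀ ℕ) :
    coeff d (coeff e (sumAlgEquiv k τ (Fin n) f)) = coeff (Finsupp.sumElim e d) f := by
  classical
  induction f using MvPolynomial.induction_on' with
  | monomial a c =>
    obtain ⟨e', d', rfl⟩ : ∃ (e' : τ →₀ ℕ) (d' : Fin n →₀ ℕ), a = Finsupp.sumElim e' d' :=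
      ⟨_, _, (Finsupp.comapDomain_sumElim_comapDomain a).symm⟩
    rw [sumAlgEquiv_monomial, coeff_monomial, coeff_monomial]
    by_cases h1 : e' = e
    · subst h1
      rw [if_pos rfl, coeff_monomial]
      refine if_congr ⟨fun h => by rw [h], fun h => ?_⟩ rfl rfl
      ext i
      simpa using DFunLike.congr_fun h (Sum.inr i)
    · rw [if_neg h1, coeff_zero, if_neg]
      intro h
      refine h1 ?_
      ext i
      simpa using DFunLike.congr_fun h (Sum.inl i)
  | add p q hp hq => rw [map_add, coeff_add, coeff_add, coeff_add, hp, hq]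

theorem sumElim_mem_support_iff (f : MvPolynomial (τ ⊕ Fin n) k) (e : τ →₀ ℕ) (d : Fin n →₀ ℕ) :
    Finsupp.sumElim e d ∈ f.support ↔ d ∈ (coeff e (sumAlgEquiv k τ (Fin n) f)).support := by
  rw [mem_support_iff, mem_support_iff, coeff_coeff_sumAlgEquiv]

theorem blockOrder_toSyn (m₁ : MonomialOrder τ) (m₂ : MonomialOrder (Fin n)) (e : τ →₀ ℕ)
    (d : Fin n →₀ ℕ) : (blockOrder m₁ m₂).toSyn (Finsupp.sumElim e d) =
      (toLex (m₁.toSyn e, m₂.toSyn d) : m₁.syn ×ₗ m₂.syn) := by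
  have h : Finsupp.sumFinsuppAddEquivProdFinsupp (Finsupp.sumElim e d) = (e, d) :=
    Finsupp.sumFinsuppAddEquivProdFinsupp.apply_symm_apply (e, d)
  change (toLex (m₁.toSyn (Finsupp.sumFinsuppAddEquivProdFinsupp (Finsupp.sumElim e d)).1,
    m₂.toSyn (Finsupp.sumFinsuppAddEquivProdFinsupp (Finsupp.sumElim e d)).2) :
      m₁.syn ×ₗ m₂.syn) = _
  rw [h]

theorem exists_eq_sumElim (c : τ ⊕ Fin n →₀ ℕ) :
    ∃ (e : τ →₀ ℕ) (d : Fin n →₀ ℕ), c = Finsupp.sumElim e d :=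
  ⟨_, _, (Finsupp.comapDomain_sumElim_comapDomain c).symm⟩

theorem sumElim_le_sumElim_iff {e e' : τ →₀ ℕ} {d d' : Fin n →₀ ℕ} :
    Finsupp.sumElim e d ≤ Finsupp.sumElim e' d' ↔ e ≤ e' ∧ d ≤ d' := by
  constructor
  · exact fun h => ⟨fun i => h (Sum.inl i), fun i => h (Sum.inr i)⟩
  · rintro ⟨h1, h2⟩ (i | i)
    exacts [h1 i, h2 i]

/-- The leading monomial for the block order `m₁ > m₂` consists of the leading monomial for `m₁`
over `k[y]` and of the leading monomial for `m₂` of its coefficient. -/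
theorem degree_blockOrder (m₁ : MonomialOrder τ) (m₂ : MonomialOrder (Fin n))
    {f : MvPolynomial (τ ⊕ Fin n) k} (hf : f ≠ 0) : (blockOrder m₁ m₂).degree f =
      Finsupp.sumElim (m₁.degree (sumAlgEquiv k τ (Fin n) f))
        (m₂.degree (relLeadingCoeff m₁ f)) := by
  have hΦ : sumAlgEquiv k τ (Fin n) f ≠ 0 := by simpa using hf
  have hl : relLeadingCoeff m₁ f ≠ 0 := by
    rw [relLeadingCoeff, m₁.leadingCoeff_ne_zero_iff]; exact hΦ
  apply (blockOrder m₁ m₂).toSyn.injective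
  refine le_antisymm ?_ ?_
  · rw [MonomialOrder.degree_le_iff]
    intro c hc
    obtain ⟨e, d, rfl⟩ := exists_eq_sumElim c
    rw [blockOrder_toSyn, blockOrder_toSyn]
    refine (Prod.Lex.toLex_le_toLex (α := m₁.syn) (β := m₂.syn)).2 ?_
    rw [sumElim_mem_support_iff] at hc
    have he : e ∈ (sumAlgEquiv k τ (Fin n) f).support := by
      rw [mem_support_iff]; rintro h0; simp [h0] at hc
    rcases (m₁.le_degree he).eq_or_lt with h | h
    · refine Or.inr ⟨h, m₂.le_degree ?_⟩
      rw [m₁.toSyn.injective h] at hc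
      exact hc
    · exact Or.inl h
  · exact (blockOrder m₁ m₂).le_degree
      ((sumElim_mem_support_iff _ _ _).2 (m₂.degree_mem_support hl))

theorem sumAlgEquiv_baseIncl (f : MvPolynomial (Fin n) k) :
    sumAlgEquiv k τ (Fin n) (baseIncl k τ n f) = C f := by
  have := DFunLike.congr_fun (sumAlgEquiv_comp_rename_inr (R := k) (S₁ := τ) (S₂ := Fin n)) f
  simpa [baseIncl] using this

theorem relLeadingCoeff_baseIncl (m : MonomialOrder τ) (f : MvPolynomial (Fin n) k) :
    relLeadingCoeff m (baseIncl k τ n f) = f := by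
  rw [relLeadingCoeff, sumAlgEquiv_baseIncl, m.leadingCoeff_C]

end BlockOrder

section SpecializedGroebner

variable {k : Type*} [Field k] {τ : Type*} [Finite τ] {n : ℕ} (m₁ : MonomialOrder τ)
  (m₂ : MonomialOrder (Fin n)) (Q : Ideal (MvPolynomial (τ ⊕ Fin n) k))
  (P : Ideal (MvPolynomial (Fin n) k))

theorem isReducedGroebnerBasis_reducedGroebnerBasis {σ : Type*} [Finite σ] (m : MonomialOrder σ)
    (I : Ideal (MvPolynomial σ k)) : IsReducedGroebnerBasis m I (reducedGroebnerBasis m I) :=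
  (exists_isReducedGroebnerBasis m I).choose_spec

theorem IsReducedGroebnerBasis.exists_degree_le {σ : Type*} {m : MonomialOrder σ}
    {I : Ideal (MvPolynomial σ k)} {G : Finset (MvPolynomial σ k)}
    (h : IsReducedGroebnerBasis m I G) {f : MvPolynomial σ k} (hf : f ∈ I) (hf0 : f ≠ 0) :
    ∃ g ∈ G, m.degree g ≤ m.degree f := by
  have h1 : m.leadingTerm f ∈ Ideal.span (m.leadingTerm '' (G : Set (MvPolynomial σ k))) := by
    rw [← h.span_leadingTerm_eq]
    exact Ideal.subset_span ⟨f, hf, rfl⟩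
  rw [MonomialOrder.span_leadingTerm_eq_span_monomial (fun g hg => by
    rw [h.monic g hg]; exact isUnit_one), ← Set.image_image (fun s => monomial s (1 : k)),
    mem_ideal_span_monomial_image] at h1
  obtain ⟨_, ⟨g, hg, rfl⟩, hle⟩ := h1 (m.degree f) (by
    rw [m.support_leadingTerm' hf0]; simp)
  exact ⟨g, hg, hle⟩

theorem IsReducedGroebnerBasis.ne_zero {σ : Type*} {m : MonomialOrder σ}
    {I : Ideal (MvPolynomial σ k)} {G : Finset (MvPolynomial σ k)}
    (h : IsReducedGroebnerBasis m I G) {g : MvPolynomial σ k} (hg : g ∈ G) : g ≠ 0 := by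
  rintro rfl
  simpa using h.monic 0 hg

theorem IsReducedGroebnerBasis.mem {σ : Type*} {m : MonomialOrder σ}
    {I : Ideal (MvPolynomial σ k)} {G : Finset (MvPolynomial σ k)}
    (h : IsReducedGroebnerBasis m I G) {g : MvPolynomial σ k} (hg : g ∈ G) : g ∈ I := by
  rw [← h.span_eq]; exact Ideal.subset_span hg

/-- The monomials in the variables `τ` that are standard for `Q` over `k[y]`: no leading monomial of
a member outside `P ⊆ k[y]` of the reduced Gröbner basis divides them. -/
def standardMonomials : Set (τ →₀ ℕ) :=
  {e | ∀ g ∈ reducedGroebnerBasis (blockOrder m₁ m₂) Q, (∀ f ∈ P, baseIncl k τ n f ≠ g) →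
    ¬ m₁.degree (sumAlgEquiv k τ (Fin n) g) ≤ e}

/-- The ideal `Q` of `k[τ, y]`, seen in the ring of polynomials in `τ` over `k[y]`. -/
noncomputable def overBase : Ideal (MvPolynomial τ (MvPolynomial (Fin n) k)) :=
  Q.comap (sumAlgEquiv k τ (Fin n)).symm

variable {m₁ m₂ Q P}

omit [Finite τ] in
theorem sumAlgEquiv_mem_overBase {f : MvPolynomial (τ ⊕ Fin n) k} :
    sumAlgEquiv k τ (Fin n) f ∈ overBase Q ↔ f ∈ Q := by
  rw [overBase, Ideal.mem_comap, AlgEquiv.symm_apply_apply]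

/-- A combination of standard monomials that lies in `Q` has its coefficients in `P`: its leading
monomial for the block order can be reduced only by a member of the Gröbner basis that lies in
`P`. -/
theorem coeff_mem_of_mem_overBase {r : MvPolynomial τ (MvPolynomial (Fin n) k)}
    (hr : r ∈ overBase Q)
    (hs : ∀ e ∈ r.support, e ∈ standardMonomials m₁ m₂ Q P) (e : τ →₀ ℕ) : coeff e r ∈ P := by
  classical
  set m := blockOrder m₁ m₂ with hm
  obtain ⟨f, rfl⟩ := (sumAlgEquiv k τ (Fin n)).surjective r
  induction hd : m.toSyn (m.degree f) using WellFoundedLT.induction generalizing f with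
  | _ d ih =>
    have hG := isReducedGroebnerBasis_reducedGroebnerBasis m Q
    by_cases hf0 : f = 0
    · simp [hf0]
    have hfQ : f ∈ Q := sumAlgEquiv_mem_overBase.1 hr
    obtain ⟨g, hg, hle⟩ := hG.exists_degree_le hfQ hf0
    have hmem := m₁.degree_mem_support
      (show sumAlgEquiv k τ (Fin n) f ≠ 0 by simpa using hf0)
    have hgP : ∃ p ∈ P, baseIncl k τ n p = g := by
      by_contra! hcon
      rw [hm, degree_blockOrder m₁ m₂ hf0, degree_blockOrder m₁ m₂ (hG.ne_zero hg),
        sumElim_le_sumElim_iff] at hle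
      exact hs _ hmem g hg hcon hle.1
    obtain ⟨p, hp, rfl⟩ := hgP
    by_cases hdeg : m.degree f = 0
    · have hg0 : m.degree (baseIncl k τ n p) = 0 := le_antisymm (hdeg ▸ hle) zero_le
      have h1 : baseIncl k τ n p = 1 := by
        rw [m.eq_C_of_degree_eq_zero hg0, hG.monic _ hg, C_1]
      have : p = 1 := by
        rw [← relLeadingCoeff_baseIncl m₁ p, h1, relLeadingCoeff, map_one, m₁.leadingCoeff_one]
      rw [(Ideal.eq_top_iff_one P).2 (this ▸ hp)]
      trivial
    have hunit : IsUnit (m.leadingCoeff (baseIncl k τ n p)) := by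
      rw [hG.monic _ hg]; exact isUnit_one
    have hlt := m.degree_reduce_lt hunit hle hdeg
    set c := (hunit.unit⁻¹ : kˣ) * m.leadingCoeff f with hc
    obtain ⟨e', d', hed⟩ := exists_eq_sumElim (m.degree f - m.degree (baseIncl k τ n p))
    have hterm : sumAlgEquiv k τ (Fin n)
        (monomial (m.degree f - m.degree (baseIncl k τ n p)) c * baseIncl k τ n p) =
        monomial e' (monomial d' c * p) := by
      rw [map_mul, sumAlgEquiv_baseIncl, hed]
      rw [sumAlgEquiv_monomial, mul_comm (monomial e' _), C_mul_monomial, mul_comm p]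
    have he' : e' = m₁.degree (sumAlgEquiv k τ (Fin n) f) := by
      rw [hm, degree_blockOrder m₁ m₂ hf0, degree_blockOrder m₁ m₂ (hG.ne_zero hg),
        sumAlgEquiv_baseIncl, m₁.degree_C] at hed
      ext i
      simpa using (DFunLike.congr_fun hed (Sum.inl i)).symm
    have hred : sumAlgEquiv k τ (Fin n) f = sumAlgEquiv k τ (Fin n) (m.reduce hunit f) +
        monomial e' (monomial d' c * p) := by
      rw [← hterm, ← map_add, MonomialOrder.reduce, sub_add_cancel]
    have hredQ : m.reduce hunit f ∈ Q :=
      Q.sub_mem hfQ (Q.mul_mem_left _ (hG.mem hg))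
    rw [hred, coeff_add, coeff_monomial]
    refine P.add_mem (ih _ (hd ▸ hlt) _ (sumAlgEquiv_mem_overBase.2 hredQ) ?_ rfl) ?_
    · intro a ha
      rw [eq_sub_of_add_eq hred.symm] at ha
      rcases Finset.mem_union.1 (support_sub _ _ _ ha) with h | h
      · exact hs a h
      · rw [Finset.mem_singleton.1 (support_monomial_subset h), he']
        exact hs _ hmem
    · split_ifs
      · exact P.mul_mem_left _ hp
      · exact P.zero_mem

/-- Every polynomial is, up to a power of the product of the leading coefficients, congruent
modulo `Q` to a combination of standard monomials. -/
theorem exists_standard_remainder (q : MvPolynomial τ (MvPolynomial (Fin n) k)) :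
    ∃ (N : ℕ) (r : MvPolynomial τ (MvPolynomial (Fin n) k)),
      (∀ e ∈ r.support, e ∈ standardMonomials m₁ m₂ Q P) ∧
      C (leadingCoeffProduct m₁ m₂ Q P ^ N) * q - r ∈ overBase Q := by
  classical
  set v := leadingCoeffProduct m₁ m₂ Q P with hv
  -- the polynomials that have such a remainder form a submodule, which contains all monomials
  let Red : Submodule (MvPolynomial (Fin n) k) (MvPolynomial τ (MvPolynomial (Fin n) k)) :=
    { carrier := {q | ∃ (N : ℕ) (r : MvPolynomial τ (MvPolynomial (Fin n) k)),
        (∀ e ∈ r.support, e ∈ standardMonomials m₁ m₂ Q P) ∧ C (v ^ N) * q - r ∈ overBase Q}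
      zero_mem' := ⟨0, 0, by simp, by simp⟩
      add_mem' := by
        rintro q q' ⟨N, r, hr, h⟩ ⟨N', r', hr', h'⟩
        refine ⟨N + N', C (v ^ N') * r + C (v ^ N) * r', fun e he => ?_, ?_⟩
        · rcases Finset.mem_union.1 (support_add he) with h1 | h1
          · rw [mem_support_iff, coeff_C_mul] at h1
            exact hr e (mem_support_iff.2 (right_ne_zero_of_mul h1))
          · rw [mem_support_iff, coeff_C_mul] at h1
            exact hr' e (mem_support_iff.2 (right_ne_zero_of_mul h1))
        · have := add_mem (Ideal.mul_mem_left _ (C (v ^ N')) h)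
            (Ideal.mul_mem_left _ (C (v ^ N)) h')
          convert this using 1
          rw [pow_add, C_mul]
          ring
      smul_mem' := by
        rintro c q ⟨N, r, hr, h⟩
        refine ⟨N, C c * r, fun e he => ?_, ?_⟩
        · rw [mem_support_iff, coeff_C_mul] at he
          exact hr e (mem_support_iff.2 (right_ne_zero_of_mul he))
        · convert Ideal.mul_mem_left _ (C c) h using 1
          rw [smul_eq_C_mul]
          ring }
  suffices H : ∀ e : τ →₀ ℕ, monomial e (1 : MvPolynomial (Fin n) k) ∈ Red by
    have : q ∈ Red := by
      rw [← support_sum_monomial_coeff q]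
      refine Red.sum_mem fun e _ => ?_
      have := Red.smul_mem (coeff e q) (H e)
      rwa [smul_monomial, smul_eq_mul, mul_one] at this
    exact this
  intro e
  induction he : m₁.toSyn e using WellFoundedLT.induction generalizing e with
  | _ s ih =>
    by_cases hstd : e ∈ standardMonomials m₁ m₂ Q P
    · refine ⟨0, monomial e 1, fun a ha => ?_, by simp⟩
      rw [Finset.mem_singleton.1 (support_monomial_subset ha)]
      exact hstd
    simp only [standardMonomials, Set.mem_ofPred_eq, not_forall, not_not] at hstd
    obtain ⟨g, hg, hgP, hle⟩ := hstd
    obtain ⟨u, hu⟩ : relLeadingCoeff m₁ g ∣ v :=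
      Finset.dvd_prod_of_mem _ (Finset.mem_filter.2 ⟨hg, hgP⟩)
    set G := sumAlgEquiv k τ (Fin n) g with hGdef
    have hGQ : G ∈ overBase Q := sumAlgEquiv_mem_overBase.2
      ((isReducedGroebnerBasis_reducedGroebnerBasis _ Q).mem hg)
    -- the terms of `g` below the leading one give smaller monomials
    have htail : monomial (e - m₁.degree G) 1 * m₁.subLTerm G ∈ Red := by
      rw [← support_sum_monomial_coeff (monomial (e - m₁.degree G) 1 * m₁.subLTerm G)]
      refine Red.sum_mem fun a ha => ?_
      have hlt : m₁.toSyn a < m₁.toSyn e := by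
        obtain ⟨b, hb, c, hc, rfl⟩ := Finset.mem_add.1 (support_mul _ _ ha)
        rw [Finset.mem_singleton.1 (support_monomial_subset hb)]
        have hc' : m₁.toSyn c < m₁.toSyn (m₁.degree G) := by
          have hcG : c ∈ G.support ∧ c ≠ m₁.degree G := by
            rw [mem_support_iff, MonomialOrder.subLTerm, coeff_sub, coeff_monomial] at hc
            split_ifs at hc with h
            · subst h
              exact absurd (sub_self _) hc
            · exact ⟨mem_support_iff.2 (by simpa using hc), Ne.symm h⟩
          exact lt_of_le_of_ne (m₁.le_degree hcG.1) fun h => hcG.2 (m₁.toSyn.injective h)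
        calc m₁.toSyn (e - m₁.degree G + c) < m₁.toSyn (e - m₁.degree G + m₁.degree G) := by
              rw [map_add, map_add]; exact add_lt_add_right hc' _
          _ = m₁.toSyn e := by rw [tsub_add_cancel_of_le hle]
      have := Red.smul_mem (coeff a (monomial (e - m₁.degree G) 1 * m₁.subLTerm G))
        (ih _ (he ▸ hlt) a rfl)
      rwa [smul_monomial, smul_eq_mul, mul_one] at this
    obtain ⟨N, r, hr, h⟩ := Red.smul_mem (-u) htail
    refine ⟨N + 1, r, hr, ?_⟩
    have hlead : (monomial e 1 : MvPolynomial τ (MvPolynomial (Fin n) k)) * C (relLeadingCoeff m₁ g)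
        = monomial (e - m₁.degree G) 1 * monomial (m₁.degree G) (m₁.leadingCoeff G) := by
      rw [monomial_mul, tsub_add_cancel_of_le hle, one_mul, mul_comm, C_mul_monomial, mul_one]
      rfl
    have h2 := (overBase Q).add_mem h ((overBase Q).mul_mem_left
      (C (v ^ N * u) * monomial (e - m₁.degree G) 1) hGQ)
    convert h2 using 1
    have e1 : m₁.subLTerm G = G - monomial (m₁.degree G) (m₁.leadingCoeff G) := rfl
    have e2 : (C v : MvPolynomial τ (MvPolynomial (Fin n) k)) = C (relLeadingCoeff m₁ g) * C u := by
      rw [hu, C_mul]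
    rw [e1, pow_succ, smul_eq_C_mul, C_neg, C_mul, C_mul]
    linear_combination (C (v ^ N) * C u) * hlead + C (v ^ N) * monomial e 1 * e2

end SpecializedGroebner

/-! ### Specialization of the base coordinates -/

/-- The Cayley–Hamilton argument: if `y` acts on the generators `b` through the matrix `M`, then
the characteristic polynomial of `M` at `y` annihilates them. -/
theorem Matrix.aeval_charpoly_mul_eq_zero {ι A B : Type*} [Fintype ι] [DecidableEq ι] [CommRing A]
    [CommRing B] [Algebra A B] (M : Matrix ι ι A) (y : B) (b : ι → B)
    (h : ∀ j, y * b j = ∑ i, algebraMap A B (M j i) * b i) (j : ι) :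
    Polynomial.aeval y M.charpoly * b j = 0 := by
  let φ : Polynomial A →ₐ[A] B := Polynomial.aeval y
  let W : Matrix ι ι B := φ.mapMatrix M.charmatrix
  have hW : W.mulVec b = 0 := by
    ext j
    have h2 : ∀ i, W j i = (if j = i then y else 0) - algebraMap A B (M j i) := by
      intro i
      change φ (M.charmatrix j i) = _
      rw [Matrix.charmatrix_apply, map_sub, Matrix.diagonal_apply]
      split_ifs <;> simp [φ]
    rw [Matrix.mulVec, dotProduct]
    simp only [h2, sub_mul, Finset.sum_sub_distrib, ite_mul, zero_mul, Finset.sum_ite_eq,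
      Finset.mem_univ, if_true, h, sub_self, Pi.zero_apply]
  have h1 : W.adjugate.mulVec (W.mulVec b) = W.det • b := by
    rw [Matrix.mulVec_mulVec, Matrix.adjugate_mul, Matrix.smul_mulVec, Matrix.one_mulVec]
  rw [hW, Matrix.mulVec_zero] at h1
  have h2 : W.det = φ M.charpoly := (AlgHom.map_det φ M.charmatrix).symm
  rw [h2] at h1
  exact (congr_fun h1 j).symm

section Specialization

variable {k : Type*} [Field k] {R : Type*} [Field R] [Algebra k R] {τ : Type*} {n : ℕ}

/-- The specialization at `a` of the coefficients of a polynomial in `τ` over `k[y]`. -/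
noncomputable def specializeCoeff (τ : Type*) (a : Fin n → R) :
    MvPolynomial τ (MvPolynomial (Fin n) k) →+* MvPolynomial τ R :=
  map (aeval a : MvPolynomial (Fin n) k →ₐ[k] R).toRingHom

theorem coeff_specializeCoeff (a : Fin n → R) (e : τ →₀ ℕ)
    (q : MvPolynomial τ (MvPolynomial (Fin n) k)) :
    coeff e (specializeCoeff τ a q) = aeval a (coeff e q) :=
  coeff_map _ _ _

theorem specializeCoeff_C (a : Fin n → R) (p : MvPolynomial (Fin n) k) :
    specializeCoeff τ a (C p) = C (aeval a p) :=
  map_C _ _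

variable [Finite τ] {m₁ : MonomialOrder τ} {m₂ : MonomialOrder (Fin n)}
  {Q : Ideal (MvPolynomial (τ ⊕ Fin n) k)} {P : Ideal (MvPolynomial (Fin n) k)}

/-- At the points of `V(P)` where no leading coefficient vanishes, the standard monomials stay
linearly independent modulo the specialized ideal. Indeed the remainder modulo `Q` is, up to powers
of the leading coefficients, linear over `k[y]` and unique modulo `P`, so it specializes to a linear
map that vanishes on the specialized ideal and fixes the standard monomials. -/
theorem eq_zero_of_mem_map_specializeCoeff {a : Fin n → R} (hP : ∀ f ∈ P, aeval a f = 0)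
    (hv : aeval a (leadingCoeffProduct m₁ m₂ Q P) ≠ 0) {q : MvPolynomial τ R}
    (hq : q ∈ (overBase Q).map (specializeCoeff τ a))
    (hs : ∀ e ∈ q.support, e ∈ standardMonomials m₁ m₂ Q P) : q = 0 := by
  classical
  set v := leadingCoeffProduct m₁ m₂ Q P with hvdef
  set sp := specializeCoeff (k := k) τ a with hsp
  choose N r hr hqr using exists_standard_remainder (m₁ := m₁) (m₂ := m₂) (Q := Q) (P := P)
  rw [← hvdef] at hqr
  -- this is the only use of the vanishing of `P` at `a`
  have hstd0 : ∀ r ∈ overBase Q, (∀ e ∈ r.support, e ∈ standardMonomials m₁ m₂ Q P) →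
      sp r = 0 := by
    intro r hrQ hrs
    ext e
    rw [hsp, coeff_specializeCoeff, coeff_zero]
    exact hP _ (coeff_mem_of_mem_overBase hrQ hrs e)
  have hsub : ∀ {p p' : MvPolynomial τ (MvPolynomial (Fin n) k)},
      (∀ e ∈ p.support, e ∈ standardMonomials m₁ m₂ Q P) →
      (∀ e ∈ p'.support, e ∈ standardMonomials m₁ m₂ Q P) →
      ∀ e ∈ (p - p').support, e ∈ standardMonomials m₁ m₂ Q P := by
    intro p p' hp hp' e he
    rcases Finset.mem_union.1 (support_sub _ _ _ he) with h | h
    exacts [hp e h, hp' e h]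
  have hadd : ∀ {p p' : MvPolynomial τ (MvPolynomial (Fin n) k)},
      (∀ e ∈ p.support, e ∈ standardMonomials m₁ m₂ Q P) →
      (∀ e ∈ p'.support, e ∈ standardMonomials m₁ m₂ Q P) →
      ∀ e ∈ (p + p').support, e ∈ standardMonomials m₁ m₂ Q P := by
    intro p p' hp hp' e he
    rcases Finset.mem_union.1 (support_add he) with h | h
    exacts [hp e h, hp' e h]
  have hCmul : ∀ {c : MvPolynomial (Fin n) k} {p : MvPolynomial τ (MvPolynomial (Fin n) k)},
      (∀ e ∈ p.support, e ∈ standardMonomials m₁ m₂ Q P) →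
      ∀ e ∈ (C c * p).support, e ∈ standardMonomials m₁ m₂ Q P := by
    intro c p hp e he
    rw [mem_support_iff, coeff_C_mul] at he
    exact hp e (mem_support_iff.2 (right_ne_zero_of_mul he))
  have hspC : ∀ M p, sp (C (v ^ M) * p) = C ((aeval a v) ^ M) * sp p := by
    intro M p
    rw [map_mul, hsp, specializeCoeff_C, map_pow]
  -- the specialized normal form, and its independence of the choice of the remainder
  let nf : MvPolynomial τ (MvPolynomial (Fin n) k) → MvPolynomial τ R := fun q =>
    C ((aeval a v) ^ N q)⁻¹ * sp (r q)
  have hnf : ∀ q M s, (∀ e ∈ s.support, e ∈ standardMonomials m₁ m₂ Q P) →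
      C (v ^ M) * q - s ∈ overBase Q → C ((aeval a v) ^ M) * nf q = sp s := by
    intro q M s hs h
    have h1 := (overBase Q).sub_mem ((overBase Q).mul_mem_left (C (v ^ M)) (hqr q))
      ((overBase Q).mul_mem_left (C (v ^ N q)) h)
    have h2 : C (v ^ M) * (C (v ^ N q) * q - r q) - C (v ^ N q) * (C (v ^ M) * q - s) =
        C (v ^ N q) * s - C (v ^ M) * r q := by ring
    rw [h2] at h1
    have h3 := hstd0 _ h1 (hsub (hCmul hs) (hCmul (hr q)))
    rw [map_sub, hspC, hspC, sub_eq_zero] at h3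
    have h4 : C ((aeval a v) ^ N q)⁻¹ * C ((aeval a v) ^ N q) = (1 : MvPolynomial τ R) := by
      rw [← C_mul, inv_mul_cancel₀ (pow_ne_zero _ hv), C_1]
    calc C ((aeval a v) ^ M) * (C ((aeval a v) ^ N q)⁻¹ * sp (r q))
        = C ((aeval a v) ^ N q)⁻¹ * (C ((aeval a v) ^ M) * sp (r q)) := by ring
      _ = sp s := by rw [← h3, ← mul_assoc, h4, one_mul]
  have hcancel : ∀ {M : ℕ} {p p' : MvPolynomial τ R},
      C ((aeval a v) ^ M) * p = C ((aeval a v) ^ M) * p' → p = p' := fun h =>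
    mul_left_cancel₀ (C_ne_zero.2 (pow_ne_zero _ hv)) h
  have hnf_add : ∀ p q, nf (p + q) = nf p + nf q := by
    intro p q
    have h1 := hnf (p + q) (N p + N q) (C (v ^ N q) * r p + C (v ^ N p) * r q)
      (hadd (hCmul (hr p)) (hCmul (hr q))) (by
        have := (overBase Q).add_mem ((overBase Q).mul_mem_left (C (v ^ N q)) (hqr p))
          ((overBase Q).mul_mem_left (C (v ^ N p)) (hqr q))
        convert this using 1
        rw [pow_add, C_mul]
        ring)
    refine hcancel (h1.trans ?_)
    rw [map_add, hspC, hspC, pow_add, C_mul, ← hnf p (N p) (r p) (hr p) (hqr p),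
      ← hnf q (N q) (r q) (hr q) (hqr q)]
    ring
  have hnf_C : ∀ c q, nf (C c * q) = C (aeval a c) * nf q := by
    intro c q
    have h1 := hnf (C c * q) (N q) (C c * r q) (hCmul (hr q)) (by
      convert (overBase Q).mul_mem_left (C c) (hqr q) using 1
      ring)
    refine hcancel (h1.trans ?_)
    rw [map_mul, hsp, specializeCoeff_C, ← hsp, ← hnf q (N q) (r q) (hr q) (hqr q)]
    ring
  -- the normal form descends to a linear map on `R[τ]`
  let L : MvPolynomial τ R →ₗ[R] MvPolynomial τ R :=
    (basisMonomials τ R).constr R fun e => nf (monomial e 1)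
  have hLmon : ∀ e, L (monomial e 1) = nf (monomial e 1) := fun e => by
    have := (basisMonomials τ R).constr_basis R (fun e => nf (monomial e 1)) e
    rwa [coe_basisMonomials] at this
  have hL : ∀ q, L (sp q) = nf q := by
    intro q
    induction q using MvPolynomial.induction_on' with
    | monomial e c =>
      have h1 : sp (monomial e c) = (aeval a c) • monomial e (1 : R) := by
        rw [hsp, specializeCoeff, map_monomial, smul_monomial, smul_eq_mul, mul_one]
        rfl
      have h2 : (monomial e c : MvPolynomial τ (MvPolynomial (Fin n) k)) = C c * monomial e 1 := by
        rw [C_mul_monomial, mul_one]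
      rw [h1, map_smul, hLmon, h2, hnf_C, smul_eq_C_mul]
    | add p q hp hq => rw [map_add, map_add, hp, hq, hnf_add]
  have hnf0 : ∀ q ∈ overBase Q, nf q = 0 := by
    intro q hq
    have := hnf q 0 0 (by simp) (by simpa using hq)
    simpa using this
  have hker : ∀ p ∈ (overBase Q).map sp, ∀ t, L (t * p) = 0 := by
    intro p hp
    refine Submodule.span_induction ?_ ?_ ?_ ?_ hp
    · rintro _ ⟨q, hq, rfl⟩ t
      induction t using MvPolynomial.induction_on' with
      | monomial e c =>
        have h1 : monomial e c * sp q = c • sp (monomial e 1 * q) := by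
          rw [map_mul, hsp, specializeCoeff, map_monomial, map_one, smul_eq_C_mul, ← mul_assoc,
            C_mul_monomial, mul_one]
        rw [h1, map_smul, hL, hnf0 _ ((overBase Q).mul_mem_left _ hq), smul_zero]
      | add p q hp hq => rw [add_mul, map_add, hp, hq, add_zero]
    · intro t; simp
    · intro p q _ _ hp hq t
      rw [mul_add, map_add, hp, hq, add_zero]
    · intro c p _ hp t
      rw [smul_eq_mul, ← mul_assoc, hp]
  have hfix : L q = q := by
    conv_lhs => rw [← support_sum_monomial_coeff q]
    conv_rhs => rw [← support_sum_monomial_coeff q]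
    rw [map_sum]
    refine Finset.sum_congr rfl fun e he => ?_
    have h1 : monomial e (coeff e q) = coeff e q • monomial e (1 : R) := by
      rw [smul_monomial, smul_eq_mul, mul_one]
    have h2 := hnf (monomial e 1) 0 (monomial e 1) (fun b hb => by
      rw [Finset.mem_singleton.1 (support_monomial_subset hb)]; exact hs e he) (by simp)
    rw [h1, map_smul, hLmon]
    congr 1
    simpa [hsp, specializeCoeff] using h2
  rw [← hfix, ← one_mul q]
  exact hker q hq 1

/-- If there are finitely many standard monomials, then multiplication by `y` on the span of the
standard monomials gives, through its characteristic polynomial, a polynomial relation for `y`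
modulo `Q` whose leading coefficient is a power of the product of the leading coefficients. -/
theorem exists_aeval_mem_overBase (hfin : (standardMonomials m₁ m₂ Q P).Finite)
    (hv : leadingCoeffProduct m₁ m₂ Q P ≠ 0) (y : MvPolynomial τ (MvPolynomial (Fin n) k)) :
    ∃ (c : Polynomial (MvPolynomial (Fin n) k)) (M : ℕ),
      c.natDegree = (standardMonomials m₁ m₂ Q P).ncard ∧
      c.leadingCoeff = leadingCoeffProduct m₁ m₂ Q P ^ M ∧
      Polynomial.aeval y c ∈ overBase Q := by
  classical
  set v := leadingCoeffProduct m₁ m₂ Q P with hvdef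
  have := hfin.fintype
  let ι := standardMonomials m₁ m₂ Q P
  have hex : ∀ q, ∃ (N : ℕ), ∀ M, N ≤ M → ∃ r : MvPolynomial τ (MvPolynomial (Fin n) k),
      (∀ e ∈ r.support, e ∈ standardMonomials m₁ m₂ Q P) ∧ C (v ^ M) * q - r ∈ overBase Q := by
    intro q
    obtain ⟨N, r, hr, h⟩ := exists_standard_remainder (m₁ := m₁) (m₂ := m₂) (Q := Q) (P := P) q
    refine ⟨N, fun M hM => ⟨C (v ^ (M - N)) * r, fun e he => ?_, ?_⟩⟩
    · rw [mem_support_iff, coeff_C_mul] at he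
      exact hr e (mem_support_iff.2 (right_ne_zero_of_mul he))
    · convert (overBase Q).mul_mem_left (C (v ^ (M - N))) h using 1
      have e1 : v ^ M = v ^ (M - N) * v ^ N := by rw [← pow_add, Nat.sub_add_cancel hM]
      rw [e1, C_mul]
      ring
  choose N hN using hex
  -- a common exponent for all the standard monomials
  let N₁ : ℕ := ∑ j : ι, N (y * monomial (j : τ →₀ ℕ) 1)
  have hr : ∀ j : ι, ∃ r : MvPolynomial τ (MvPolynomial (Fin n) k),
      (∀ e ∈ r.support, e ∈ standardMonomials m₁ m₂ Q P) ∧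
      C (v ^ N₁) * (y * monomial (j : τ →₀ ℕ) 1) - r ∈ overBase Q := fun j =>
    hN _ _ (Finset.single_le_sum (f := fun j : ι => N (y * monomial (j : τ →₀ ℕ) 1))
      (fun _ _ => Nat.zero_le _) (Finset.mem_univ j))
  choose r hrs hrQ using hr
  obtain ⟨r₀, hr₀s, hr₀Q⟩ := hN 1 (N 1) le_rfl
  let B := MvPolynomial τ (MvPolynomial (Fin n) k) ⧸ overBase Q
  let mk : MvPolynomial τ (MvPolynomial (Fin n) k) →ₐ[MvPolynomial (Fin n) k] B :=
    Ideal.Quotient.mkₐ _ (overBase Q)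
  let b : ι → B := fun j => mk (monomial (j : τ →₀ ℕ) 1)
  have hmk : ∀ {p}, p ∈ overBase Q → mk p = 0 := fun h => Ideal.Quotient.eq_zero_iff_mem.2 h
  have hexp : ∀ r : MvPolynomial τ (MvPolynomial (Fin n) k),
      (∀ e ∈ r.support, e ∈ standardMonomials m₁ m₂ Q P) →
      mk r = ∑ i : ι, algebraMap _ B (coeff (i : τ →₀ ℕ) r) * b i := by
    intro r hr
    have h1 : r = ∑ i : ι, C (coeff (i : τ →₀ ℕ) r) * monomial (i : τ →₀ ℕ) 1 := by
      conv_lhs => rw [← support_sum_monomial_coeff r]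
      rw [Finset.sum_subset (s₂ := (Set.toFinset (standardMonomials m₁ m₂ Q P)))
        (fun e he => Set.mem_toFinset.2 (hr e he)) (fun e _ he => by
          rw [notMem_support_iff.1 he, monomial_zero])]
      rw [← Finset.sum_coe_sort]
      refine Fintype.sum_equiv (Equiv.setCongr (by ext; simp)) _ _ fun i => ?_
      rw [C_mul_monomial, mul_one]
      rfl
    conv_lhs => rw [h1]
    rw [map_sum]
    refine Finset.sum_congr rfl fun i _ => ?_
    rw [map_mul, ← algebraMap_eq, AlgHom.commutes]
  let A : Matrix ι ι (MvPolynomial (Fin n) k) := fun j i => coeff (i : τ →₀ ℕ) (r j)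
  have hdet : ∀ j, Polynomial.aeval (mk (C (v ^ N₁) * y)) A.charpoly * b j = 0 := by
    refine Matrix.aeval_charpoly_mul_eq_zero A _ b fun j => ?_
    rw [← hexp _ (hrs j), ← map_mul, mul_assoc]
    exact sub_eq_zero.1 (by rw [← map_sub]; exact hmk (hrQ j))
  have hlin : (Polynomial.C (v ^ N₁) * Polynomial.X : Polynomial (MvPolynomial (Fin n) k)).natDegree
      = 1 := Polynomial.natDegree_C_mul_X _ (pow_ne_zero _ hv)
  -- the factor `v ^ N 1` makes up for `1` being a combination of standard monomials only up to it
  refine ⟨Polynomial.C (v ^ N 1) * A.charpoly.comp (Polynomial.C (v ^ N₁) * Polynomial.X),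
    N 1 + N₁ * Fintype.card ι, ?_, ?_, ?_⟩
  · rw [Polynomial.natDegree_C_mul (pow_ne_zero _ hv), Polynomial.natDegree_comp, hlin, mul_one,
      Matrix.charpoly_natDegree_eq_dim, ← Nat.card_eq_fintype_card]
    rfl
  · rw [Polynomial.leadingCoeff_mul, Polynomial.leadingCoeff_C, Polynomial.leadingCoeff_comp
      (by rw [hlin]; exact one_ne_zero), A.charpoly_monic.leadingCoeff, one_mul,
      Matrix.charpoly_natDegree_eq_dim, Polynomial.leadingCoeff_C_mul_X, ← pow_mul, ← pow_add]
  · refine Ideal.Quotient.eq_zero_iff_mem.1 ?_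
    change mk (Polynomial.aeval y _) = 0
    have h0 : mk (C (v ^ N 1)) = ∑ i : ι, algebraMap _ B (coeff (i : τ →₀ ℕ) r₀) * b i := by
      rw [← hexp _ hr₀s]
      exact sub_eq_zero.1 (by rw [← map_sub]; exact hmk (by simpa using hr₀Q))
    have h1 : mk (Polynomial.aeval y (A.charpoly.comp (Polynomial.C (v ^ N₁) * Polynomial.X))) =
        Polynomial.aeval (mk (C (v ^ N₁) * y)) A.charpoly := by
      rw [Polynomial.aeval_comp, ← Polynomial.aeval_algHom_apply]
      simp only [map_mul, Polynomial.aeval_C, Polynomial.aeval_X, algebraMap_eq]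
    rw [map_mul, map_mul, h1, Polynomial.aeval_C, algebraMap_eq, h0, Finset.sum_mul]
    refine Finset.sum_eq_zero fun i _ => ?_
    rw [mul_assoc, mul_comm (b i), hdet, mul_zero]

end Specialization

/-! ### The common divisor of the restrictions to the fibres -/

section FiberAlgebra

variable {R : Type*} [Field R]

/-- A polynomial in `x`, seen as a polynomial in `x` and `z`. -/
noncomputable def inclX (R : Type*) [Field R] : Polynomial R →ₐ[R] MvPolynomial (Fin 2) R :=
  Polynomial.aeval (X 0)

/-- If an ideal of `R[x, z]` contains `z h - 1` and a nonzero polynomial in `x`, then `R[x]` maps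
onto the quotient: the generator `γ` of the intersection of the ideal with `R[x]` is prime to `h`,
so that the inverse of `h` is a polynomial in `x` modulo `γ`. -/
theorem exists_generator_of_inverse_mem {q : Ideal (MvPolynomial (Fin 2) R)} {h : Polynomial R}
    (hz : X 1 * inclX R h - 1 ∈ q) {p : Polynomial R} (hp0 : p ≠ 0) (hp : inclX R p ∈ q) :
    ∃ γ : Polynomial R, γ ≠ 0 ∧ (∀ f, inclX R f ∈ q ↔ γ ∣ f) ∧ IsCoprime γ h ∧
      Module.Finite R (MvPolynomial (Fin 2) R ⧸ q) ∧
      Module.finrank R (MvPolynomial (Fin 2) R ⧸ q) ≤ γ.natDegree := by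
  classical
  obtain ⟨γ, hγ⟩ := (IsPrincipalIdealRing.principal (q.comap (inclX R))).principal
  have hmem : ∀ f, inclX R f ∈ q ↔ γ ∣ f := by
    intro f
    rw [← Ideal.mem_comap, hγ]
    exact Ideal.mem_span_singleton
  have hγ0 : γ ≠ 0 := by
    rintro rfl
    exact hp0 (zero_dvd_iff.1 ((hmem p).1 hp))
  have hcop : IsCoprime γ h := by
    rw [← EuclideanDomain.gcd_isUnit_iff]
    obtain ⟨γ', hγ'⟩ := EuclideanDomain.gcd_dvd_left γ h
    obtain ⟨h', hh'⟩ := EuclideanDomain.gcd_dvd_right γ h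
    set d := EuclideanDomain.gcd γ h
    have h1 : inclX R γ' ∈ q := by
      have h2 : inclX R (γ' * h) ∈ q := by
        rw [hmem]; exact ⟨h', by rw [hh']; conv_rhs => rw [hγ']
                                 ring⟩
      have h3 := q.sub_mem (q.mul_mem_left (X 1) h2) (q.mul_mem_left (inclX R γ') hz)
      convert h3 using 1
      rw [map_mul]; ring
    obtain ⟨e, he⟩ := (hmem γ').1 h1
    have h4 : d * e = 1 := by
      refine mul_left_cancel₀ hγ0 ?_
      rw [mul_one]
      conv_rhs => rw [hγ', he]
      ring
    exact IsUnit.of_mul_eq_one _ h4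
  obtain ⟨u, w, huw⟩ := hcop
  let π : Polynomial R →ₐ[R] MvPolynomial (Fin 2) R ⧸ q := (Ideal.Quotient.mkₐ R q).comp (inclX R)
  have hπ0 : ∀ f ∈ Ideal.span {γ}, π f = 0 := fun f hf =>
    Ideal.Quotient.eq_zero_iff_mem.2 ((hmem f).2 (Ideal.mem_span_singleton.1 hf))
  have hz' : π w = Ideal.Quotient.mkₐ R q (X 1) := by
    refine (Ideal.Quotient.eq.2 ?_)
    have h1 : inclX R (u * γ) ∈ q := (hmem _).2 (Dvd.intro_left _ rfl)
    have h2 : inclX R (u * γ) + inclX R (w * h) = 1 := by rw [← map_add, huw, map_one]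
    have h3 := q.sub_mem (q.mul_mem_left (-inclX R w) hz) (q.mul_mem_left (X 1) h1)
    change inclX R w - X 1 ∈ q
    convert h3 using 1
    simp only [map_mul] at h2 ⊢
    linear_combination (X 1) * h2
  have hsurj : Function.Surjective π := by
    rw [← AlgHom.range_eq_top, eq_top_iff]
    have : (Ideal.Quotient.mkₐ R q).range = ⊤ :=
      (AlgHom.range_eq_top _).2 (Ideal.Quotient.mkₐ_surjective R q)
    rw [← this, ← Algebra.map_top, ← adjoin_range_X, AlgHom.map_adjoin]
    refine Algebra.adjoin_le ?_
    rintro _ ⟨_, ⟨i, rfl⟩, rfl⟩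
    fin_cases i
    · exact ⟨Polynomial.X, by simp [π, inclX]⟩
    · exact ⟨w, hz'⟩
  let π' : (Polynomial R ⧸ Ideal.span {γ}) →ₐ[R] MvPolynomial (Fin 2) R ⧸ q :=
    Ideal.Quotient.liftₐ _ π hπ0
  have hsurj' : Function.Surjective π' := by
    intro y
    obtain ⟨f, rfl⟩ := hsurj y
    exact ⟨Ideal.Quotient.mk _ f, rfl⟩
  have hfin : Module.Finite R (Polynomial R ⧸ Ideal.span {γ}) :=
    Module.Finite.of_basis (AdjoinRoot.powerBasis hγ0).basis
  refine ⟨γ, hγ0, hmem, ⟨u, w, huw⟩, Module.Finite.of_surjective π'.toLinearMap hsurj', ?_⟩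
  rw [← finrank_quotient_span_eq_natDegree (f := γ)]
  exact LinearMap.finrank_le_finrank_of_surjective (f := π'.toLinearMap) hsurj'

end FiberAlgebra

section FiberGcd

variable {k : Type*} [Field k] {R : Type*} [Field R] [Algebra k R] {n : ℕ}

/-- The restriction of a polynomial to the fibre over the point `a` of the base. -/
noncomputable def fiberAt (k : Type*) [Field k] {R : Type*} [Field R] [Algebra k R] {n : ℕ}
    (a : Fin n → R) : MvPolynomial (Fin 1 ⊕ Fin n) k →ₐ[k] Polynomial R :=
  aeval (Sum.elim (fun _ => Polynomial.X) fun i => Polynomial.C (a i))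

theorem eval_fiberAt (a : Fin n → R) (t : R) (f : MvPolynomial (Fin 1 ⊕ Fin n) k) :
    (fiberAt k a f).eval t = aeval (Sum.elim (fun _ => t) a) f := by
  have : ((Polynomial.aeval t : Polynomial R →ₐ[R] R).restrictScalars k).comp (fiberAt k a) =
      aeval (Sum.elim (fun _ => t) a) := by
    ext i
    rcases i with i | i <;> simp [fiberAt]
  rw [← this]
  simp

/-- The restriction of a polynomial to the fibre over `a`, with `x` one of the variables of a
larger set. -/
theorem specializeCoeff_rename {τ : Type*} (j : τ) (a : Fin n → R)
    (f : MvPolynomial (Fin 1 ⊕ Fin n) k) :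
    specializeCoeff τ a (sumAlgEquiv k τ (Fin n) (rename (Sum.map (fun _ => j) id) f)) =
      Polynomial.aeval (X j) (fiberAt k a f) := by
  induction f using MvPolynomial.induction_on with
  | C c =>
    have h1 : fiberAt k a (C c) = algebraMap R (Polynomial R) (algebraMap k R c) := by
      rw [fiberAt, aeval_C, ← IsScalarTower.algebraMap_apply]
    rw [rename_C, sumAlgEquiv_C_inl, specializeCoeff_C, h1, AlgHom.commutes, aeval_C,
      MvPolynomial.algebraMap_eq]
  | add p q hp hq => simp only [map_add, hp, hq]
  | mul_X p i hp =>
    rw [map_mul, map_mul, map_mul, map_mul, map_mul, hp, rename_X]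
    congr 1
    rcases i with i | i
    · simp [fiberAt, specializeCoeff]
    · simp [fiberAt, specializeCoeff]

/-- Rabinowitsch's argument: a polynomial in `x` that lies in the ideal generated by `I` and
`z h - 1` is carried into `I` by a power of `h`. -/
theorem exists_mul_pow_mem_of_inclX_mem (I : Ideal (Polynomial R)) (h : Polynomial R)
    {p : Polynomial R} (hp : inclX R p ∈ I.map (inclX R) ⊔ Ideal.span {X 1 * inclX R h - 1}) :
    ∃ N, p * h ^ N ∈ I := by
  let h' : Polynomial R ⧸ I := Ideal.Quotient.mk I h
  let L := Localization.Away h'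
  let ι : Polynomial R →ₐ[R] L := (IsScalarTower.toAlgHom R (Polynomial R ⧸ I) L).comp
    (Ideal.Quotient.mkₐ R I)
  let ψ : MvPolynomial (Fin 2) R →ₐ[R] L :=
    aeval ![ι Polynomial.X, IsLocalization.Away.invSelf h']
  have hψ : ∀ f, ψ (inclX R f) = ι f := by
    intro f
    have : ψ.comp (inclX R) = ι := by
      apply Polynomial.algHom_ext
      simp [ψ, inclX]
    exact DFunLike.congr_fun this f
  have hker : I.map (inclX R) ⊔ Ideal.span {X 1 * inclX R h - 1} ≤ RingHom.ker ψ := by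
    refine sup_le (Ideal.map_le_iff_le_comap.2 fun f hf => ?_) (Ideal.span_le.2 ?_)
    · rw [Ideal.mem_comap, RingHom.mem_ker, hψ]
      have : Ideal.Quotient.mkₐ R I f = 0 := Ideal.Quotient.eq_zero_iff_mem.2 hf
      simp only [ι, AlgHom.comp_apply, this, map_zero]
    · rintro _ rfl
      rw [SetLike.mem_coe, RingHom.mem_ker, map_sub, map_mul, hψ, map_one, sub_eq_zero, mul_comm]
      have : ψ (X 1) = IsLocalization.Away.invSelf h' := by simp [ψ]
      rw [this]
      exact IsLocalization.Away.mul_invSelf h'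
  have h0 : algebraMap (Polynomial R ⧸ I) L (Ideal.Quotient.mk I p) = 0 := by
    have := hker hp
    rw [RingHom.mem_ker, hψ] at this
    exact this
  obtain ⟨⟨_, N, rfl⟩, hN⟩ := (IsLocalization.map_eq_zero_iff (Submonoid.powers h') L _).1 h0
  refine ⟨N, Ideal.Quotient.eq_zero_iff_mem.1 ?_⟩
  rw [map_mul, map_pow, mul_comm]
  exact hN

/-- Over a set of points at which the leading coefficients of the reduced Gröbner basis of
`I k[y, x, z] + ⟨z h - 1⟩` do not vanish, the part prime to `h` of the greatest common divisor of
the restrictions of `I` to the fibres is the restriction of one polynomial `c`. Over every fibre `c`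
is a multiple of that divisor `γ`, and its degree, the number of standard monomials, is at most the
dimension of `R[x, z]` modulo the specialized ideal, which is at most the degree of `γ`. -/
theorem exists_fiber_gcd (Ty : MonomialOrder (Fin n)) (Txz : MonomialOrder (Fin 2))
    (I : Ideal (MvPolynomial (Fin 1 ⊕ Fin n) k)) (h : MvPolynomial (Fin 1 ⊕ Fin n) k)
    (P : Ideal (MvPolynomial (Fin n) k)) {S : Set (Fin n → R)} (hne : S.Nonempty)
    (hP : ∀ a ∈ S, ∀ f ∈ P, aeval a f = 0)
    (hv : ∀ a ∈ S, aeval a (leadingCoeffProduct Txz Ty (rabinowitschIdeal I h) P) ≠ 0)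
    (hI : ∀ a ∈ S, ∃ f ∈ I, fiberAt k a f ≠ 0) :
    ∃ c : Polynomial (MvPolynomial (Fin n) k), ∀ a ∈ S,
      aeval a c.leadingCoeff ≠ 0 ∧
      (∀ f ∈ I, c.map (aeval a : MvPolynomial (Fin n) k →ₐ[k] R).toRingHom ∣ fiberAt k a f) ∧
      (∃ N, c.map (aeval a : MvPolynomial (Fin n) k →ₐ[k] R).toRingHom * fiberAt k a h ^ N ∈
        I.map (fiberAt k a)) ∧
      IsCoprime (c.map (aeval a : MvPolynomial (Fin n) k →ₐ[k] R).toRingHom) (fiberAt k a h) := by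
  classical
  set Q := rabinowitschIdeal I h with hQ
  set v := leadingCoeffProduct Txz Ty Q P with hvdef
  let q : (Fin n → R) → Ideal (MvPolynomial (Fin 2) R) := fun a =>
    (overBase Q).map (specializeCoeff (Fin 2) a)
  have hmemq : ∀ a, ∀ f ∈ I, inclX R (fiberAt k a f) ∈ q a := by
    intro a f hf
    rw [inclX, ← specializeCoeff_rename]
    exact Ideal.mem_map_of_mem _ (sumAlgEquiv_mem_overBase.2
      (Ideal.mem_sup_left (Ideal.mem_map_of_mem _ hf)))
  have hspz : ∀ a : Fin n → R, specializeCoeff (Fin 2) a (sumAlgEquiv k (Fin 2) (Fin n)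
      (X (Sum.inl 1) * rename (Sum.map (fun _ => (0 : Fin 2)) id) h - 1)) =
        X 1 * inclX R (fiberAt k a h) - 1 := by
    intro a
    rw [map_sub, map_mul, map_sub, map_mul, specializeCoeff_rename, sumAlgEquiv_X_inl, map_one,
      map_one]
    simp [specializeCoeff, inclX]
  have hz : ∀ a, X 1 * inclX R (fiberAt k a h) - 1 ∈ q a := by
    intro a
    rw [← hspz]
    exact Ideal.mem_map_of_mem _ (sumAlgEquiv_mem_overBase.2
      (Ideal.mem_sup_right (Ideal.subset_span rfl)))
  have hqle : ∀ a, q a ≤ (I.map (fiberAt k a)).map (inclX R) ⊔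
      Ideal.span {X 1 * inclX R (fiberAt k a h) - 1} := by
    intro a
    refine Ideal.map_le_iff_le_comap.2 fun f hf => ?_
    obtain ⟨f, rfl⟩ := (sumAlgEquiv k (Fin 2) (Fin n)).surjective f
    rw [sumAlgEquiv_mem_overBase] at hf
    have hle : Q ≤ Ideal.comap ((specializeCoeff (Fin 2) a).comp
        ((sumAlgEquiv k (Fin 2) (Fin n)).toAlgHom.toRingHom)) ((I.map (fiberAt k a)).map (inclX R) ⊔
        Ideal.span {X 1 * inclX R (fiberAt k a h) - 1}) := by
      refine sup_le (Ideal.map_le_iff_le_comap.2 fun g hg => ?_) (Ideal.span_le.2 ?_)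
      · refine Ideal.mem_sup_left ?_
        change specializeCoeff (Fin 2) a (sumAlgEquiv k (Fin 2) (Fin n) (rename _ g)) ∈ _
        rw [specializeCoeff_rename]
        exact Ideal.mem_map_of_mem _ (Ideal.mem_map_of_mem _ hg)
      · rintro _ rfl
        refine Ideal.mem_sup_right (Ideal.subset_span ?_)
        exact hspz a
    exact hle hf
  -- linear independence of the standard monomials in the fibre algebras
  have hli : ∀ a ∈ S, LinearIndependent R (fun e : standardMonomials Txz Ty Q P =>
      Ideal.Quotient.mkₐ R (q a) (monomial (e : Fin 2 →₀ ℕ) 1)) := by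
    intro a ha
    rw [linearIndependent_iff]
    intro l hl
    set p : MvPolynomial (Fin 2) R := l.sum fun e c => monomial (e : Fin 2 →₀ ℕ) c with hp
    have hpq : p ∈ q a := by
      refine Ideal.Quotient.eq_zero_iff_mem.1 ?_
      rw [← hl, Finsupp.linearCombination_apply]
      change Ideal.Quotient.mkₐ R (q a) p = _
      rw [hp, map_finsuppSum]
      refine Finsupp.sum_congr fun e _ => ?_
      rw [← map_smul, smul_monomial, smul_eq_mul, mul_one]
    have hcoeff : ∀ e : standardMonomials Txz Ty Q P, coeff (e : Fin 2 →₀ ℕ) p = l e := by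
      intro e
      rw [hp, Finsupp.sum, coeff_sum]
      simp only [coeff_monomial, Subtype.coe_inj]
      rw [Finset.sum_ite_eq']
      split_ifs with h
      · rfl
      · exact (Finsupp.notMem_support_iff.1 h).symm
    have hp0 := eq_zero_of_mem_map_specializeCoeff (hP a ha) (hv a ha) hpq (fun e he => by
      obtain ⟨e', _, he'⟩ := Finset.mem_biUnion.1 (support_sum he)
      rw [Finset.mem_singleton.1 (support_monomial_subset he')]
      exact e'.2)
    ext e
    rw [← hcoeff, hp0, coeff_zero, Finsupp.zero_apply]
  have hγ : ∀ a ∈ S, ∃ γ : Polynomial R, γ ≠ 0 ∧ (∀ f, inclX R f ∈ q a ↔ γ ∣ f) ∧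
      IsCoprime γ (fiberAt k a h) ∧ Module.Finite R (MvPolynomial (Fin 2) R ⧸ q a) ∧
      Module.finrank R (MvPolynomial (Fin 2) R ⧸ q a) ≤ γ.natDegree := fun a ha => by
    obtain ⟨f, hf, hf0⟩ := hI a ha
    exact exists_generator_of_inverse_mem (hz a) hf0 (hmemq a f hf)
  obtain ⟨a₀, ha₀⟩ := hne
  have hfin : (standardMonomials Txz Ty Q P).Finite := by
    obtain ⟨γ, -, -, -, hmf, -⟩ := hγ a₀ ha₀
    exact Set.finite_coe_iff.1 (hli a₀ ha₀).finite_of_isNoetherian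
  have hv0 : v ≠ 0 := by
    intro h0
    refine hv a₀ ha₀ ?_
    rw [h0, map_zero]
  obtain ⟨c, M, hcd, hcl, hcQ⟩ := exists_aeval_mem_overBase hfin hv0
    (X 0 : MvPolynomial (Fin 2) (MvPolynomial (Fin n) k))
  refine ⟨c, fun a ha => ?_⟩
  set ca := c.map (aeval a : MvPolynomial (Fin n) k →ₐ[k] R).toRingHom with hca
  have hlead : aeval a c.leadingCoeff ≠ 0 := by
    rw [hcl, map_pow]; exact pow_ne_zero _ (hv a ha)
  have hcaq : inclX R ca ∈ q a := by
    have h1 := Ideal.mem_map_of_mem (specializeCoeff (Fin 2) a) hcQ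
    convert h1 using 1
    rw [hca, inclX, Polynomial.aeval_def, Polynomial.eval₂_map, Polynomial.aeval_def,
      Polynomial.hom_eval₂]
    congr 1
    · ext <;> simp [specializeCoeff]
    · simp [specializeCoeff]
  obtain ⟨γ, hγ0, hmem, hcop, hmf, hrank⟩ := hγ a ha
  have hdeg : ca.natDegree = c.natDegree :=
    Polynomial.natDegree_map_of_leadingCoeff_ne_zero _ hlead
  have hca0 : ca ≠ 0 := by
    intro h0
    have := Polynomial.leadingCoeff_map_of_leadingCoeff_ne_zero
      (aeval a : MvPolynomial (Fin n) k →ₐ[k] R).toRingHom hlead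
    rw [← hca, h0, Polynomial.leadingCoeff_zero] at this
    exact hlead this.symm
  have hdvd : γ ∣ ca := (hmem ca).1 hcaq
  have hassoc : ca ∣ γ := by
    have := hfin.fintype
    have h1 := (hli a ha).fintype_card_le_finrank
    rw [← Nat.card_eq_fintype_card] at h1
    have h2 : ca.natDegree ≤ γ.natDegree := by
      rw [hdeg, hcd]; exact h1.trans hrank
    exact (Polynomial.associated_of_dvd_of_natDegree_le hdvd hca0 h2).symm.dvd
  refine ⟨hlead, fun f hf => hassoc.trans ((hmem _).1 (hmemq a f hf)), ?_,
    hcop.of_isCoprime_of_dvd_left hassoc⟩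
  exact exists_mul_pow_mem_of_inclX_mem _ _ (hqle a hcaq)

end FiberGcd

/-! ### Termination and output of the algorithms -/

section OptionTraversal

variable {α β : Type*}

theorem List.mapM_option_eq_some_iff {f : α → Option β} {l : List α} {bs : List β} :
    l.mapM f = some bs ↔ List.Forall₂ (fun a b => f a = some b) l bs := by
  induction l generalizing bs with
  | nil => simp [eq_comm]
  | cons a l ih =>
    simp only [List.mapM_cons, Option.bind_eq_bind, Option.pure_def, Option.bind_eq_some_iff,
      Option.some.injEq, List.forall₂_cons_left_iff, ih]
    constructor
    · rintro ⟨b, hb, cs, hcs, rfl⟩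
      exact ⟨b, cs, hb, hcs, rfl⟩
    · rintro ⟨b, cs, hb, hcs, rfl⟩
      exact ⟨b, hb, cs, hcs, rfl⟩

theorem List.mapM_option_mono {f g : α → Option β} {l : List α}
    {bs : List β} (h : ∀ a ∈ l, ∀ b, f a = some b → g a = some b) (hf : l.mapM f = some bs) :
    l.mapM g = some bs := by
  induction l generalizing bs with
  | nil => exact hf
  | cons a l ih =>
    rw [List.mapM_option_eq_some_iff, List.forall₂_cons_left_iff] at hf ⊢
    obtain ⟨b, cs, hb, hcs, rfl⟩ := hf
    exact ⟨b, cs, h a (by simp) b hb, List.mapM_option_eq_some_iff.1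
      (ih (fun a ha => h a (by simp [ha])) (List.mapM_option_eq_some_iff.2 hcs)), rfl⟩

/-- If `f N a` has a value for large `N`, for each member of a list, then one `N` does for all. -/
theorem List.exists_mapM_option_eq_some {f : ℕ → α → Option β} {l : List α}
    (hmono : ∀ N M, N ≤ M → ∀ a b, f N a = some b → f M a = some b)
    (h : ∀ a ∈ l, ∃ N b, f N a = some b) : ∃ N bs, l.mapM (f N) = some bs := by
  induction l with
  | nil => exact ⟨0, [], rfl⟩
  | cons a l ih =>
    obtain ⟨N, b, hb⟩ := h a (by simp)
    obtain ⟨M, bs, hbs⟩ := ih fun a ha => h a (by simp [ha])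
    refine ⟨max N M, b :: bs, List.mapM_option_eq_some_iff.2 (List.Forall₂.cons
      (hmono N _ (le_max_left _ _) _ _ hb) (List.mapM_option_eq_some_iff.1 ?_))⟩
    exact List.mapM_option_mono (fun a _ b => hmono M _ (le_max_right _ _) a b) hbs

theorem List.exists_of_mem_flatten_of_mapM {f : α → Option (List β)} {l : List α}
    {bs : List (List β)} (hf : l.mapM f = some bs) {b : β} (hb : b ∈ bs.flatten) :
    ∃ a ∈ l, ∃ c, f a = some c ∧ b ∈ c := by
  obtain ⟨c, hc, hbc⟩ := List.mem_flatten.1 hb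
  rw [List.mapM_option_eq_some_iff] at hf
  obtain ⟨i, hi, rfl⟩ := List.getElem_of_mem hc
  have hl := hf.length_eq
  exact ⟨l[i], List.getElem_mem _, _, hf.get (i := i) (by omega) hi, hbc⟩

end OptionTraversal

section Termination

variable {k : Type*} [Field k] {n : ℕ}

theorem mem_primeDecomposition {J P : Ideal (MvPolynomial (Fin n) k)} :
    P ∈ primeDecomposition J ↔ P ∈ J.minimalPrimes := by
  simp [primeDecomposition]

/-- No relative leading coefficient of a member `g` outside `J` of the reduced Gröbner basis lies
in `J`: otherwise it would be a member of `Q` whose leading monomial divides that of `g`, so that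
`g` itself would be a polynomial in `y` and equal to its leading coefficient. -/
theorem leadingCoeffProduct_notMem {τ : Type*} [Finite τ] (m₁ : MonomialOrder τ)
    (m₂ : MonomialOrder (Fin n)) {Q : Ideal (MvPolynomial (τ ⊕ Fin n) k)}
    {J : Ideal (MvPolynomial (Fin n) k)} [hJ : J.IsPrime] (hJQ : J ≤ Q.comap (baseIncl k τ n)) :
    leadingCoeffProduct m₁ m₂ Q J ∉ J := by
  classical
  rw [leadingCoeffProduct, Ideal.IsPrime.prod_mem_iff]
  rintro ⟨g, hg, hgJ⟩
  obtain ⟨hg, hgout⟩ := Finset.mem_filter.1 hg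
  have hG := isReducedGroebnerBasis_reducedGroebnerBasis (blockOrder m₁ m₂) Q
  have hg0 := hG.ne_zero hg
  have hl0 : relLeadingCoeff m₁ g ≠ 0 := by
    rw [relLeadingCoeff, m₁.leadingCoeff_ne_zero_iff]
    simpa using hg0
  have hb0 : baseIncl k τ n (relLeadingCoeff m₁ g) ≠ 0 := by
    intro h
    apply hl0
    rw [← relLeadingCoeff_baseIncl m₁ (relLeadingCoeff m₁ g), h, ← map_zero (baseIncl k τ n),
      relLeadingCoeff_baseIncl]
  have hdb : (blockOrder m₁ m₂).degree (baseIncl k τ n (relLeadingCoeff m₁ g)) =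
      Finsupp.sumElim 0 (m₂.degree (relLeadingCoeff m₁ g)) := by
    rw [degree_blockOrder _ _ hb0, relLeadingCoeff_baseIncl, sumAlgEquiv_baseIncl, m₁.degree_C]
  obtain ⟨g', hg', hle⟩ := hG.exists_degree_le (hJQ hgJ) hb0
  have hdg := degree_blockOrder m₁ m₂ hg0
  have hgg : g' = g := by
    by_contra hne
    refine hG.reduced g hg g' hg' hne _ ((blockOrder m₁ m₂).degree_mem_support hg0) (hle.trans ?_)
    rw [hdb, hdg, sumElim_le_sumElim_iff]
    exact ⟨zero_le, le_rfl⟩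
  rw [hgg, hdb, hdg, sumElim_le_sumElim_iff] at hle
  have hdeg0 : m₁.degree (sumAlgEquiv k τ (Fin n) g) = 0 := le_antisymm hle.1 zero_le
  refine hgout _ hgJ ((sumAlgEquiv k τ (Fin n)).injective ?_)
  rw [sumAlgEquiv_baseIncl]
  exact (m₁.eq_C_of_degree_eq_zero hdeg0).symm

theorem proj2SubRun_mono (Ty : MonomialOrder (Fin n)) (Txz : MonomialOrder (Fin 2)) {N M : ℕ}
    (hNM : N ≤ M) {I₀ : Ideal (MvPolynomial (Fin 1 ⊕ Fin n) k)}
    {J₀ : Ideal (MvPolynomial (Fin n) k)} {h' : MvPolynomial (Fin 1 ⊕ Fin n) k}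
    {w : MvPolynomial (Fin n) k} {L : List (BasicConstructible k (Fin n))}
    (h : proj2SubRun Ty Txz N I₀ J₀ h' w = some L) : proj2SubRun Ty Txz M I₀ J₀ h' w = some L := by
  induction N generalizing M I₀ J₀ w L with
  | zero => simp [proj2SubRun] at h
  | succ N ih =>
    obtain ⟨M, rfl⟩ : ∃ M', M = M' + 1 := ⟨M - 1, by omega⟩
    have hmono : ∀ (D : List (Ideal (MvPolynomial (Fin n) k))) bs,
        D.mapM (fun P => proj2SubRun Ty Txz N (I₀ ⊔ P.map (baseIncl k (Fin 1) n)) P h' w) =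
          some bs →
        D.mapM (fun P => proj2SubRun Ty Txz M (I₀ ⊔ P.map (baseIncl k (Fin 1) n)) P h' w) =
          some bs := fun D bs =>
      List.mapM_option_mono fun P _ b hb => ih (by omega) hb
    rw [proj2SubRun] at h ⊢
    split_ifs at h ⊢ with h1 h2
    · exact h
    · simp only [Option.bind_eq_bind, Option.pure_def, Option.bind_eq_some_iff] at h ⊢
      obtain ⟨bs, hbs, hL⟩ := h
      exact ⟨bs, hmono _ _ hbs, hL⟩
    · simp only [Option.bind_eq_bind, Option.pure_def, Option.bind_eq_some_iff] at h ⊢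
      obtain ⟨bs, hbs, hL⟩ := h
      exact ⟨bs, hmono _ _ hbs, hL⟩

theorem proj2Run_mono (Ty : MonomialOrder (Fin n)) (Txz : MonomialOrder (Fin 2)) {N M : ℕ}
    (hNM : N ≤ M) {I I' : Ideal (MvPolynomial (Fin 1 ⊕ Fin n) k)}
    {J : Ideal (MvPolynomial (Fin n) k)} {h h' : MvPolynomial (Fin 1 ⊕ Fin n) k}
    {L : List (BasicConstructible k (Fin n))}
    (hr : proj2Run Ty Txz N I I' J h h' = some L) : proj2Run Ty Txz M I I' J h h' = some L := by
  induction N generalizing M I J h L with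
  | zero => simp [proj2Run] at hr
  | succ N ih =>
    obtain ⟨M, rfl⟩ : ∃ M', M = M' + 1 := ⟨M - 1, by omega⟩
    have hmono : ∀ (D : List (Ideal (MvPolynomial (Fin n) k))) bs,
        D.mapM (fun P => proj2Run Ty Txz N (I ⊔ P.map (baseIncl k (Fin 1) n)) I' P h h') =
          some bs →
        D.mapM (fun P => proj2Run Ty Txz M (I ⊔ P.map (baseIncl k (Fin 1) n)) I' P h h') =
          some bs := fun D bs =>
      List.mapM_option_mono fun P _ b hb => ih (by omega) hb
    rw [proj2Run] at hr ⊢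
    split_ifs at hr ⊢ with h1 h2 h3
    · exact hr
    · simp only [Option.bind_eq_bind, Option.pure_def, Option.bind_eq_some_iff] at hr ⊢
      obtain ⟨bs, hbs, hL⟩ := hr
      exact ⟨bs, hmono _ _ hbs, hL⟩
    · exact ih (by omega) hr
    · simp only [Option.bind_eq_bind, Option.pure_def, Option.bind_eq_some_iff] at hr ⊢
      obtain ⟨cs, hcs, bs, hbs, hL⟩ := hr
      exact ⟨cs, proj2SubRun_mono Ty Txz (by omega) hcs, bs, hmono _ _ hbs, hL⟩

theorem lt_of_mem_minimalPrimes {J K P : Ideal (MvPolynomial (Fin n) k)} (hJK : J < K)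
    (hP : P ∈ K.minimalPrimes) : J < P :=
  hJK.trans_le hP.1.2

/-- `Proj2Sub` halts, since the prime ideal `J₀` grows strictly in the recursive calls. -/
theorem exists_proj2SubRun_eq_some (Ty : MonomialOrder (Fin n)) (Txz : MonomialOrder (Fin 2))
    (h' : MvPolynomial (Fin 1 ⊕ Fin n) k) (w : MvPolynomial (Fin n) k)
    (J₀ : Ideal (MvPolynomial (Fin n) k)) (hJ₀ : J₀.IsPrime)
    (I₀ : Ideal (MvPolynomial (Fin 1 ⊕ Fin n) k)) (hJI : J₀ ≤ I₀.comap (baseIncl k (Fin 1) n)) :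
    ∃ N L, proj2SubRun Ty Txz N I₀ J₀ h' w = some L := by
  induction J₀ using WellFoundedGT.induction generalizing I₀ with
  | _ J ih =>
    have hrec : ∀ K, J < K → ∃ N bs, (primeDecomposition K).mapM
        (fun P => proj2SubRun Ty Txz N (I₀ ⊔ P.map (baseIncl k (Fin 1) n)) P h' w) = some bs := by
      intro K hK
      refine List.exists_mapM_option_eq_some
        (fun N M hNM P L hL => proj2SubRun_mono Ty Txz hNM hL) fun P hP => ?_
      rw [mem_primeDecomposition] at hP
      exact ih P (lt_of_mem_minimalPrimes hK hP) hP.1.1 _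
        (Ideal.le_comap_of_map_le le_sup_right)
    by_cases h1 : 1 ∈ I₀
    · exact ⟨1, [], by rw [proj2SubRun, if_pos h1]⟩
    by_cases h2 : I₀.comap (baseIncl k (Fin 1) n) = J
    · have hv : leadingCoeffProduct Txz Ty (rabinowitschIdeal I₀ h') J ∉ J := by
        refine leadingCoeffProduct_notMem Txz Ty fun f hf => ?_
        have := Ideal.mem_map_of_mem (rename (Sum.map (fun _ => (0 : Fin 2)) id)) (hJI hf)
        rw [baseIncl, rename_rename] at this
        exact Ideal.mem_sup_left this
      obtain ⟨N, bs, hbs⟩ := hrec _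
        (left_lt_sup.2 fun h => hv (h (Ideal.mem_span_singleton_self _)))
      refine ⟨N + 1,
        ⟨J, w * leadingCoeffProduct Txz Ty (rabinowitschIdeal I₀ h') J⟩ :: bs.flatten, ?_⟩
      rw [proj2SubRun, if_neg h1, if_neg (not_not.2 h2)]
      simp only [hbs]
      rfl
    · obtain ⟨N, bs, hbs⟩ := hrec _ (lt_of_le_of_ne hJI (Ne.symm h2))
      refine ⟨N + 1, bs.flatten, ?_⟩
      rw [proj2SubRun, if_neg h1, if_pos h2]
      simp only [hbs]
      rfl

/-- `Proj2` halts, since the prime ideal `J` grows strictly in the recursive calls, except where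
`h` is adjoined to `I`; a second such step adjoins `1`. -/
theorem exists_proj2Run_eq_some (Ty : MonomialOrder (Fin n)) (Txz : MonomialOrder (Fin 2))
    (I' : Ideal (MvPolynomial (Fin 1 ⊕ Fin n) k)) (h h' : MvPolynomial (Fin 1 ⊕ Fin n) k)
    (J : Ideal (MvPolynomial (Fin n) k)) (hJ : J.IsPrime)
    (I : Ideal (MvPolynomial (Fin 1 ⊕ Fin n) k)) (hJI : J ≤ I.comap (baseIncl k (Fin 1) n)) :
    ∃ N L, proj2Run Ty Txz N I I' J h h' = some L := by
  induction J using WellFoundedGT.induction generalizing I h with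
  | _ J ih =>
    have hrec : ∀ K I h, J < K → ∃ N bs, (primeDecomposition K).mapM
        (fun P => proj2Run Ty Txz N (I ⊔ P.map (baseIncl k (Fin 1) n)) I' P h h') = some bs := by
      intro K I h hK
      refine List.exists_mapM_option_eq_some
        (fun N M hNM P L hL => proj2Run_mono Ty Txz hNM hL) fun P hP => ?_
      rw [mem_primeDecomposition] at hP
      exact ih P (lt_of_mem_minimalPrimes hK hP) _ hP.1.1 _
        (Ideal.le_comap_of_map_le le_sup_right)
    have hstep : ∀ I h, J ≤ I.comap (baseIncl k (Fin 1) n) → (1 ∉ I →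
        I = J.map (baseIncl k (Fin 1) n) →
          ∃ N L, proj2Run Ty Txz N (I ⊔ Ideal.span {h}) I' J 1 h' = some L) →
        ∃ N L, proj2Run Ty Txz N I I' J h h' = some L := by
      intro I h hJI hex
      by_cases h1 : 1 ∈ I
      · exact ⟨1, [], by rw [proj2Run, if_pos h1]⟩
      by_cases h2 : I.comap (baseIncl k (Fin 1) n) = J
      · by_cases h3 : I = J.map (baseIncl k (Fin 1) n)
        · obtain ⟨N, L, hL⟩ := hex h1 h3
          exact ⟨N + 1, L, by rw [proj2Run, if_neg h1, if_neg (not_not.2 h2), if_pos h3, hL]⟩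
        · have hw := leadingCoeffProduct_notMem MonomialOrder.lex Ty hJI
          obtain ⟨N₁, bs, hbs⟩ := hrec _ I h
            (left_lt_sup.2 fun h => hw (h (Ideal.mem_span_singleton_self _)))
          obtain ⟨N₂, cs, hcs⟩ := exists_proj2SubRun_eq_some Ty Txz h'
            (leadingCoeffProduct MonomialOrder.lex Ty I J) ⊥ Ideal.isPrime_bot (I ⊔ I') bot_le
          refine ⟨max N₁ N₂ + 1, cs ++ bs.flatten, ?_⟩
          rw [proj2Run, if_neg h1, if_neg (not_not.2 h2), if_neg h3]
          simp only [proj2SubRun_mono Ty Txz (le_max_right N₁ N₂) hcs,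
            List.mapM_option_mono (fun P _ L hL =>
              proj2Run_mono Ty Txz (le_max_left N₁ N₂) hL) hbs]
          rfl
      · obtain ⟨N, bs, hbs⟩ := hrec _ I h (lt_of_le_of_ne hJI (Ne.symm h2))
        refine ⟨N + 1, bs.flatten, ?_⟩
        rw [proj2Run, if_neg h1, if_pos h2]
        simp only [hbs]
        rfl
    refine hstep I h hJI fun _ _ => hstep _ 1 (hJI.trans (Ideal.comap_mono le_sup_left))
      fun _ _ => ⟨1, [], ?_⟩
    rw [proj2Run, if_pos (Ideal.mem_sup_right (Ideal.mem_span_singleton_self _))]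

end Termination

section Output

variable {k : Type*} [Field k] {n : ℕ}

/-- A member of the output of `Proj2Sub` is found at an ideal `I₂` that is the sum of `I₀` and of an
ideal of `k[y]` contained in `P`. -/
theorem exists_of_mem_proj2SubRun {Ty : MonomialOrder (Fin n)} {Txz : MonomialOrder (Fin 2)}
    {N : ℕ} {I₀ : Ideal (MvPolynomial (Fin 1 ⊕ Fin n) k)} {J₀ : Ideal (MvPolynomial (Fin n) k)}
    {h' : MvPolynomial (Fin 1 ⊕ Fin n) k} {w : MvPolynomial (Fin n) k}
    {L : List (BasicConstructible k (Fin n))} (hL : proj2SubRun Ty Txz N I₀ J₀ h' w = some L)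
    {B : BasicConstructible k (Fin n)} (hB : B ∈ L) :
    ∃ I₂ P, I₀ ≤ I₂ ∧ I₂ ≤ I₀ ⊔ P.map (baseIncl k (Fin 1) n) ∧
      I₂.comap (baseIncl k (Fin 1) n) = P ∧
      B = ⟨P, w * leadingCoeffProduct Txz Ty (rabinowitschIdeal I₂ h') P⟩ := by
  induction N generalizing I₀ J₀ L with
  | zero => simp [proj2SubRun] at hL
  | succ N ih =>
    have hrec : ∀ (D : List (Ideal (MvPolynomial (Fin n) k))) bs,
        D.mapM (fun P => proj2SubRun Ty Txz N (I₀ ⊔ P.map (baseIncl k (Fin 1) n)) P h' w) =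
          some bs → B ∈ bs.flatten →
        ∃ I₂ P, I₀ ≤ I₂ ∧ I₂ ≤ I₀ ⊔ P.map (baseIncl k (Fin 1) n) ∧
          I₂.comap (baseIncl k (Fin 1) n) = P ∧
          B = ⟨P, w * leadingCoeffProduct Txz Ty (rabinowitschIdeal I₂ h') P⟩ := by
      intro D bs hbs hB
      obtain ⟨P', -, c, hc, hBc⟩ := List.exists_of_mem_flatten_of_mapM hbs hB
      obtain ⟨I₂, P, h1, h2, h3, h4⟩ := ih hc hBc
      have hPP : P' ≤ P := by
        rw [← h3]
        exact Ideal.le_comap_of_map_le (le_sup_right.trans h1)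
      exact ⟨I₂, P, le_sup_left.trans h1, h2.trans (sup_le (sup_le le_sup_left
        (le_sup_of_le_right (Ideal.map_mono hPP))) le_sup_right), h3, h4⟩
    rw [proj2SubRun] at hL
    split_ifs at hL with h1 h2
    · simp only [Option.some.injEq] at hL
      rw [← hL] at hB
      simp at hB
    · simp only [Option.bind_eq_bind, Option.pure_def, Option.bind_eq_some_iff,
        Option.some.injEq] at hL
      obtain ⟨bs, hbs, rfl⟩ := hL
      exact hrec _ _ hbs hB
    · simp only [Option.bind_eq_bind, Option.pure_def, Option.bind_eq_some_iff,
        Option.some.injEq] at hL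
      obtain ⟨bs, hbs, rfl⟩ := hL
      rcases List.mem_cons.1 hB with rfl | hB
      · exact ⟨I₀, J₀, le_rfl, le_sup_left, not_not.1 h2, rfl⟩
      · exact hrec _ _ hbs hB

/-- The members of the output of `Proj2`, and the ideals `I₁` and `J₁` at which they are found:
either `I₁` is the sum of `I` and of an ideal of `k[y]`, or `I` has become trivial over `J₁` and
`I₁` is the sum of `⟨h⟩` and of an ideal of `k[y]`. -/
theorem exists_of_mem_proj2Run {Ty : MonomialOrder (Fin n)} {Txz : MonomialOrder (Fin 2)}
    {N : ℕ} {I I' : Ideal (MvPolynomial (Fin 1 ⊕ Fin n) k)} {J : Ideal (MvPolynomial (Fin n) k)}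
    {h h' : MvPolynomial (Fin 1 ⊕ Fin n) k}
    {L : List (BasicConstructible k (Fin n))} (hL : proj2Run Ty Txz N I I' J h h' = some L)
    {B : BasicConstructible k (Fin n)} (hB : B ∈ L) :
    ∃ I₁ J₁, 1 ∉ I₁ ∧ I₁.comap (baseIncl k (Fin 1) n) = J₁ ∧
      I₁ ≠ J₁.map (baseIncl k (Fin 1) n) ∧
      (∃ M Ls, proj2SubRun Ty Txz M (I₁ ⊔ I') ⊥ h'
        (leadingCoeffProduct MonomialOrder.lex Ty I₁ J₁) = some Ls ∧ B ∈ Ls) ∧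
      ((I ≤ I₁ ∧ I₁ ≤ I ⊔ J₁.map (baseIncl k (Fin 1) n)) ∨
        (I ≤ J₁.map (baseIncl k (Fin 1) n) ∧ Ideal.span {h} ≤ I₁ ∧
          I₁ ≤ Ideal.span {h} ⊔ J₁.map (baseIncl k (Fin 1) n))) := by
  induction N generalizing I J h L with
  | zero => simp [proj2Run] at hL
  | succ N ih =>
    have hrec : ∀ (D : List (Ideal (MvPolynomial (Fin n) k))) bs,
        D.mapM (fun P => proj2Run Ty Txz N (I ⊔ P.map (baseIncl k (Fin 1) n)) I' P h h') =
          some bs → B ∈ bs.flatten →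
        ∃ I₁ J₁, 1 ∉ I₁ ∧ I₁.comap (baseIncl k (Fin 1) n) = J₁ ∧
          I₁ ≠ J₁.map (baseIncl k (Fin 1) n) ∧
          (∃ M Ls, proj2SubRun Ty Txz M (I₁ ⊔ I') ⊥ h'
            (leadingCoeffProduct MonomialOrder.lex Ty I₁ J₁) = some Ls ∧ B ∈ Ls) ∧
          ((I ≤ I₁ ∧ I₁ ≤ I ⊔ J₁.map (baseIncl k (Fin 1) n)) ∨
            (I ≤ J₁.map (baseIncl k (Fin 1) n) ∧ Ideal.span {h} ≤ I₁ ∧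
              I₁ ≤ Ideal.span {h} ⊔ J₁.map (baseIncl k (Fin 1) n))) := by
      intro D bs hbs hB
      obtain ⟨P, -, c, hc, hBc⟩ := List.exists_of_mem_flatten_of_mapM hbs hB
      obtain ⟨I₁, J₁, h1, h2, h3, h4, h5⟩ := ih hc hBc
      refine ⟨I₁, J₁, h1, h2, h3, h4, ?_⟩
      rcases h5 with ⟨h5, h6⟩ | ⟨h5, h6, h7⟩
      · have hPP : P ≤ J₁ := by
          rw [← h2]
          exact Ideal.le_comap_of_map_le (le_sup_right.trans h5)
        exact Or.inl ⟨le_sup_left.trans h5, h6.trans (sup_le (sup_le le_sup_left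
          (le_sup_of_le_right (Ideal.map_mono hPP))) le_sup_right)⟩
      · exact Or.inr ⟨le_sup_left.trans h5, h6, h7⟩
    rw [proj2Run] at hL
    split_ifs at hL with h1 h2 h3
    · simp only [Option.some.injEq] at hL
      rw [← hL] at hB
      simp at hB
    · simp only [Option.bind_eq_bind, Option.pure_def, Option.bind_eq_some_iff,
        Option.some.injEq] at hL
      obtain ⟨bs, hbs, rfl⟩ := hL
      exact hrec _ _ hbs hB
    · obtain ⟨I₁, J₁, h4, h5, h6, h7, h8⟩ := ih hL hB
      refine ⟨I₁, J₁, h4, h5, h6, h7, Or.inr ?_⟩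
      rcases h8 with ⟨h8, h9⟩ | ⟨-, h9, -⟩
      · -- the call that adjoins `h` is made at an ideal extended from `k[y]`
        have hJJ : J.map (baseIncl k (Fin 1) n) ≤ J₁.map (baseIncl k (Fin 1) n) := by
          refine Ideal.map_mono ?_
          rw [← h5]
          exact Ideal.le_comap_of_map_le (h3 ▸ le_sup_left.trans h8)
        refine ⟨h3.trans_le hJJ, le_sup_right.trans h8, h9.trans (sup_le (sup_le ?_ le_sup_left)
          le_sup_right)⟩
        exact le_sup_of_le_right (h3.trans_le hJJ)
      · -- having adjoined `h` twice, the algorithm would have stopped at the unit ideal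
        exact absurd (h9 (Ideal.mem_span_singleton_self _)) h4
    · simp only [Option.bind_eq_bind, Option.pure_def, Option.bind_eq_some_iff,
        Option.some.injEq] at hL
      obtain ⟨cs, hcs, bs, hbs, rfl⟩ := hL
      rcases List.mem_append.1 hB with hB | hB
      · exact ⟨I, J, h1, not_not.1 h2, h3, ⟨N, cs, hcs, hB⟩, Or.inl ⟨le_rfl, le_sup_left⟩⟩
      · exact hrec _ _ hbs hB

/-- At a point where no leading coefficient of the reduced Gröbner basis vanishes, an ideal that is
not extended from `J` has a member that does not vanish on the whole fibre. -/
theorem exists_fiberAt_ne_zero {R : Type*} [Field R] [Algebra k R] {m₂ : MonomialOrder (Fin n)}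
    {I : Ideal (MvPolynomial (Fin 1 ⊕ Fin n) k)} {J : Ideal (MvPolynomial (Fin n) k)}
    (hJI : J ≤ I.comap (baseIncl k (Fin 1) n)) (hne : I ≠ J.map (baseIncl k (Fin 1) n))
    {a : Fin n → R} (ha : aeval a (leadingCoeffProduct MonomialOrder.lex m₂ I J) ≠ 0) :
    ∃ f ∈ I, fiberAt k a f ≠ 0 := by
  classical
  have hG := isReducedGroebnerBasis_reducedGroebnerBasis (blockOrder MonomialOrder.lex m₂) I
  obtain ⟨g, hg, hgout⟩ : ∃ g ∈ reducedGroebnerBasis (blockOrder MonomialOrder.lex m₂) I,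
      ∀ f ∈ J, baseIncl k (Fin 1) n f ≠ g := by
    by_contra! hcon
    refine hne (le_antisymm ?_ (Ideal.map_le_iff_le_comap.2 hJI))
    rw [← hG.span_eq, Ideal.span_le]
    intro g hg
    obtain ⟨f, hf, rfl⟩ := hcon g hg
    exact Ideal.mem_map_of_mem _ hf
  refine ⟨g, hG.mem hg, fun h0 => ha ?_⟩
  obtain ⟨u, hu⟩ : relLeadingCoeff MonomialOrder.lex g ∣
      leadingCoeffProduct MonomialOrder.lex m₂ I J :=
    Finset.dvd_prod_of_mem _ (Finset.mem_filter.2 ⟨hg, hgout⟩)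
  have h1 := specializeCoeff_rename (0 : Fin 1) a g
  have hid : (Sum.map (fun _ => (0 : Fin 1)) id : Fin 1 ⊕ Fin n → Fin 1 ⊕ Fin n) = id := by
    funext i
    rcases i with i | i
    · exact congrArg Sum.inl (Subsingleton.elim _ _)
    · rfl
  rw [hid, rename_id_apply, h0, map_zero] at h1
  rw [hu, map_mul, relLeadingCoeff, MonomialOrder.leadingCoeff, ← coeff_specializeCoeff, h1,
    coeff_zero, zero_mul]

end Output

/-! ### Continuity and semi-algebraic sections -/

section Sections

variable {R : Type*} {n : ℕ}

theorem eq_of_comp_inr_eq {p q : Fin 1 ⊕ Fin n → R} (h : p ∘ Sum.inr = q ∘ Sum.inr)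
    (h0 : p (Sum.inl 0) = q (Sum.inl 0)) : p = q := by
  funext i
  rcases i with i | i
  · rw [Subsingleton.elim i 0, h0]
  · exact congr_fun h i

variable [Field R] [LinearOrder R] {S : Set (Fin n → R)}

/-- The image of a semi-algebraic section is semi-algebraic. -/
theorem IsSemialgebraicMap.isSemialgebraic_range {ξ : S → (Fin 1 ⊕ Fin n → R)}
    (hξ : IsSemialgebraicMap ξ) (hproj : ∀ s, ξ s ∘ Sum.inr = (s : Fin n → R)) :
    IsSemialgebraic (Set.range ξ) := by
  have h := hξ.preimage (fun t : Fin n ⊕ (Fin 1 ⊕ Fin n) =>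
    (X (Sum.elim Sum.inr id t) : MvPolynomial (Fin 1 ⊕ Fin n) R))
  convert h using 1
  ext p
  constructor
  · rintro ⟨s, rfl⟩
    refine ⟨s, ?_, ?_⟩
    · rw [← hproj s]
      funext i
      simp
    · funext i
      simp
  · rintro ⟨s, -, hs⟩
    refine ⟨s, ?_⟩
    rw [← hs]
    funext i
    simp

end Sections

section EuclideanContinuity

variable {R : Type*} [Field R] [LinearOrder R] [IsStrictOrderedRing R]

attribute [local instance] Preorder.topology

/-- The coordinates are continuous for the Euclidean topology. -/
theorem euclideanTopology_le_pi (σ : Type*) [Fintype σ] :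
    euclideanTopology R σ ≤ (Pi.topologicalSpace : TopologicalSpace (σ → R)) := by
  have : OrderTopology R := ⟨rfl⟩
  refine le_iInf fun i => ?_
  rw [← continuous_iff_le_induced]
  let _ := euclideanTopology R σ
  have key : ∀ (x : σ → R) (r : R), 0 < r → ∀ᶠ y in nhds x, |x i - y i| < r := by
    intro x r hr
    have hopen : IsOpen (euclideanBall x r) :=
      TopologicalSpace.isOpen_generateFrom_of_mem ⟨x, r, hr, rfl⟩
    have hx : x ∈ euclideanBall x r := by
      simpa [euclideanBall] using pow_pos hr 2
    filter_upwards [hopen.mem_nhds hx] with y hy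
    have h1 : (x i - y i) ^ 2 < r ^ 2 := by
      refine lt_of_le_of_lt ?_ hy
      exact Finset.single_le_sum (f := fun j => (x j - y j) ^ 2) (fun j _ => sq_nonneg _)
        (Finset.mem_univ i)
    exact abs_lt_of_sq_lt_sq h1 hr.le
  rw [continuous_iff_continuousAt]
  intro x
  rw [ContinuousAt, tendsto_order]
  refine ⟨fun b hb => ?_, fun b hb => ?_⟩
  · filter_upwards [key x (x i - b) (sub_pos.2 hb)] with y hy
    have := (abs_lt.1 hy).2
    linarith
  · filter_upwards [key x (b - x i) (sub_pos.2 hb)] with y hy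
    have := (abs_lt.1 hy).1
    linarith

theorem continuous_apply_euclidean {σ : Type*} [Fintype σ] (i : σ) :
    @Continuous _ _ (euclideanTopology R σ) _ fun x : σ → R => x i :=
  continuous_le_dom (euclideanTopology_le_pi σ) (continuous_apply i)

/-- Polynomial expressions in functions that are continuous for the order topology are
continuous. -/
theorem continuous_aeval_of_continuous {k : Type*} [Field k] [Algebra k R] {X σ : Type*}
    [TopologicalSpace X] {u : X → σ → R} (hu : ∀ i, Continuous fun x => u x i)
    (f : MvPolynomial σ k) : Continuous fun x => aeval (u x) f := by
  have : OrderTopology R := ⟨rfl⟩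
  induction f using MvPolynomial.induction_on with
  | C c => simpa using continuous_const
  | add p q hp hq =>
    simp only [map_add]
    exact hp.add hq
  | mul_X p i hp =>
    simp only [map_mul, aeval_X]
    exact hp.mul (hu i)

theorem IsEuclideanContinuous.continuous_apply {σ τ : Type*} [Fintype σ] [Fintype τ]
    {S : Set (σ → R)} {ξ : S → τ → R} (hξ : IsEuclideanContinuous ξ) (i : τ) :
    @Continuous _ _ (euclideanTopologyOn S) _ fun s => ξ s i :=
  let _ := euclideanTopologyOn S
  let _ := euclideanTopology R τ
  (continuous_apply_euclidean i).comp hξ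

/-- A polynomial that does not vanish at one value of a continuous map does not vanish at the
neighbouring ones. -/
theorem IsEuclideanContinuous.eventually_aeval_ne_zero {k : Type*} [Field k] [Algebra k R]
    {σ τ : Type*} [Fintype σ] [Fintype τ] {S : Set (σ → R)} {ξ : S → τ → R}
    (hξ : IsEuclideanContinuous ξ) {f : MvPolynomial τ k} {s₀ : S} (h : aeval (ξ s₀) f ≠ 0) :
    ∀ᶠ s in @nhds _ (euclideanTopologyOn S) s₀, aeval (ξ s) f ≠ 0 := by
  have : OrderTopology R := ⟨rfl⟩
  let _ := euclideanTopologyOn S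
  exact (continuous_aeval_of_continuous hξ.continuous_apply f).continuousAt.eventually_ne h

variable {n : ℕ} {S : Set (Fin n → R)}

/-- Two sections over a semi-algebraically connected set that agree in a neighbourhood of every
point where they agree are identical or disjoint. -/
theorem IsSemialgebraicallyConnected.eq_or_forall_ne [IsRealClosed R] (hS : IsSemialgebraic S)
    (hconn : IsSemialgebraicallyConnected S) {ξ η : S → (Fin 1 ⊕ Fin n → R)}
    (hξ : IsSemialgebraicMap ξ) (hξc : IsEuclideanContinuous ξ)
    (hξp : ∀ s, ξ s ∘ Sum.inr = (s : Fin n → R))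
    (hη : IsSemialgebraicMap η) (hηc : IsEuclideanContinuous η)
    (hηp : ∀ s, η s ∘ Sum.inr = (s : Fin n → R))
    (hloc : ∀ s₀, ξ s₀ = η s₀ → ∀ᶠ s in @nhds _ (euclideanTopologyOn S) s₀, ξ s = η s) :
    ξ = η ∨ ∀ s, ξ s ≠ η s := by
  have : OrderTopology R := ⟨rfl⟩
  let _ := euclideanTopologyOn S
  set A : Set S := {s | ξ s = η s} with hA
  have hAeq : A = {s | ξ s (Sum.inl 0) = η s (Sum.inl 0)} := by
    ext s
    exact ⟨fun h => congr_fun h _, fun h => eq_of_comp_inr_eq ((hξp s).trans (hηp s).symm) h⟩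
  have hAclosed : IsClosed A := by
    rw [hAeq]
    exact isClosed_eq (hξc.continuous_apply _) (hηc.continuous_apply _)
  have hAopen : IsOpen A := isOpen_iff_mem_nhds.2 hloc
  have hclosedIn : ∀ B : Set S, IsClosed B → IsEuclideanClosedIn (Subtype.val '' B) S := by
    intro B hB
    obtain ⟨F, hF, rfl⟩ := (@isClosed_induced_iff _ _ (euclideanTopology R (Fin n)) _ _).1 hB
    exact ⟨F, hF, Subtype.image_preimage_val S F⟩
  have hAalg : IsSemialgebraic (Subtype.val '' A) := by
    have h := ((hξ.isSemialgebraic_range hξp).inter (hη.isSemialgebraic_range hηp)).exists_fiber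
    convert h using 1
    ext a
    constructor
    · rintro ⟨s, hs, rfl⟩
      refine ⟨ξ s (Sum.inl 0), ?_⟩
      have : Sum.elim (fun _ => ξ s (Sum.inl 0)) (s : Fin n → R) = ξ s :=
        eq_of_comp_inr_eq (by rw [hξp]; rfl) rfl
      rw [this]
      exact ⟨⟨s, rfl⟩, ⟨s, hs.symm⟩⟩
    · rintro ⟨x, ⟨s, hs⟩, ⟨s', hs'⟩⟩
      have h1 : (s : Fin n → R) = a := by rw [← hξp s, hs]; rfl
      have h2 : (s' : Fin n → R) = a := by rw [← hηp s', hs']; rfl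
      obtain rfl : s = s' := Subtype.ext (h1.trans h2.symm)
      exact ⟨s, hs.trans hs'.symm, h1⟩
  have hcompl : Subtype.val '' Aᶜ = S ∩ (Subtype.val '' A)ᶜ := by
    ext a
    constructor
    · rintro ⟨s, hs, rfl⟩
      exact ⟨s.2, fun ⟨s', hs', h⟩ => hs (Subtype.ext h ▸ hs')⟩
    · rintro ⟨ha, h⟩
      exact ⟨⟨a, ha⟩, fun h' => h ⟨_, h', rfl⟩, rfl⟩
  by_contra! hcon
  obtain ⟨hne, s, hs⟩ := hcon
  obtain ⟨s', hs'⟩ := Function.ne_iff.1 hne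
  refine hconn ⟨Subtype.val '' A, Subtype.val '' Aᶜ, hAalg, ?_, ⟨s, s, hs, rfl⟩, ⟨s', s', hs', rfl⟩,
    hclosedIn _ hAclosed, hclosedIn _ hAopen.isClosed_compl, ?_, ?_⟩
  · rw [hcompl]
    exact hS.inter hAalg.compl
  · exact (Set.disjoint_image_iff Subtype.val_injective).2 disjoint_compl_right
  · rw [← Set.image_union, Set.union_compl_self, Set.image_univ, Subtype.range_coe]

end EuclideanContinuity

/-! ### Local equations over the base -/

section LocalEquation

open scoped Polynomial

theorem Polynomial.exists_pseudo_division {A : Type*} [CommRing A] [IsDomain A] {c : A[X]}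
    (hc : c ≠ 0) (f : A[X]) :
    ∃ (M : ℕ) (q r : A[X]), Polynomial.C (c.leadingCoeff ^ M) * f = q * c + r ∧
      r.degree < c.degree := by
  induction hd : f.degree using WellFoundedLT.induction generalizing f with
  | _ d ih =>
    by_cases hlt : f.degree < c.degree
    · exact ⟨0, 0, f, by simp, hlt⟩
    rw [not_lt] at hlt
    have hf0 : f ≠ 0 := by
      rintro rfl
      rw [Polynomial.degree_zero, le_bot_iff, Polynomial.degree_eq_bot] at hlt
      exact hc hlt
    have hl : c.leadingCoeff ≠ 0 := Polynomial.leadingCoeff_ne_zero.2 hc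
    set u : A[X] := Polynomial.C f.leadingCoeff * Polynomial.X ^ (f.natDegree - c.natDegree)
    have hu : (u * c).degree = f.degree := by
      rw [Polynomial.degree_mul, Polynomial.degree_C_mul_X_pow _
        (Polynomial.leadingCoeff_ne_zero.2 hf0), Polynomial.degree_eq_natDegree hc,
        Polynomial.degree_eq_natDegree hf0, ← Nat.cast_add,
        Nat.sub_add_cancel (Polynomial.natDegree_le_natDegree hlt)]
    have hlf : (Polynomial.C c.leadingCoeff * f).degree = f.degree := by
      rw [Polynomial.degree_mul, Polynomial.degree_C hl, zero_add]
    obtain ⟨M, q, r, hqr, hr⟩ := ih (Polynomial.C c.leadingCoeff * f - u * c).degree (by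
      rw [← hd, ← hlf]
      refine Polynomial.degree_sub_lt_left (hlf.trans hu.symm)
        (mul_ne_zero (Polynomial.C_ne_zero.2 hl) hf0) ?_
      rw [Polynomial.leadingCoeff_mul, Polynomial.leadingCoeff_mul, Polynomial.leadingCoeff_C,
        Polynomial.leadingCoeff_C_mul_X_pow, mul_comm]) _ rfl
    refine ⟨M + 1, q + Polynomial.C (c.leadingCoeff ^ M) * u, r, ?_, hr⟩
    rw [pow_succ, Polynomial.C_mul]
    linear_combination hqr

variable {k : Type*} [Field k] {R : Type*} [Field R] [Algebra k R] {n : ℕ}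

theorem map_fiberPoly (a : Fin n → R) (f : MvPolynomial (Fin 1 ⊕ Fin n) k) :
    (fiberPoly k (Fin n) f).map (aeval a : MvPolynomial (Fin n) k →ₐ[k] R).toRingHom =
      fiberAt k a f := by
  have : (Polynomial.mapAlgHom (aeval a : MvPolynomial (Fin n) k →ₐ[k] R)).comp
      (fiberPoly k (Fin n)) = fiberAt k a := by
    ext1 i
    rcases i with i | i <;> simp [fiberPoly, fiberAt]
  exact DFunLike.congr_fun this f

theorem fiberPoly_surjective (k : Type*) [Field k] (n : ℕ) :
    Function.Surjective (fiberPoly k (Fin n)) := by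
  have hC : ∀ p, fiberPoly k (Fin n) (baseIncl k (Fin 1) n p) = Polynomial.C p := by
    intro p
    have : (fiberPoly k (Fin n)).comp (baseIncl k (Fin 1) n) =
        (Polynomial.CAlgHom : _ →ₐ[MvPolynomial (Fin n) k] _).restrictScalars k := by
      ext1 i
      simp [fiberPoly, baseIncl]
    exact DFunLike.congr_fun this p
  intro c
  induction c using Polynomial.induction_on' with
  | add p q hp hq =>
    obtain ⟨⟨f, rfl⟩, ⟨g, rfl⟩⟩ := hp, hq
    exact ⟨f + g, map_add _ _ _⟩
  | monomial m p =>
    refine ⟨baseIncl k (Fin 1) n p * X (Sum.inl 0) ^ m, ?_⟩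
    rw [map_mul, hC, map_pow, ← Polynomial.C_mul_X_pow_eq_monomial]
    simp [fiberPoly]

/-- The restriction of a polynomial in `y` to a fibre is constant. -/
theorem fiberAt_baseIncl (a : Fin n → R) (p : MvPolynomial (Fin n) k) :
    fiberAt k a (baseIncl k (Fin 1) n p) = Polynomial.C (aeval a p) := by
  have : (fiberAt k a).comp (baseIncl k (Fin 1) n) =
      ((Polynomial.CAlgHom : R →ₐ[R] _).restrictScalars k).comp (aeval a) := by
    ext1 i
    simp [fiberAt, baseIncl]
  exact DFunLike.congr_fun this p

/-- Over `S` as in `exists_fiber_gcd`, the polynomial `c` and the quotients `e f` by `c` of the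
members `f` of the ideal, up to units, are polynomials in `x` and `y`. At every point over `S`, the
zeros of `c` lie in `D(h)`, and the common zeros of the quotients of generators lie in `V(h)`. -/
theorem exists_local_equation (Ty : MonomialOrder (Fin n)) (Txz : MonomialOrder (Fin 2))
    (I : Ideal (MvPolynomial (Fin 1 ⊕ Fin n) k)) (h : MvPolynomial (Fin 1 ⊕ Fin n) k)
    (P : Ideal (MvPolynomial (Fin n) k)) {S : Set (Fin n → R)} (hne : S.Nonempty)
    (hP : ∀ a ∈ S, ∀ f ∈ P, aeval a f = 0)
    (hv : ∀ a ∈ S, aeval a (leadingCoeffProduct Txz Ty (rabinowitschIdeal I h) P) ≠ 0)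
    (hI : ∀ a ∈ S, ∃ f ∈ I, fiberAt k a f ≠ 0)
    {F : Set (MvPolynomial (Fin 1 ⊕ Fin n) k)} (hFI : F ⊆ I)
    (hF : ∀ a ∈ S, I.map (fiberAt k a) ≤ Ideal.span (fiberAt k a '' F)) :
    ∃ (c : MvPolynomial (Fin 1 ⊕ Fin n) k)
      (e : MvPolynomial (Fin 1 ⊕ Fin n) k → MvPolynomial (Fin 1 ⊕ Fin n) k),
      ∀ p : Fin 1 ⊕ Fin n → R, p ∘ Sum.inr ∈ S →
        (∀ f ∈ I, ∃ u : R, u ≠ 0 ∧ u * aeval p f = aeval p (e f) * aeval p c) ∧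
        ((∀ f ∈ F, aeval p (e f) = 0) → aeval p h = 0) ∧ (aeval p c = 0 → aeval p h ≠ 0) := by
  obtain ⟨c, hc⟩ := exists_fiber_gcd Ty Txz I h P hne hP hv hI
  have hc0 : c ≠ 0 := by
    rintro rfl
    obtain ⟨a, ha⟩ := hne
    simpa using (hc a ha).1
  choose M q r hqr hr using Polynomial.exists_pseudo_division hc0
  choose Ψ hΨ using fiberPoly_surjective k n
  have hmap : ∀ a : Fin n → R, ∀ d,
      d.map (aeval a : MvPolynomial (Fin n) k →ₐ[k] R).toRingHom = fiberAt k a (Ψ d) := by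
    intro a d
    rw [← map_fiberPoly, hΨ]
  have heq : ∀ a ∈ S, ∀ f ∈ I, Polynomial.C (aeval a c.leadingCoeff ^ M (fiberPoly k (Fin n) f)) *
      fiberAt k a f = fiberAt k a (Ψ (q (fiberPoly k (Fin n) f))) * fiberAt k a (Ψ c) := by
    intro a ha f hf
    obtain ⟨hl, hdvd, -, -⟩ := hc a ha
    set φ := (aeval a : MvPolynomial (Fin n) k →ₐ[k] R).toRingHom with hφ
    have h1 := congrArg (Polynomial.map φ) (hqr (fiberPoly k (Fin n) f))
    rw [Polynomial.map_mul, Polynomial.map_add, Polynomial.map_mul, Polynomial.map_C, map_fiberPoly,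
      map_pow] at h1
    -- the remainder vanishes on the fibre, being divisible by `c` and of smaller degree
    have h2 : (r (fiberPoly k (Fin n) f)).map φ = 0 := by
      refine Polynomial.eq_zero_of_dvd_of_degree_lt (p := c.map φ) ?_ ?_
      · rw [← sub_eq_iff_eq_add'.2 h1]
        exact dvd_sub ((hdvd f hf).mul_left _) (Dvd.intro_left _ rfl)
      · rw [Polynomial.degree_map_eq_of_leadingCoeff_ne_zero φ hl]
        exact Polynomial.degree_map_le.trans_lt (hr _)
    rw [h2, add_zero, hmap, hmap] at h1
    exact h1
  refine ⟨Ψ c, fun f => Ψ (q (fiberPoly k (Fin n) f)), fun p hp => ?_⟩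
  set a := p ∘ Sum.inr with ha
  set t := p (Sum.inl 0) with ht
  obtain ⟨hl, hdvd, ⟨N, hN⟩, hcop⟩ := hc a hp
  have hpt : Sum.elim (fun _ => t) a = p := eq_of_comp_inr_eq rfl rfl
  have heval : ∀ f : MvPolynomial (Fin 1 ⊕ Fin n) k, aeval p f = (fiberAt k a f).eval t := by
    intro f
    rw [eval_fiberAt, hpt]
  rw [hmap] at hN hcop
  have hca0 : fiberAt k a (Ψ c) ≠ 0 := by
    rw [← hmap]
    intro h0
    have := Polynomial.leadingCoeff_map_of_leadingCoeff_ne_zero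
      (aeval a : MvPolynomial (Fin n) k →ₐ[k] R).toRingHom hl
    rw [h0, Polynomial.leadingCoeff_zero] at this
    exact hl this.symm
  refine ⟨fun f hf => ⟨_, pow_ne_zero (M (fiberPoly k (Fin n) f)) hl, ?_⟩, fun h0 => ?_,
    fun h0 h1 => ?_⟩
  · have := congrArg (Polynomial.eval t) (heq a hp f hf)
    rwa [Polynomial.eval_mul, Polynomial.eval_mul, Polynomial.eval_C, ← heval, ← heval, ← heval]
      at this
  · -- if `t` is a zero of all quotients, then `c (x - t)` divides `c h ^ N` on the fibre
    have hle : I.map (fiberAt k a) ≤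
        Ideal.span {fiberAt k a (Ψ c) * (Polynomial.X - Polynomial.C t)} := by
      refine (hF a hp).trans (Ideal.span_le.2 ?_)
      rintro _ ⟨f, hf, rfl⟩
      have h1 := h0 f hf
      rw [heval] at h1
      obtain ⟨z, hz⟩ := Polynomial.dvd_iff_isRoot.2 h1
      rw [SetLike.mem_coe, Ideal.mem_span_singleton]
      have hunit : IsUnit (Polynomial.C (aeval a c.leadingCoeff ^ M (fiberPoly k (Fin n) f))) :=
        Polynomial.isUnit_C.2 (isUnit_iff_ne_zero.2 (pow_ne_zero _ hl))
      rw [← hunit.dvd_mul_left, heq a hp f (hFI hf), hz]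
      exact ⟨z, by ring⟩
    have h1 := (mul_dvd_mul_iff_left hca0).1 (Ideal.mem_span_singleton.1 (hle hN))
    have h2 := Polynomial.dvd_iff_isRoot.1 h1
    rw [Polynomial.IsRoot.def, Polynomial.eval_pow, ← heval] at h2
    exact eq_zero_of_pow_eq_zero h2
  · obtain ⟨u, w, huw⟩ := hcop
    have := congrArg (Polynomial.eval t) huw
    rw [Polynomial.eval_add, Polynomial.eval_mul, Polynomial.eval_mul, ← heval, ← heval, h0, h1,
      mul_zero, mul_zero, zero_add, Polynomial.eval_one] at this
    exact zero_ne_one this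

end LocalEquation

/-! ### Delineated sets and their sections -/

section Sections

variable {k : Type*} [Field k] {R : Type*} [Field R] [Algebra k R]

theorem BasicConstructible.mem_points_baseChange {σ : Type*} {I : Ideal (MvPolynomial σ k)}
    {h : MvPolynomial σ k} {p : σ → R} :
    p ∈ ((BasicConstructible.mk I h).baseChange R).points ↔
      (∀ f ∈ I, aeval p f = 0) ∧ aeval p h ≠ 0 := by
  have hev : ∀ f : MvPolynomial σ k, eval p (map (algebraMap k R) f) = aeval p f := by
    intro f
    rw [eval_map, aeval_def]
  have hle : (∀ f ∈ I.map (map (algebraMap k R)), eval p f = 0) ↔ ∀ f ∈ I, aeval p f = 0 := by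
    have := Ideal.map_le_iff_le_comap (f := map (σ := σ) (algebraMap k R)) (I := I)
      (K := RingHom.ker (eval p))
    simpa only [SetLike.le_def, Ideal.mem_comap, RingHom.mem_ker, hev] using this
  rw [BasicConstructible.points, Set.mem_ofPred_eq, BasicConstructible.baseChange, hle, hev]

theorem BasicConstructible.mem_points_hypersurface {σ : Type*} {g : MvPolynomial σ R} {p : σ → R} :
    p ∈ (BasicConstructible.mk (Ideal.span {g}) 1).points ↔ eval p g = 0 := by
  have hle : (∀ f ∈ Ideal.span {g}, eval p f = 0) ↔ eval p g = 0 := by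
    have := Ideal.span_singleton_le_iff_mem (I := RingHom.ker (eval p)) (x := g)
    simpa only [SetLike.le_def, RingHom.mem_ker] using this
  rw [BasicConstructible.points, Set.mem_ofPred_eq, hle]
  simp

theorem BasicConstructible.mem_points_nonvanishing {σ : Type*} {g : MvPolynomial σ R} {p : σ → R} :
    p ∈ (BasicConstructible.mk ⊥ g).points ↔ eval p g ≠ 0 := by
  rw [BasicConstructible.points, Set.mem_ofPred_eq]
  simp

variable {n : ℕ}

theorem eval_eq_eval_fiberAt (p : Fin 1 ⊕ Fin n → R) (g : MvPolynomial (Fin 1 ⊕ Fin n) R) :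
    eval p g = (fiberAt R (p ∘ Sum.inr) g).eval (p (Sum.inl 0)) := by
  rw [eval_fiberAt, ← coe_aeval_eq_eval]
  exact congrArg (fun q => aeval q g) (eq_of_comp_inr_eq rfl rfl)

theorem aeval_eq_eval_fiberAt (p : Fin 1 ⊕ Fin n → R) (g : MvPolynomial (Fin 1 ⊕ Fin n) k) :
    aeval p g = (fiberAt k (p ∘ Sum.inr) g).eval (p (Sum.inl 0)) := by
  rw [eval_fiberAt]
  exact congrArg (fun q => aeval q g) (eq_of_comp_inr_eq rfl rfl)

theorem Polynomial.eq_zero_of_finite_of_eval_ne_zero [Infinite R] {p : Polynomial R} {X : Set R}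
    (hX : X.Finite) (h : ∀ t, p.eval t ≠ 0 → t ∈ X) : p = 0 := by
  refine Polynomial.eq_zero_of_infinite_isRoot p fun hfin => Set.infinite_univ (α := R) ?_
  refine (hfin.union hX).subset fun t _ => ?_
  by_cases ht : p.eval t = 0
  exacts [Or.inl ht, Or.inr (h t ht)]

variable [LinearOrder R] {S : Set (Fin n → R)} {m : ℕ}
  {ξ : Fin m → S → (Fin 1 ⊕ Fin n → R)}

/-- Only finitely many points of a delineated set lie over a point of the base. -/
theorem IsDelineatedBy.finite_fiber {T : BasicConstructible R (Fin 1 ⊕ Fin n)}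
    (hT : IsDelineatedBy T S m ξ) {a : Fin n → R} (ha : a ∈ S) :
    {t : R | Sum.elim (fun _ => t) a ∈ T.points}.Finite := by
  refine (Set.finite_range fun i => ξ i ⟨a, ha⟩ (Sum.inl 0)).subset fun t ht => ?_
  obtain ⟨i, hi, -⟩ := hT.cover _ ht ha
  exact ⟨i, (congr_fun hi (Sum.inl 0)).symm⟩

/-- If `T` agrees with `D(g)` over `S` and `V(g)` is delineated, then the fibres of `V(g)` are
finite, so `D(g)` meets every fibre in a cofinite set. -/
theorem IsDelineatedBy.eq_zero_of_eval_ne_zero [Infinite R] {g : MvPolynomial (Fin 1 ⊕ Fin n) R}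
    (hg : IsDelineatedBy (BasicConstructible.mk (Ideal.span {g}) 1) S m ξ) {a : Fin n → R}
    (ha : a ∈ S) {p : Polynomial R}
    (hp : ∀ t, eval (Sum.elim (fun _ => t) a) g ≠ 0 → p.eval t = 0) : p = 0 := by
  refine Polynomial.eq_zero_of_finite_of_eval_ne_zero (hg.finite_fiber ha) fun t ht => ?_
  rw [Set.mem_ofPred_eq, BasicConstructible.mem_points_hypersurface]
  by_contra h
  exact ht (hp t h)

/-- Repeated use of the convention gives nothing beyond a single use. -/
theorem HasSections.direct_or_convention [Infinite R] (hne : S.Nonempty)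
    {T : BasicConstructible R (Fin 1 ⊕ Fin n)} (hT : HasSections S m ξ T) :
    m = 0 ∨ IsDelineatedBy T S m ξ ∨ ∃ g : MvPolynomial (Fin 1 ⊕ Fin n) R,
      (∀ p : Fin 1 ⊕ Fin n → R, p ∘ Sum.inr ∈ S → (p ∈ T.points ↔ eval p g ≠ 0)) ∧
      IsDelineatedBy (BasicConstructible.mk (Ideal.span {g}) 1) S m ξ := by
  induction hT with
  | direct T hT => exact Or.inr (Or.inl hT)
  | convention T g hTg hg ih =>
    have hTg' : ∀ p : Fin 1 ⊕ Fin n → R, p ∘ Sum.inr ∈ S → (p ∈ T.points ↔ eval p g ≠ 0) := by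
      intro p hp
      have := Set.ext_iff.1 hTg p
      rw [Set.mem_inter_iff, Set.mem_inter_iff, BasicConstructible.mem_points_nonvanishing] at this
      constructor
      · exact fun h => (this.1 ⟨h, hp⟩).1
      · exact fun h => (this.2 ⟨h, hp⟩).1
    rcases ih with h0 | hd | ⟨g', hg', hd⟩
    · exact Or.inl h0
    · exact Or.inr (Or.inr ⟨g, hTg', hd⟩)
    · -- `g` vanishes on a cofinite subset of a fibre, hence on all of it, and `g'` nowhere
      refine Or.inl (Nat.eq_zero_of_not_pos fun hm => ?_)
      obtain ⟨a, ha⟩ := hne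
      set p := ξ ⟨0, hm⟩ ⟨a, ha⟩
      have hpa : p ∘ Sum.inr = a := hd.proj_eq _ _
      have hgp : fiberAt R a g = 0 := hd.eq_zero_of_eval_ne_zero ha fun t ht => by
        have := BasicConstructible.mem_points_hypersurface.1
          ((hg' (Sum.elim (fun _ => t) a) ha).2 ht)
        rwa [eval_eq_eval_fiberAt] at this
      refine (hg' p (hpa ▸ ha)).1 (BasicConstructible.mem_points_hypersurface.2 ?_)
        (BasicConstructible.mem_points_hypersurface.1 (hd.mem_points _ _))
      rw [eval_eq_eval_fiberAt, hpa, hgp, Polynomial.eval_zero]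

/-- The sections of a geometrically delineable set `V(I) ∩ D(h)` over `S` are the sections of a
delineated set, which is `V(I) ∩ D(h)` itself or, if `I` vanishes over `S`, the set `V(h)`. -/
theorem HasSections.exists_isDelineatedBy [Infinite R] (hne : S.Nonempty)
    {I : Ideal (MvPolynomial (Fin 1 ⊕ Fin n) k)} {h : MvPolynomial (Fin 1 ⊕ Fin n) k}
    (hT : HasSections S m ξ ((BasicConstructible.mk I h).baseChange R)) :
    m = 0 ∨ ∃ D, IsDelineatedBy D S m ξ ∧
      ((∀ p : Fin 1 ⊕ Fin n → R, p ∘ Sum.inr ∈ S →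
          (p ∈ D.points ↔ (∀ f ∈ I, aeval p f = 0) ∧ aeval p h ≠ 0)) ∨
        (∀ a ∈ S, ∀ f ∈ I, fiberAt k a f = 0) ∧ ∀ p : Fin 1 ⊕ Fin n → R, p ∘ Sum.inr ∈ S →
          (p ∈ D.points ↔ aeval p h = 0)) := by
  rcases hT.direct_or_convention hne with h0 | hd | ⟨g, hg, hd⟩
  · exact Or.inl h0
  · exact Or.inr ⟨_, hd, Or.inl fun p _ => BasicConstructible.mem_points_baseChange⟩
  · have hI : ∀ a ∈ S, ∀ f ∈ I, fiberAt k a f = 0 := by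
      intro a ha f hf
      refine hd.eq_zero_of_eval_ne_zero ha fun t ht => ?_
      rw [eval_fiberAt]
      exact (BasicConstructible.mem_points_baseChange.1
        ((hg (Sum.elim (fun _ => t) a) ha).2 ht)).1 f hf
    refine Or.inr ⟨_, hd, Or.inr ⟨hI, fun p hp => ?_⟩⟩
    have h1 := hg p hp
    rw [BasicConstructible.mem_points_baseChange] at h1
    have h2 : ∀ f ∈ I, aeval p f = 0 := by
      intro f hf
      rw [aeval_eq_eval_fiberAt, hI _ hp f hf, Polynomial.eval_zero]
    rw [BasicConstructible.mem_points_hypersurface]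
    constructor
    · intro h3
      by_contra h4
      exact h1.1 ⟨h2, h4⟩ h3
    · intro h3
      by_contra h4
      exact (h1.2 h4).2 h3

end Sections

section Agreement

variable {k : Type*} [Field k] {R : Type*} [Field R] [LinearOrder R] [IsStrictOrderedRing R]
  [Algebra k R] {n : ℕ} {S : Set (Fin n → R)} {m m' : ℕ}
  {ξ : Fin m → S → (Fin 1 ⊕ Fin n → R)} {ξ' : Fin m' → S → (Fin 1 ⊕ Fin n → R)}

/-- A continuous map into a delineated set that lifts the inclusion of the base coincides with a
section near every point where it meets the section. -/
theorem IsDelineatedBy.eventually_eq {D : BasicConstructible R (Fin 1 ⊕ Fin n)}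
    (hD : IsDelineatedBy D S m ξ) {η : S → (Fin 1 ⊕ Fin n → R)} (hη : IsEuclideanContinuous η)
    (hηp : ∀ s, η s ∘ Sum.inr = (s : Fin n → R)) {s₀ : S}
    (hmem : ∀ᶠ s in @nhds _ (euclideanTopologyOn S) s₀, η s ∈ D.points) {i : Fin m}
    (h₀ : η s₀ = ξ i s₀) : ∀ᶠ s in @nhds _ (euclideanTopologyOn S) s₀, η s = ξ i s := by
  let _ : TopologicalSpace R := Preorder.topology R
  have : OrderTopology R := ⟨rfl⟩
  let _ := euclideanTopologyOn S
  have hne : ∀ j, j ≠ i → ∀ᶠ s in nhds s₀, η s (Sum.inl 0) ≠ ξ j s (Sum.inl 0) := by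
    intro j hj
    refine ((hη.continuous_apply _).continuousAt.ne_iff_eventually_ne
      ((hD.continuous j).continuous_apply _).continuousAt).1 ?_
    rw [h₀]
    rcases lt_or_gt_of_ne hj with hlt | hlt
    exacts [(hD.strictMono _ _ s₀ hlt).ne', (hD.strictMono _ _ s₀ hlt).ne]
  have hall : ∀ᶠ s in nhds s₀, ∀ j, j ≠ i → η s (Sum.inl 0) ≠ ξ j s (Sum.inl 0) := by
    rw [Filter.eventually_all]
    intro j
    by_cases hj : j = i
    · exact Filter.Eventually.of_forall fun s h => absurd hj h
    · filter_upwards [hne j hj] with s hs _ using hs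
  filter_upwards [hmem, hall] with s hs hs'
  have hsS : η s ∘ Sum.inr ∈ S := by rw [hηp]; exact s.2
  obtain ⟨l, hl, -⟩ := hD.cover _ hs hsS
  have hss : (⟨η s ∘ Sum.inr, hsS⟩ : S) = s := Subtype.ext (hηp s)
  simp only [hss] at hl
  by_cases hli : l = i
  · rw [← hli]; exact hl
  · exact absurd (congr_fun hl (Sum.inl 0)) (hs' l hli)

/-- Two sections, of `V(I₁) ∩ D(o)` and of `V(I') ∩ D(h')` or of `V(h')` if `I'` vanishes over `S`,
that agree at a point agree in a neighbourhood of it. The zeros of `c` are the points over `S` of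
`V(I₁) ∩ V(I') ∩ D(h')`, and a generator `f` of `I₁ + I'` is, up to units, the product of `c` and
`e f`. Where `e f` does not vanish, `f` vanishes only at the zeros of `c`. -/
theorem IsDelineatedBy.eventually_eq_of_eq {D D' : BasicConstructible R (Fin 1 ⊕ Fin n)}
    (hD : IsDelineatedBy D S m ξ) (hD' : IsDelineatedBy D' S m' ξ')
    {I₁ I' : Ideal (MvPolynomial (Fin 1 ⊕ Fin n) k)} {o h' c : MvPolynomial (Fin 1 ⊕ Fin n) k}
    {e : MvPolynomial (Fin 1 ⊕ Fin n) k → MvPolynomial (Fin 1 ⊕ Fin n) k}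
    (hDo : ∀ p : Fin 1 ⊕ Fin n → R, p ∘ Sum.inr ∈ S →
      (p ∈ D.points ↔ (∀ f ∈ I₁, aeval p f = 0) ∧ aeval p o ≠ 0))
    (hDh' : (∀ p : Fin 1 ⊕ Fin n → R, p ∘ Sum.inr ∈ S →
        (p ∈ D'.points ↔ (∀ f ∈ I', aeval p f = 0) ∧ aeval p h' ≠ 0)) ∨
      (∀ a ∈ S, ∀ f ∈ I', fiberAt k a f = 0) ∧ ∀ p : Fin 1 ⊕ Fin n → R, p ∘ Sum.inr ∈ S →
        (p ∈ D'.points ↔ aeval p h' = 0))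
    (hc : ∀ p : Fin 1 ⊕ Fin n → R, p ∘ Sum.inr ∈ S →
      (∀ f, f ∈ I₁ ∨ f ∈ I' → ∃ u : R, u ≠ 0 ∧ u * aeval p f = aeval p (e f) * aeval p c) ∧
      ((∀ f, f ∈ I₁ ∨ f ∈ I' → aeval p (e f) = 0) → aeval p h' = 0) ∧
      (aeval p c = 0 → aeval p h' ≠ 0))
    {i : Fin m} {j : Fin m'} {s₀ : S} (h₀ : ξ i s₀ = ξ' j s₀) :
    ∀ᶠ s in @nhds _ (euclideanTopologyOn S) s₀, ξ i s = ξ' j s := by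
  have hξS : ∀ s, ξ i s ∘ Sum.inr ∈ S := fun s => by rw [hD.proj_eq]; exact s.2
  have hξS' : ∀ s, ξ' j s ∘ Sum.inr ∈ S := fun s => by rw [hD'.proj_eq]; exact s.2
  have hξ₁ : ∀ s, (∀ f ∈ I₁, aeval (ξ i s) f = 0) ∧ aeval (ξ i s) o ≠ 0 := fun s =>
    (hDo _ (hξS s)).1 (hD.mem_points i s)
  have hzero : ∀ p : Fin 1 ⊕ Fin n → R, p ∘ Sum.inr ∈ S → aeval p c = 0 → ∀ f, f ∈ I₁ ∨ f ∈ I' →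
      aeval p f = 0 := by
    intro p hp h0 f hf
    obtain ⟨u, hu, huf⟩ := (hc p hp).1 f hf
    rw [h0, mul_zero] at huf
    exact (mul_eq_zero.1 huf).resolve_left hu
  have hfactor : ∀ p : Fin 1 ⊕ Fin n → R, p ∘ Sum.inr ∈ S → ∀ f, f ∈ I₁ ∨ f ∈ I' →
      aeval p f = 0 → aeval p (e f) = 0 ∨ aeval p c = 0 := by
    intro p hp f hf h0
    obtain ⟨u, -, huf⟩ := (hc p hp).1 f hf
    rw [h0, mul_zero] at huf
    exact mul_eq_zero.1 huf.symm
  rcases hDh' with hD'p | ⟨hI', hD'p⟩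
  · have hξ' : ∀ s, (∀ f ∈ I', aeval (ξ' j s) f = 0) ∧ aeval (ξ' j s) h' ≠ 0 := fun s =>
      (hD'p _ (hξS' s)).1 (hD'.mem_points j s)
    obtain ⟨f, hf, hef⟩ : ∃ f, (f ∈ I₁ ∨ f ∈ I') ∧ aeval (ξ i s₀) (e f) ≠ 0 := by
      by_contra! hcon
      exact (h₀ ▸ (hξ' s₀).2) ((hc _ (hξS s₀)).2.1 hcon)
    rcases hf with hf | hf
    · refine hD'.eventually_eq (hD.continuous i) (hD.proj_eq i) ?_ h₀
      filter_upwards [(hD.continuous i).eventually_aeval_ne_zero hef] with s hs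
      have h0 := (hfactor _ (hξS s) f (Or.inl hf) ((hξ₁ s).1 f hf)).resolve_left hs
      exact (hD'p _ (hξS s)).2 ⟨fun g hg => hzero _ (hξS s) h0 g (Or.inr hg),
        (hc _ (hξS s)).2.2 h0⟩
    · have hev : ∀ᶠ s in @nhds _ (euclideanTopologyOn S) s₀, ξ' j s = ξ i s := by
        refine hD.eventually_eq (hD'.continuous j) (hD'.proj_eq j) ?_ h₀.symm
        rw [h₀] at hef
        filter_upwards [(hD'.continuous j).eventually_aeval_ne_zero hef,
          (hD'.continuous j).eventually_aeval_ne_zero (h₀ ▸ (hξ₁ s₀).2)] with s hs hso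
        have h0 := (hfactor _ (hξS' s) f (Or.inr hf) ((hξ' s).1 f hf)).resolve_left hs
        exact (hDo _ (hξS' s)).2 ⟨fun g hg => hzero _ (hξS' s) h0 g (Or.inl hg), hso⟩
      filter_upwards [hev] with s hs using hs.symm
  · -- here the sections of `V(h')` lie off the zeros of `c`
    refine hD'.eventually_eq (hD.continuous i) (hD.proj_eq i) ?_ h₀
    have hc₀ : aeval (ξ i s₀) c ≠ 0 := fun h0 =>
      (hc _ (hξS s₀)).2.2 h0 ((hD'p _ (hξS s₀)).1 (h₀ ▸ hD'.mem_points j s₀))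
    filter_upwards [(hD.continuous i).eventually_aeval_ne_zero hc₀] with s hs
    refine (hD'p _ (hξS s)).2 ((hc _ (hξS s)).2.1 fun f hf => ?_)
    refine (hfactor _ (hξS s) f hf ?_).resolve_right hs
    rcases hf with hf | hf
    · exact (hξ₁ s).1 f hf
    · rw [aeval_eq_eval_fiberAt, hI' _ (hξS s) f hf, Polynomial.eval_zero]

end Agreement

section Family

variable {R : Type*} [Field R] [LinearOrder R] {n : ℕ} {S : Set (Fin n → R)}

theorem IsDelineatedBy.eq_or_forall_ne {D : BasicConstructible R (Fin 1 ⊕ Fin n)} {m : ℕ}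
    {ξ : Fin m → S → (Fin 1 ⊕ Fin n → R)} (hD : IsDelineatedBy D S m ξ) (i j : Fin m) :
    ξ i = ξ j ∨ ∀ s, ξ i s ≠ ξ j s := by
  rcases lt_trichotomy i j with h | rfl | h
  · exact Or.inr fun s hs => (hD.strictMono i j s h).ne (congr_fun hs _)
  · exact Or.inl rfl
  · exact Or.inr fun s hs => (hD.strictMono j i s h).ne' (congr_fun hs _)

theorem isGeometricallyDelineableFamily_pair {T T' : BasicConstructible R (Fin 1 ⊕ Fin n)}
    {m m' : ℕ} {ξ : Fin m → S → (Fin 1 ⊕ Fin n → R)} {ξ' : Fin m' → S → (Fin 1 ⊕ Fin n → R)}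
    (hT : HasSections S m ξ T) (hT' : HasSections S m' ξ' T')
    (h : ∀ i j, ξ i = ξ j ∨ ∀ s, ξ i s ≠ ξ j s) (h' : ∀ i j, ξ' i = ξ' j ∨ ∀ s, ξ' i s ≠ ξ' j s)
    (hh' : ∀ i j, ξ i = ξ' j ∨ ∀ s, ξ i s ≠ ξ' j s) :
    IsGeometricallyDelineableFamily ![T, T'] S := by
  refine ⟨![m, m'], fun i => match i with | 0 => ξ | 1 => ξ', ?_, ?_⟩
  · rw [Fin.forall_fin_two]
    exact ⟨hT, hT'⟩
  · rw [Fin.forall_fin_two]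
    refine ⟨fun a => ?_, fun a => ?_⟩
    · rw [Fin.forall_fin_two]
      exact ⟨h a, hh' a⟩
    · rw [Fin.forall_fin_two]
      refine ⟨fun b => ?_, h' a⟩
      rcases hh' b a with h | h
      exacts [Or.inl h.symm, Or.inr fun s => (h s).symm]

end Family

/-! ### Delineability of the pair -/

section FirstMember

variable {k : Type*} [Field k] {R : Type*} [Field R] [LinearOrder R] [Algebra k R] {n : ℕ}
  {S : Set (Fin n → R)} {m : ℕ} {ξ : Fin m → S → (Fin 1 ⊕ Fin n → R)}

/-- In the two situations in which `Proj2` calls `Proj2Sub` at `I₁`, the sections of `V(I) ∩ D(h)`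
are those of an open part `V(I₁) ∩ D(o)` of `V(I₁)`: here `o = h` if `I₁` extends `I`, and `o = 1`
if `I` vanishes over `S` and `I₁` extends `⟨h⟩`. The mixed cases are excluded or void, because the
fibres of a delineated set are finite. -/
theorem IsDelineatedBy.exists_mem_points_iff [Infinite R] {D : BasicConstructible R (Fin 1 ⊕ Fin n)}
    (hD : IsDelineatedBy D S m ξ) (hne : S.Nonempty)
    {I I₁ K : Ideal (MvPolynomial (Fin 1 ⊕ Fin n) k)} {h : MvPolynomial (Fin 1 ⊕ Fin n) k}
    (hK : ∀ a ∈ S, ∀ f ∈ K, fiberAt k a f = 0) (hI₁ : ∀ a ∈ S, ∃ f ∈ I₁, fiberAt k a f ≠ 0)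
    (hcase : (I ≤ I₁ ∧ I₁ ≤ I ⊔ K) ∨ (I ≤ K ∧ Ideal.span {h} ≤ I₁ ∧ I₁ ≤ Ideal.span {h} ⊔ K))
    (hDp : (∀ p : Fin 1 ⊕ Fin n → R, p ∘ Sum.inr ∈ S →
          (p ∈ D.points ↔ (∀ f ∈ I, aeval p f = 0) ∧ aeval p h ≠ 0)) ∨
        (∀ a ∈ S, ∀ f ∈ I, fiberAt k a f = 0) ∧ ∀ p : Fin 1 ⊕ Fin n → R, p ∘ Sum.inr ∈ S →
          (p ∈ D.points ↔ aeval p h = 0)) :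
    m = 0 ∨ ∃ o : MvPolynomial (Fin 1 ⊕ Fin n) k, ∀ p : Fin 1 ⊕ Fin n → R, p ∘ Sum.inr ∈ S →
      (p ∈ D.points ↔ (∀ f ∈ I₁, aeval p f = 0) ∧ aeval p o ≠ 0) := by
  have hKp : ∀ p : Fin 1 ⊕ Fin n → R, p ∘ Sum.inr ∈ S → ∀ f ∈ K, aeval p f = 0 := by
    intro p hp f hf
    rw [aeval_eq_eval_fiberAt, hK _ hp f hf, Polynomial.eval_zero]
  -- an ideal between `Q` and `Q + K` has the same zeros over `S` as `Q`
  have hzeros : ∀ {Q : Ideal (MvPolynomial (Fin 1 ⊕ Fin n) k)}, Q ≤ I₁ → I₁ ≤ Q ⊔ K →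
      ∀ p : Fin 1 ⊕ Fin n → R, p ∘ Sum.inr ∈ S →
        ((∀ f ∈ I₁, aeval p f = 0) ↔ ∀ f ∈ Q, aeval p f = 0) := by
    intro Q h1 h2 p hp
    refine ⟨fun h f hf => h f (h1 hf), fun h f hf => ?_⟩
    obtain ⟨f₁, hf₁, f₂, hf₂, rfl⟩ := Submodule.mem_sup.1 (h2 hf)
    rw [map_add, h f₁ hf₁, hKp p hp f₂ hf₂, add_zero]
  rcases hcase with ⟨h1, h2⟩ | ⟨h1, h2, h3⟩
  · rcases hDp with hDp | ⟨hI, -⟩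
    · refine Or.inr ⟨h, fun p hp => ?_⟩
      rw [hDp p hp, hzeros h1 h2 p hp]
    · -- `I₁` would vanish over `S`
      exfalso
      obtain ⟨a, ha⟩ := hne
      obtain ⟨f, hf, hf0⟩ := hI₁ a ha
      obtain ⟨f₁, hf₁, f₂, hf₂, rfl⟩ := Submodule.mem_sup.1 (h2 hf)
      exact hf0 (by rw [map_add, hI a ha f₁ hf₁, hK a ha f₂ hf₂, add_zero])
  · rcases hDp with hDp | ⟨-, hDp⟩
    · -- the fibres of `D(h)` are finite only if they are empty
      refine Or.inl (Nat.eq_zero_of_not_pos fun hm => ?_)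
      obtain ⟨a, ha⟩ := hne
      have h0 : fiberAt k a h = 0 := by
        refine Polynomial.eq_zero_of_finite_of_eval_ne_zero (hD.finite_fiber ha) fun t ht => ?_
        refine (hDp (Sum.elim (fun _ => t) a) ha).2
          ⟨fun f hf => hKp (Sum.elim (fun _ => t) a) ha f (h1 hf), ?_⟩
        rwa [eval_fiberAt] at ht
      have hpa : ξ ⟨0, hm⟩ ⟨a, ha⟩ ∘ Sum.inr = a := hD.proj_eq _ _
      have hpS : ξ ⟨0, hm⟩ ⟨a, ha⟩ ∘ Sum.inr ∈ S := by rw [hpa]; exact ha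
      refine ((hDp _ hpS).1 (hD.mem_points ⟨0, hm⟩ ⟨a, ha⟩)).2 ?_
      rw [aeval_eq_eval_fiberAt, hpa, h0, Polynomial.eval_zero]
    · refine Or.inr ⟨1, fun p hp => ?_⟩
      rw [hDp p hp, hzeros h2 h3 p hp, map_one, and_iff_left one_ne_zero]
      refine ⟨fun h0 f hf => ?_, fun h0 => h0 h (Ideal.mem_span_singleton_self h)⟩
      obtain ⟨g, rfl⟩ := Ideal.mem_span_singleton.1 hf
      rw [map_mul, h0, zero_mul]

end FirstMember

theorem mainTheorem11 {k : Type*} [Field k] {R : Type*} [Field R] [LinearOrder R]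
    [IsStrictOrderedRing R] [IsRealClosed R] [Algebra k R] (n : ℕ)
    (Ty : MonomialOrder (Fin n)) (Txz : MonomialOrder (Fin 2)) :
    (∀ (I₀ : Ideal (MvPolynomial (Fin 1 ⊕ Fin n) k)) (J₀ : Ideal (MvPolynomial (Fin n) k))
        (h' : MvPolynomial (Fin 1 ⊕ Fin n) k) (w : MvPolynomial (Fin n) k),
        J₀.IsPrime → J₀ ≤ I₀.comap (baseIncl k (Fin 1) n) →
        ∃ L, Proj2SubReturns Ty Txz I₀ J₀ h' w L) ∧
    ∀ (I I' : Ideal (MvPolynomial (Fin 1 ⊕ Fin n) k)) (J : Ideal (MvPolynomial (Fin n) k))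
      (h h' : MvPolynomial (Fin 1 ⊕ Fin n) k),
      J.IsPrime → J ≤ I.comap (baseIncl k (Fin 1) n) →
      (∃ L, Proj2Returns Ty Txz I I' J h h' L) ∧
      ∀ L, Proj2Returns Ty Txz I I' J h h' L → ∀ B ∈ L, ∀ S : Set (Fin n → R),
        IsSemialgebraic S → IsSemialgebraicallyConnected S → S ⊆ (B.baseChange R).points →
        IsGeometricallyDelineable ((BasicConstructible.mk I h).baseChange R) S →
        IsGeometricallyDelineable ((BasicConstructible.mk I' h').baseChange R) S →
        IsGeometricallyDelineableFamily
          ![(BasicConstructible.mk I h).baseChange R, (BasicConstructible.mk I' h').baseChange R]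
          S := by
  refine ⟨fun I₀ J₀ h' w hJ₀ hJI => ?_, fun I I' J h h' hJ hJI => ⟨?_, ?_⟩⟩
  · obtain ⟨N, L, hL⟩ := exists_proj2SubRun_eq_some Ty Txz h' w J₀ hJ₀ I₀ hJI
    exact ⟨L, N, hL⟩
  · obtain ⟨N, L, hL⟩ := exists_proj2Run_eq_some Ty Txz I' h h' J hJ I hJI
    exact ⟨L, N, hL⟩
  rintro L ⟨N, hL⟩ B hB S hS hconn hSB ⟨m, ξ, hξ⟩ ⟨m', ξ', hξ'⟩
  rcases S.eq_empty_or_nonempty with rfl | hne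
  · exact isGeometricallyDelineableFamily_pair hξ hξ' (fun _ _ => Or.inr fun s => s.2.elim)
      (fun _ _ => Or.inr fun s => s.2.elim) (fun _ _ => Or.inr fun s => s.2.elim)
  have : Infinite R := Infinite.of_injective (Nat.cast : ℕ → R) Nat.cast_injective
  obtain ⟨I₁, J₁, -, hJ₁, hne₁, ⟨M, Ls, hLs, hBs⟩, hcase⟩ := exists_of_mem_proj2Run hL hB
  obtain ⟨I₂, P, hle, hle', hP, rfl⟩ := exists_of_mem_proj2SubRun hLs hBs
  have hpt : ∀ a ∈ S, (∀ f ∈ P, aeval a f = 0) ∧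
      aeval a (leadingCoeffProduct MonomialOrder.lex Ty I₁ J₁) ≠ 0 ∧
      aeval a (leadingCoeffProduct Txz Ty (rabinowitschIdeal I₂ h') P) ≠ 0 := by
    intro a ha
    have := BasicConstructible.mem_points_baseChange.1 (hSB ha)
    rw [map_mul, mul_ne_zero_iff] at this
    exact this
  -- modulo polynomials that vanish over `S`, the ideal `I₂` is generated by `I₁` and `I'`
  have hPmap : ∀ a ∈ S, ∀ f ∈ P.map (baseIncl k (Fin 1) n), fiberAt k a f = 0 := by
    intro a ha
    have : P.map (baseIncl k (Fin 1) n) ≤ RingHom.ker (fiberAt k a) := by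
      refine Ideal.map_le_iff_le_comap.2 fun f hf => ?_
      rw [Ideal.mem_comap, RingHom.mem_ker, fiberAt_baseIncl, (hpt a ha).1 f hf, map_zero]
    exact fun f hf => this hf
  have hJP : J₁ ≤ P := by
    rw [← hJ₁, ← hP]
    exact Ideal.comap_mono (le_sup_left.trans hle)
  have hI₁ : ∀ a ∈ S, ∃ f ∈ I₁, fiberAt k a f ≠ 0 := fun a ha =>
    exists_fiberAt_ne_zero hJ₁.ge hne₁ (hpt a ha).2.1
  obtain ⟨c, e, hce⟩ := exists_local_equation Ty Txz I₂ h' P hne (fun a ha => (hpt a ha).1)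
    (fun a ha => (hpt a ha).2.2)
    (fun a ha => (hI₁ a ha).imp fun f hf => ⟨hle (Ideal.mem_sup_left hf.1), hf.2⟩)
    (F := {f | f ∈ I₁ ∨ f ∈ I'})
    (fun f hf => hle (hf.elim (fun h => Ideal.mem_sup_left h) fun h => Ideal.mem_sup_right h))
    (fun a ha => Ideal.map_le_iff_le_comap.2 (hle'.trans (sup_le (sup_le
      (fun f hf => Ideal.subset_span ⟨f, Or.inl hf, rfl⟩)
      (fun f hf => Ideal.subset_span ⟨f, Or.inr hf, rfl⟩))
      (fun f hf => by rw [Ideal.mem_comap, hPmap a ha f hf]; exact Ideal.zero_mem _))))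
  have hc : ∀ p : Fin 1 ⊕ Fin n → R, p ∘ Sum.inr ∈ S →
      (∀ f, f ∈ I₁ ∨ f ∈ I' → ∃ u : R, u ≠ 0 ∧ u * aeval p f = aeval p (e f) * aeval p c) ∧
      ((∀ f, f ∈ I₁ ∨ f ∈ I' → aeval p (e f) = 0) → aeval p h' = 0) ∧
      (aeval p c = 0 → aeval p h' ≠ 0) := fun p hp =>
    ⟨fun f hf => (hce p hp).1 f (hle (hf.elim (fun h => Ideal.mem_sup_left h)
      fun h => Ideal.mem_sup_right h)), (hce p hp).2⟩
  have hself : ∀ {m : ℕ} {ξ : Fin m → S → (Fin 1 ⊕ Fin n → R)}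
      {I : Ideal (MvPolynomial (Fin 1 ⊕ Fin n) k)} {h : MvPolynomial (Fin 1 ⊕ Fin n) k},
      HasSections S m ξ ((BasicConstructible.mk I h).baseChange R) →
      ∀ i j, ξ i = ξ j ∨ ∀ s, ξ i s ≠ ξ j s := by
    intro m ξ I h hξ i j
    rcases hξ.exists_isDelineatedBy hne with h0 | ⟨D, hD, -⟩
    · exact absurd i.2 (by omega)
    · exact hD.eq_or_forall_ne i j
  refine isGeometricallyDelineableFamily_pair hξ hξ' (hself hξ) (hself hξ') fun i j => ?_
  rcases hξ.exists_isDelineatedBy hne with h0 | ⟨D, hD, hDp⟩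
  · exact absurd i.2 (by omega)
  rcases hξ'.exists_isDelineatedBy hne with h0 | ⟨D', hD', hDp'⟩
  · exact absurd j.2 (by omega)
  rcases hD.exists_mem_points_iff hne
    (fun a ha f hf => hPmap a ha f (Ideal.map_mono hJP hf)) hI₁ hcase hDp with h0 | ⟨o, ho⟩
  · exact absurd i.2 (by omega)
  exact hconn.eq_or_forall_ne hS (hD.semialgebraic i) (hD.continuous i) (hD.proj_eq i)
    (hD'.semialgebraic j) (hD'.continuous j) (hD'.proj_eq j)
    fun s₀ h₀ => hD.eventually_eq_of_eq hD' ho hDp' hc h₀
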